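/- A hyperbolic $n$-manifold is a manifold without boundary, with its path metric, which is locally isometric to $\mathbb{H}^n$; a geodesic is a locally distance-minimizing path parametrized by arc length. A pleated surface in a hyperbolic $3$-manifold $N$ is a complete hyperbolic surface $S$ together with a continuous map $f\colon S\to N$ such that (a) every geodesic segment in $S$ is taken by $f$ to a rectifiable arc in $N$ of the same length, and (b) for each $x\in S$ there is at least one open geodesic segment $l_x$ through $x$ which $f$ maps to a geodesic segment of $N$ (that is, $f$ carries the arc-length parametrization of $l_x$ to a geodesic of $N$). The pleating locus $\Pi(f)$ is the set of points $x\in S$ for which the germ at $x$ of such a segment $l_x$ is unique (as an unoriented germ). A geodesic lamination on $S$ is a closed subset $L\subseteq S$, possibly empty, together with a foliation of $L$ by complete geodesics of $S$: a partition of $L$ into leaves, each the image of a complete geodesic $\mathbb{R}\to S$, such that each point of $L$ has an open neighbourhood $U$ in $S$ and a homeomorphism $U\to\mathbb{R}\times\mathbb{R}$ taking $L\cap U$ to $B\times\mathbb{R}$ for some $B\subseteq\mathbb{R}$, and taking the connected components of $l\cap U$, for every leaf $l$, to sets of the form $\{b\}\times\mathbb{R}$. **Proposition.** Let $f\colon S\to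 N$ be a pleated surface. Then $\Pi(f)$ has the structure of a geodesic lamination on $S$: there is a geodesic lamination on $S$ with underlying closed set $\Pi(f)$, and each of its leaves is the image of a complete geodesic $\gamma\colon\mathbb{R}\to S$ for which $f\circ\gamma$ is a geodesic of $N$ (so that the leaf through $x\in\Pi(f)$ has the germ of $l_x$ at $x$). -/

import Mathlib

open Set Filter Topology

namespace PleatedSurfaces

/-! ### Hyperbolic space (hyperboloid model) -/

/-- Hyperbolic `n`-space: the upper sheet `t ^ 2 - ‖v‖ ^ 2 = 1`, `t > 0`, of the hyperboloid
in Minkowski space `ℝ × ℝⁿ`. -/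
@[ext]
structure HypSpace (n : ℕ) where
  time : ℝ
  space : EuclideanSpace ℝ (Fin n)
  time_pos : 0 < time
  time_sq : time ^ 2 = 1 + ‖space‖ ^ 2

namespace HypSpace

variable {n : ℕ}

/-- Minus the Minkowski inner product of two points of the hyperboloid. -/
noncomputable def form (x y : HypSpace n) : ℝ :=
  x.time * y.time - inner ℝ x.space y.space

/-- The hyperbolic metric: `cosh (dist x y) = form x y`. -/
noncomputable instance : Dist (HypSpace n) := ⟨fun x y => Real.arcosh (form x y)⟩

theorem dist_def (x y : HypSpace n) : dist x y = Real.arcosh (form x y) := rfl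

theorem form_comm (x y : HypSpace n) : form x y = form y x := by
  simp only [form, real_inner_comm, mul_comm]

theorem form_self (x : HypSpace n) : form x x = 1 := by
  have := x.time_sq
  simp only [form, real_inner_self_eq_norm_sq]
  nlinarith

theorem one_add_le (x y : HypSpace n) : 1 + ‖x.space‖ * ‖y.space‖ ≤ x.time * y.time := by
  have hx := x.time_sq
  have hy := y.time_sq
  have hxy := mul_pos x.time_pos y.time_pos
  refine le_of_sq_le_sq ?_ hxy.le
  rw [mul_pow, hx, hy]
  nlinarith [sq_nonneg (‖x.space‖ - ‖y.space‖)]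
where
  le_of_sq_le_sq {a b : ℝ} (h : a ^ 2 ≤ b ^ 2) (hb : 0 ≤ b) : a ≤ b := by
    exact le_of_abs_le (abs_le_of_sq_le_sq h hb)

theorem one_le_form (x y : HypSpace n) : 1 ≤ form x y := by
  have h := one_add_le x y
  have := real_inner_le_norm x.space y.space
  simp only [form]
  linarith

theorem cosh_dist (x y : HypSpace n) : Real.cosh (dist x y) = form x y :=
  Real.cosh_arcosh (one_le_form x y)

theorem eq_of_form_eq_one {x y : HypSpace n} (h : form x y = 1) : x = y := by
  have h1 := one_add_le x y
  have h2 := real_inner_le_norm x.space y.space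
  have hx := x.time_sq
  have hy := y.time_sq
  have h3 : x.time * y.time = 1 + ‖x.space‖ * ‖y.space‖ := by
    simp only [form] at h
    linarith
  have h4 : (‖x.space‖ - ‖y.space‖) ^ 2 = 0 := by
    have h5 : (x.time * y.time) ^ 2 = (1 + ‖x.space‖ * ‖y.space‖) ^ 2 := by rw [h3]
    rw [mul_pow, hx, hy] at h5
    nlinarith
  have h6 : ‖x.space‖ = ‖y.space‖ := by
    have := pow_eq_zero_iff (two_ne_zero) |>.1 h4
    linarith
  have h7 : ‖x.space - y.space‖ ^ 2 = 0 := by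
    rw [norm_sub_sq_real]
    simp only [form] at h
    rw [h6] at h3 ⊢
    nlinarith
  have h8 : x.space = y.space := by
    have := pow_eq_zero_iff (two_ne_zero) |>.1 h7
    exact sub_eq_zero.1 (norm_eq_zero.1 this)
  have h9 : x.time = y.time := by
    have h10 : x.time ^ 2 = y.time ^ 2 := by rw [hx, hy, h6]
    exact (pow_left_inj₀ x.time_pos.le y.time_pos.le two_ne_zero).1 h10
  exact HypSpace.ext h9 h8

/-- The Minkowski-orthogonal complement of a point `y` is Euclidean; `proj y x` is the component
of `x` in it, in Euclidean coordinates. -/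
noncomputable def proj (y x : HypSpace n) : EuclideanSpace ℝ (Fin n) :=
  (x.space - form x y • y.space) -
    ((x.time - form x y * y.time) / (1 + y.time)) • y.space

theorem inner_proj (x y z : HypSpace n) :
    inner ℝ (proj y x) (proj y z) = form x y * form z y - form x z := by
  have hy := y.time_sq
  have hp := y.time_pos
  have hne : (1 + y.time) ≠ 0 := by positivity
  have e1 : inner ℝ x.space y.space = x.time * y.time - form x y := by simp [form]
  have e2 : inner ℝ z.space y.space = z.time * y.time - form z y := by simp [form]
  have e3 : inner ℝ x.space z.space = x.time * z.time - form x z := by simp [form]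
  have e4 : inner ℝ y.space y.space = y.time ^ 2 - 1 := by
    rw [real_inner_self_eq_norm_sq]; linarith
  have e5 : inner ℝ y.space z.space = z.time * y.time - form z y := by
    rw [real_inner_comm]; exact e2
  simp only [proj, inner_sub_left, inner_sub_right, real_inner_smul_left, real_inner_smul_right,
    e1, e3, e4, e5]
  field_simp
  ring

theorem norm_proj (x y : HypSpace n) : ‖proj y x‖ = Real.sinh (dist x y) := by
  have h := inner_proj x y x
  rw [real_inner_self_eq_norm_sq, form_self] at h
  rw [dist_def, Real.sinh_arcosh (one_le_form x y), ← Real.sqrt_sq (norm_nonneg (proj y x)), h]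
  ring_nf

theorem dist_nonneg' (x y : HypSpace n) : 0 ≤ dist x y :=
  Real.arcosh_nonneg (one_le_form x y)

theorem dist_triangle' (x y z : HypSpace n) : dist x z ≤ dist x y + dist y z := by
  have h1 := inner_proj x y z
  have h2 := neg_le_of_abs_le (abs_real_inner_le_norm (proj y x) (proj y z))
  have hc : dist y z = dist z y := by rw [dist_def, dist_def, form_comm]
  rw [norm_proj, norm_proj, h1] at h2
  have h3 : Real.cosh (dist x z) ≤ Real.cosh (dist x y + dist y z) := by
    rw [Real.cosh_add, cosh_dist, cosh_dist, hc, cosh_dist]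
    linarith
  have h4 := Real.cosh_le_cosh.1 h3
  rwa [abs_of_nonneg (dist_nonneg' x z),
    abs_of_nonneg (add_nonneg (dist_nonneg' x y) (dist_nonneg' y z))] at h4

noncomputable instance : MetricSpace (HypSpace n) where
  dist_self x := by rw [dist_def, form_self, Real.arcosh_zero]
  dist_comm x y := by rw [dist_def, dist_def, form_comm]
  dist_triangle := dist_triangle'
  eq_of_dist_eq_zero {x y} h :=
    eq_of_form_eq_one ((Real.arcosh_eq_zero_iff (one_le_form x y)).1 h)

end HypSpace

/-! ### Hyperbolic manifolds and their geodesics -/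

/-- A hyperbolic `n`-manifold (without boundary), as a metric object: a space that is locally
isometric to hyperbolic `n`-space, in which the distance between two points is the infimum of the
lengths of the paths joining them (`⊤` if there are none, so disconnected manifolds are allowed).
The length of a path is its total variation `eVariationOn`. -/
class IsHyperbolicManifold (n : ℕ) (M : Type*) [EMetricSpace M] : Prop where
  locally_isometric : ∀ x : M, ∃ r > 0, ∃ c : HypSpace n,
    Nonempty (Metric.eball x r ≃ᵢ Metric.eball c r)
  edist_eq_iInf_length : ∀ x y : M, edist x y = ⨅ γ : Path x y, eVariationOn γ univ

/-- `γ` is a unit-speed geodesic on the interval `I` (in the Riemannian sense: locally, the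
distance between two of its points equals the difference of the parameters). -/
def IsGeodesicOn {M : Type*} [EMetricSpace M] (γ : ℝ → M) (I : Set ℝ) : Prop :=
  ∀ t ∈ I, ∃ δ > 0, ∀ s ∈ I ∩ Metric.ball t δ, ∀ s' ∈ I ∩ Metric.ball t δ,
    edist (γ s) (γ s') = edist s s'

/-! ### Pleated surfaces -/

section Pleated

variable {S N : Type*} [EMetricSpace S] [EMetricSpace N]

/-- `γ`, restricted to a small interval around `0`, is an open geodesic segment through `x = γ 0`
which `f` maps to a geodesic segment. -/
def IsMappedGeodesicAt (f : S → N) (x : S) (γ : ℝ → S) : Prop :=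
  γ 0 = x ∧ ∃ ε > 0, IsGeodesicOn γ (Ioo (-ε) ε) ∧ IsGeodesicOn (f ∘ γ) (Ioo (-ε) ε)

/-- Two geodesic segments through the same point, both parametrized by arc length from that point,
have the same (unoriented) germ there. -/
def SameGerm (γ₁ γ₂ : ℝ → S) : Prop :=
  γ₁ =ᶠ[𝓝 0] γ₂ ∨ γ₁ =ᶠ[𝓝 0] fun t => γ₂ (-t)

/-- `f : S → N` is a pleated surface (`S` is meant to be a complete hyperbolic surface and `N` a
hyperbolic 3-manifold): it is continuous, takes every geodesic segment to a rectifiable arc of the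
same length, and through every point there is an open geodesic segment which is mapped to a
geodesic segment. -/
structure IsPleatedSurface (f : S → N) : Prop where
  continuous : Continuous f
  isometric : ∀ (γ : ℝ → S) (a b : ℝ), a ≤ b → IsGeodesicOn γ (Icc a b) →
    eVariationOn (f ∘ γ) (Icc a b) ≠ ⊤ ∧
      eVariationOn (f ∘ γ) (Icc a b) = eVariationOn γ (Icc a b)
  exists_segment : ∀ x : S, ∃ γ : ℝ → S, IsMappedGeodesicAt f x γ

/-- The pleating locus: the points `x` for which the germ at `x` of a geodesic segment through `x`
that is mapped to a geodesic segment is unique. -/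
def pleatingLocus (f : S → N) : Set S :=
  {x | (∃ γ : ℝ → S, IsMappedGeodesicAt f x γ) ∧
    ∀ γ₁ γ₂ : ℝ → S, IsMappedGeodesicAt f x γ₁ → IsMappedGeodesicAt f x γ₂ → SameGerm γ₁ γ₂}

end Pleated

/-! ### Geodesic laminations -/

/-- A chart `e` of a surface, onto the plane, is a foliation chart for the partition `leaves` of
`L` if it takes `L` to a union `B × ℝ` of vertical lines `{b} × ℝ` (plaques), and the connected components
of the trace of each leaf on the domain of the chart are plaques. -/
def IsLaminationChart {S : Type*} [TopologicalSpace S] (L : Set S) (leaves : Set (Set S))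
    (e : OpenPartialHomeomorph S (ℝ × ℝ)) : Prop :=
  e.target = univ ∧
  (∃ B : Set ℝ, ∀ p ∈ e.source, p ∈ L ↔ (e p).1 ∈ B) ∧
  ∀ l ∈ leaves, ∀ p ∈ l ∩ e.source,
    connectedComponentIn (l ∩ e.source) p = {q ∈ e.source | (e q).1 = (e p).1}

/-- A geodesic lamination on a hyperbolic surface: a closed set together with a foliation of it by
(complete) geodesics. The leaves are automatically simple, because their traces in the
foliation charts consist of disjoint plaques. -/
structure GeodesicLamination (S : Type*) [EMetricSpace S] where
  /-- the underlying closed set -/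
  support : Set S
  /-- the leaves of the foliation -/
  leaves : Set (Set S)
  isClosed_support : IsClosed support
  sUnion_leaves : ⋃₀ leaves = support
  pairwiseDisjoint_leaves : leaves.PairwiseDisjoint id
  exists_geodesic : ∀ l ∈ leaves, ∃ γ : ℝ → S, IsGeodesicOn γ univ ∧ range γ = l
  exists_chart : ∀ x ∈ support, ∃ e : OpenPartialHomeomorph S (ℝ × ℝ),
    x ∈ e.source ∧ IsLaminationChart support leaves e

end PleatedSurfaces

/-!
The pleating locus `Π` of a pleated surface `f : S → N` is the complement of the set where `f` is
locally isometric, and its leaves are the complete geodesics which prolong the segments `l_x`.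

*Rigidity.* Since geodesic segments keep their lengths, `f` does not increase distances locally
(`PleatedChart.edist_le`). In the hyperboloid model `cosh (dist x y)` is the Minkowski product of
`x` and `y`, and a point of a segment is a positive linear combination of the end points. If a
segment from `a` to `b` is mapped to a geodesic segment, and the distance from an interior point
`q` to `c` is preserved, then a positive combination of the products of `a` and `b` with `c` is
preserved. No product increases, so both are preserved (`HypSpace.dist_eq_of_tripod`), and `f` acts
on the triangle `abc` as a linear isometry. Hence `f` is isometric near the interior points of a
segment which is mapped to a geodesic segment and crosses another one
(`HypSpace.isometric_of_crossing`), and near the interior points of a distance-preserving segment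
which starts on a transverse segment of this kind (`HypSpace.isometric_of_tripod`).

*The locus.* If the germ of `l_x` is not unique then two such segments cross at `x`, and `f` is
isometric near `x`; conversely, where `f` is isometric all directions are possible. Thus `Π` is
closed (`IsPleatedSurface.mem_pleatingLocus_iff`). A geodesic which is mapped to a geodesic and
meets `Π` stays in `Π`, since otherwise it would be crossed by another one and `f` would be
isometric along it (`IsPleatedSurface.mem_pleatingLocus_of_straight`). By completeness of `S` such
a path has a limit point at the end of a finite interval of definition. This point is in `Π`, and
by the tripod lemma the path is tangent to `l_x` there, which prolongs it. So the leaves are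
complete geodesics (`IsPleatedSurface.exists_complete_straight`), and distinct leaves are disjoint
by uniqueness of the germs.

*Foliation charts.* In the Klein model the leaves are disjoint straight segments
(`exists_boxChart`). Two segments whose slopes differed by more than their base points on a
transversal would cross in the chart, so that the slope is a Lipschitz function of the base point,
on a subset of the transversal. Extending this function to the real line gives a shear homeomorphism
which makes all leaves vertical (`exists_straightening`). A leaf meets only countably many vertical
lines of such a chart, so the connected components of its trace are single vertical lines
(`IsPleatedSurface.exists_laminationChart`).
-/

namespace PleatedSurfaces

/-! ### Linear algebra of the hyperboloid -/

/-- Minkowski space `ℝ × ℝⁿ`. -/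
abbrev Mink (n : ℕ) := ℝ × EuclideanSpace ℝ (Fin n)

/-- Minus the Minkowski inner product, so that points of hyperbolic space have norm `1` and
tangent vectors have negative norm. -/
noncomputable def mink {n : ℕ} (x y : Mink n) : ℝ := x.1 * y.1 - inner ℝ x.2 y.2

section mink
variable {n : ℕ} (x y z : Mink n) (c : ℝ)

theorem mink_comm : mink x y = mink y x := by simp only [mink, real_inner_comm, mul_comm]
theorem mink_add_left : mink (x + y) z = mink x z + mink y z := by
  simp only [mink, Prod.fst_add, Prod.snd_add, inner_add_left]; ring
theorem mink_smul_left : mink (c • x) y = c * mink x y := by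
  simp only [mink, Prod.smul_fst, Prod.smul_snd, real_inner_smul_left, smul_eq_mul]; ring
theorem mink_add_right : mink x (y + z) = mink x y + mink x z := by
  rw [mink_comm, mink_add_left, mink_comm y, mink_comm z]
theorem mink_smul_right : mink x (c • y) = c * mink x y := by
  rw [mink_comm, mink_smul_left, mink_comm]

end mink

namespace HypSpace

variable {n : ℕ}

/-- A point of hyperbolic space as a vector of Minkowski space. -/
def vec (x : HypSpace n) : Mink n := (x.time, x.space)

theorem vec_injective : Function.Injective (vec : HypSpace n → Mink n) := fun x y h => by
  simp only [vec, Prod.mk.injEq] at h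
  exact HypSpace.ext h.1 h.2

theorem mink_vec (x y : HypSpace n) : mink x.vec y.vec = form x y := rfl

/-- The orthogonal complement of a point of the hyperboloid is negative definite for `mink`. -/
theorem mink_self_neg (p : HypSpace n) {Z : Mink n} (h1 : mink p.vec Z = 0) (hZ : Z ≠ 0) :
    mink Z Z < 0 := by
  have hp := p.time_sq
  have hp0 := p.time_pos
  have h2 : p.time * Z.1 = inner ℝ p.space Z.2 := by
    simp only [mink, vec] at h1; linarith
  have h3 : (inner ℝ p.space Z.2) ^ 2 ≤ ‖p.space‖ ^ 2 * ‖Z.2‖ ^ 2 := by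
    rw [← mul_pow]; exact sq_le_sq' (neg_le_of_abs_le (abs_real_inner_le_norm _ _))
      (real_inner_le_norm _ _)
  rw [← h2] at h3
  have h4 : Z.1 ^ 2 ≤ ‖Z.2‖ ^ 2 - ‖Z.2‖ ^ 2 / p.time ^ 2 := by
    field_simp
    nlinarith
  have h5 : Z.2 ≠ 0 := by
    intro h
    apply hZ
    rw [h, inner_zero_right] at h2
    exact Prod.ext ((mul_eq_zero.1 h2).resolve_left hp0.ne') h
  have h6 : 0 < ‖Z.2‖ ^ 2 := by positivity
  have h7 : 0 < ‖Z.2‖ ^ 2 / p.time ^ 2 :=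
    div_pos h6 (by positivity)
  simp only [mink, real_inner_self_eq_norm_sq]
  nlinarith

theorem eq_zero_of_mink (p : HypSpace n) {Z : Mink n} (h1 : mink p.vec Z = 0)
    (h2 : 0 ≤ mink Z Z) : Z = 0 := by
  by_contra h
  exact absurd (mink_self_neg p h1 h) (not_lt.2 h2)

/-- The hyperboloid equation and positivity against one point characterise the upper sheet. -/
theorem exists_vec_eq (p : HypSpace n) {X : Mink n} (h : mink X X = 1)
    (hp : 0 < mink p.vec X) : ∃ q : HypSpace n, q.vec = X := by
  have h1 : X.1 ^ 2 = 1 + ‖X.2‖ ^ 2 := by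
    simp only [mink, real_inner_self_eq_norm_sq] at h; linarith
  refine ⟨⟨X.1, X.2, ?_, h1⟩, rfl⟩
  by_contra hX
  have h2 : ‖X.2‖ ≤ -X.1 := abs_le_of_sq_le_sq (by nlinarith) (by linarith) |> le_of_abs_le
  have h3 : ‖p.space‖ ≤ p.time :=
    le_of_abs_le (abs_le_of_sq_le_sq (by nlinarith [p.time_sq]) p.time_pos.le)
  have h4 := neg_le_of_abs_le (abs_real_inner_le_norm p.space X.2)
  simp only [mink, vec] at hp
  nlinarith [mul_le_mul h3 h2 (norm_nonneg _) p.time_pos.le]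

/-- Three points which lie on a unit-speed geodesic at the times `a`, `b`, `c` satisfy an explicit
linear relation. -/
theorem sinh_smul_vec_add (p q r : HypSpace n) (a b c : ℝ) (hpq : dist p q = |a - b|)
    (hqr : dist q r = |b - c|) (hpr : dist p r = |a - c|) :
    Real.sinh (c - b) • p.vec + Real.sinh (a - c) • q.vec + Real.sinh (b - a) • r.vec = 0 := by
  have e1 : form p q = Real.cosh (a - b) := by rw [← cosh_dist, hpq, Real.cosh_abs]
  have e2 : form q r = Real.cosh (b - c) := by rw [← cosh_dist, hqr, Real.cosh_abs]
  have e3 : form p r = Real.cosh (a - c) := by rw [← cosh_dist, hpr, Real.cosh_abs]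
  have hc := Real.cosh_sq' a
  have hb := Real.cosh_sq' b
  have hd := Real.cosh_sq' c
  have hp : mink p.vec
      (Real.sinh (c - b) • p.vec + Real.sinh (a - c) • q.vec + Real.sinh (b - a) • r.vec) = 0 := by
    simp only [mink_add_right, mink_smul_right, mink_vec, form_self, e1, e3, Real.sinh_sub,
      Real.cosh_sub]
    linear_combination (Real.cosh c * Real.sinh b - Real.sinh c * Real.cosh b) * hc
  refine eq_zero_of_mink p hp (le_of_eq ?_)
  simp only [mink_add_right, mink_smul_right, mink_add_left, mink_smul_left, mink_vec, form_self,
    form_comm q p, form_comm r p, form_comm r q, e1, e2, e3] at hp ⊢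
  have hq : Real.sinh (c - b) * Real.cosh (a - b) + Real.sinh (a - c)  +
      Real.sinh (b - a) * Real.cosh (b - c) = 0 := by
    simp only [Real.sinh_sub, Real.cosh_sub]
    linear_combination (Real.cosh a * Real.sinh c - Real.sinh a * Real.cosh c) * hb
  have hr : Real.sinh (c - b) * Real.cosh (a - c) + Real.sinh (a - c) * Real.cosh (b - c) +
      Real.sinh (b - a) = 0 := by
    simp only [Real.sinh_sub, Real.cosh_sub]
    linear_combination (Real.cosh b * Real.sinh a - Real.sinh b * Real.cosh a) * hd
  linear_combination (-Real.sinh (c - b)) * hp - Real.sinh (a - c) * hq - Real.sinh (b - a) * hr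

/-! ### Geodesic lines of hyperbolic space -/

/-- `Q` is a unit tangent vector of the hyperboloid at `p`. -/
def IsUnitTangent (p : HypSpace n) (Q : Mink n) : Prop := mink p.vec Q = 0 ∧ mink Q Q = -1

/-- The unit-speed geodesic `t ↦ cosh t • p + sinh t • Q` from `p` in the direction of the unit
tangent vector `Q`. (The time coordinate is determined by the space coordinates.) -/
noncomputable def expLine (p : HypSpace n) (Q : Mink n) (t : ℝ) : HypSpace n where
  time := √(1 + ‖Real.cosh t • p.space + Real.sinh t • Q.2‖ ^ 2)
  space := Real.cosh t • p.space + Real.sinh t • Q.2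
  time_pos := by positivity
  time_sq := Real.sq_sqrt (by positivity)

theorem vec_expLine {p : HypSpace n} {Q : Mink n} (h : IsUnitTangent p Q) (t : ℝ) :
    (expLine p Q t).vec = Real.cosh t • p.vec + Real.sinh t • Q := by
  have hQ : mink Q p.vec = 0 := by rw [mink_comm, h.1]
  have hs := Real.cosh_sq t
  obtain ⟨q, hq⟩ := exists_vec_eq p (X := Real.cosh t • p.vec + Real.sinh t • Q) (by
    simp only [mink_add_right, mink_smul_right, mink_add_left, mink_smul_left, mink_vec, form_self,
      h.1, h.2, hQ]
    linear_combination hs) (by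
    simp only [mink_add_right, mink_smul_right, mink_vec, form_self, h.1]
    simpa using Real.cosh_pos t)
  rw [← hq]
  have h1 : q.space = Real.cosh t • p.space + Real.sinh t • Q.2 := congrArg Prod.snd hq
  have h2 : (expLine p Q t).space = q.space := by rw [h1]; rfl
  have h3 : (expLine p Q t).time = q.time := by
    refine (pow_left_inj₀ (expLine p Q t).time_pos.le q.time_pos.le two_ne_zero).1 ?_
    rw [(expLine p Q t).time_sq, q.time_sq, h2]
  exact Prod.ext h3 h2

theorem expLine_zero {p : HypSpace n} {Q : Mink n} (h : IsUnitTangent p Q) :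
    expLine p Q 0 = p := vec_injective <| by rw [vec_expLine h]; simp

theorem IsUnitTangent.neg {p : HypSpace n} {Q : Mink n} (h : IsUnitTangent p Q) :
    IsUnitTangent p (-Q) := by
  rw [← neg_one_smul ℝ Q]
  constructor
  · rw [mink_smul_right, h.1, mul_zero]
  · rw [mink_smul_right, mink_smul_left, h.2]; norm_num

theorem expLine_neg (p : HypSpace n) (Q : Mink n) (t : ℝ) :
    expLine p (-Q) t = expLine p Q (-t) := by
  simp [expLine]

theorem dist_eq_of_form {p q : HypSpace n} {d : ℝ} (h : form p q = Real.cosh d) :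
    dist p q = |d| := by
  rw [dist_def, h, ← Real.cosh_abs, Real.arcosh_cosh (abs_nonneg d)]

theorem dist_expLine {p : HypSpace n} {Q : Mink n} (h : IsUnitTangent p Q) (s t : ℝ) :
    dist (expLine p Q s) (expLine p Q t) = |s - t| := by
  have hQ : mink Q p.vec = 0 := by rw [mink_comm, h.1]
  refine dist_eq_of_form ?_
  rw [← mink_vec, vec_expLine h, vec_expLine h]
  simp only [mink_add_right, mink_smul_right, mink_add_left, mink_smul_left, mink_vec, form_self,
      h.1, h.2, hQ, Real.cosh_sub]
  ring

theorem edist_expLine {p : HypSpace n} {Q : Mink n} (h : IsUnitTangent p Q) (s t : ℝ) :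
    edist (expLine p Q s) (expLine p Q t) = edist s t := by
  rw [edist_dist, dist_expLine h, edist_dist, Real.dist_eq]

theorem expLine_injective {p : HypSpace n} {Q : Mink n} (h : IsUnitTangent p Q) :
    Function.Injective (expLine p Q) := fun s t hst => by
  have := dist_expLine h s t
  rw [hst, dist_self] at this
  linarith [abs_eq_zero.1 this.symm]

theorem continuous_expLine {p : HypSpace n} {Q : Mink n} (h : IsUnitTangent p Q) :
    Continuous (expLine p Q) :=
  (Isometry.of_dist_eq (fun s t => by rw [dist_expLine h, Real.dist_eq])).continuous

/-- Two distinct points lie on a geodesic line. -/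
theorem exists_expLine_dist {p r : HypSpace n} (hpr : p ≠ r) :
    ∃ Q, IsUnitTangent p Q ∧ expLine p Q (dist p r) = r := by
  have hd : 0 < dist p r := dist_pos.2 hpr
  have hs : Real.sinh (dist p r) ≠ 0 := (Real.sinh_pos_iff.2 hd).ne'
  set d := dist p r
  have e : form p r = Real.cosh d := (cosh_dist p r).symm
  have e' : form r p = Real.cosh d := by rw [form_comm, e]
  have h2 := Real.cosh_sq d
  have hQ : IsUnitTangent p ((Real.sinh d)⁻¹ • (r.vec + (-Real.cosh d) • p.vec)) := by
    constructor
    · simp only [mink_add_right, mink_smul_right, mink_vec, form_self, e]; ring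
    · simp only [mink_add_right, mink_smul_right, mink_add_left, mink_smul_left, mink_vec,
        form_self, e, e']
      field_simp
      linarith
  refine ⟨_, hQ, vec_injective ?_⟩
  rw [vec_expLine hQ, smul_inv_smul₀ hs]
  module

/-- A distance-preserving path is a geodesic line. -/
theorem exists_eq_expLine {γ : ℝ → HypSpace n} {I : Set ℝ} {t₀ t₁ : ℝ} (h01 : t₀ ≠ t₁)
    (h0 : t₀ ∈ I) (h1 : t₁ ∈ I) (h : ∀ s ∈ I, ∀ t ∈ I, dist (γ s) (γ t) = |s - t|) :
    ∃ Q, IsUnitTangent (γ t₀) Q ∧ ∀ t ∈ I, γ t = expLine (γ t₀) Q (t - t₀) := by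
  have hs : Real.sinh (t₁ - t₀) ≠ 0 := by
    rw [Ne, Real.sinh_eq_zero, sub_eq_zero]; exact h01.symm
  set d := t₁ - t₀ with hd
  have e : form (γ t₀) (γ t₁) = Real.cosh d := by
    rw [← cosh_dist, dist_comm, h _ h1 _ h0, Real.cosh_abs]
  have e' : form (γ t₁) (γ t₀) = Real.cosh d := by rw [form_comm, e]
  have h2 := Real.cosh_sq d
  have hQ : IsUnitTangent (γ t₀)
      ((Real.sinh d)⁻¹ • ((γ t₁).vec + (-Real.cosh d) • (γ t₀).vec)) := by
    constructor
    · simp only [mink_add_right, mink_smul_right, mink_vec, form_self, e]; ring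
    · simp only [mink_add_right, mink_smul_right, mink_add_left, mink_smul_left, mink_vec,
        form_self, e, e']
      field_simp
      linarith
  refine ⟨_, hQ, fun t ht => vec_injective ?_⟩
  have h3 := sinh_smul_vec_add (γ t₀) (γ t₁) (γ t) t₀ t₁ t (h _ h0 _ h1) (h _ h1 _ ht) (h _ h0 _ ht)
  rw [vec_expLine hQ]
  refine (smul_right_injective _ hs) ?_
  simp only [smul_add, smul_smul]
  have e3 : Real.sinh (t - t₁) = Real.sinh (t - t₀) * Real.cosh d -
      Real.cosh (t - t₀) * Real.sinh d := by
    rw [← Real.sinh_sub]; congr 1; simp [hd]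
  have e4 : Real.sinh (t₀ - t) = - Real.sinh (t - t₀) := by rw [← Real.sinh_neg, neg_sub]
  rw [e3, e4, ← hd] at h3
  rw [← sub_eq_zero, ← h3]
  match_scalars <;> field_simp
  ring

/-! ### The Klein model -/

/-- The Klein (projective) coordinates of a point of hyperbolic space. -/
noncomputable def klein (p : HypSpace n) : EuclideanSpace ℝ (Fin n) := p.time⁻¹ • p.space

/-- The Klein direction of a tangent vector `Q` at `p`: the image of `Q` under the differential of
`klein`, up to the positive factor `p.time`. -/
noncomputable def kleinDir (p : HypSpace n) (Q : Mink n) : EuclideanSpace ℝ (Fin n) :=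
  Q.2 - (Q.1 / p.time) • p.space

/-- Geodesic lines are straight in the Klein model. -/
theorem klein_expLine {p : HypSpace n} {Q : Mink n} (h : IsUnitTangent p Q) (t : ℝ) :
    klein (expLine p Q t) =
      klein p + (Real.sinh t / (expLine p Q t).time) • kleinDir p Q := by
  have h1 : (expLine p Q t).time = Real.cosh t * p.time + Real.sinh t * Q.1 :=
    congrArg Prod.fst (vec_expLine h t)
  have h2 : (expLine p Q t).space = Real.cosh t • p.space + Real.sinh t • Q.2 := rfl
  have h3 := (expLine p Q t).time_pos
  have h4 := p.time_pos
  simp only [klein, kleinDir]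
  rw [h2]
  rw [h1] at h3 ⊢
  match_scalars
  · field_simp
    ring
  · field_simp

theorem time_smul_klein (p : HypSpace n) : p.time • klein p = p.space :=
  smul_inv_smul₀ p.time_pos.ne' _

theorem vec_eq_time_smul (p : HypSpace n) : p.vec = p.time • ((1 : ℝ), klein p) := by
  ext1
  · simp [vec]
  · simp [vec, time_smul_klein]

theorem norm_klein_sq (p : HypSpace n) : ‖klein p‖ ^ 2 = 1 - (p.time ^ 2)⁻¹ := by
  have h0 := p.time_pos
  have h := p.time_sq
  rw [klein, norm_smul, mul_pow, norm_inv, Real.norm_of_nonneg h0.le]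
  field_simp
  linarith

theorem norm_klein_lt_one (p : HypSpace n) : ‖klein p‖ < 1 := by
  have h0 : 0 < (p.time ^ 2)⁻¹ := inv_pos.2 (pow_pos p.time_pos 2)
  have h := norm_klein_sq p
  nlinarith [norm_nonneg (klein p)]

/-- An affine relation between Klein coordinates lifts to a linear relation between points of the
hyperboloid, with coefficients of the same signs. -/
theorem vec_eq_of_klein_eq {p q r : HypSpace n} {a b : ℝ} (hab : a + b = 1)
    (h : klein q = a • klein p + b • klein r) :
    q.vec = (q.time * a / p.time) • p.vec + (q.time * b / r.time) • r.vec := by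
  have hp := p.time_pos.ne'
  have hr := r.time_pos.ne'
  rw [vec_eq_time_smul q, vec_eq_time_smul p, vec_eq_time_smul r, smul_smul, smul_smul,
    div_mul_cancel₀ _ hp, div_mul_cancel₀ _ hr]
  ext1
  · simp [← mul_add, hab]
  · simp [h, smul_smul]

theorem klein_injective : Function.Injective (klein : HypSpace n → _) := fun p q h => by
  have h1 := norm_klein_sq p
  rw [h, norm_klein_sq q] at h1
  have h2 : q.time ^ 2 = p.time ^ 2 := inv_injective (by linarith)
  have h3 : q.time = p.time :=
    (pow_left_inj₀ q.time_pos.le p.time_pos.le two_ne_zero).1 h2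
  refine HypSpace.ext h3.symm ?_
  rw [← time_smul_klein p, ← time_smul_klein q, h, h3]

/-- The distance is additive along Klein segments. -/
theorem dist_add_dist_of_vec_eq {p q r : HypSpace n} {α β : ℝ} (hα : 0 ≤ α) (hβ : 0 ≤ β)
    (h : q.vec = α • p.vec + β • r.vec) : dist p q + dist q r = dist p r := by
  set C := form p r with hC
  have hC' : form r p = C := form_comm r p
  have e1 : form p q = α + β * C := by
    rw [← mink_vec, h, mink_add_right, mink_smul_right, mink_smul_right, mink_vec, mink_vec,
      form_self]; ring
  have e2 : form q r = α * C + β := by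
    rw [← mink_vec, h, mink_add_left, mink_smul_left, mink_smul_left, mink_vec, mink_vec,
      form_self]; ring
  have e3 : α ^ 2 + β ^ 2 + 2 * α * β * C = 1 := by
    rw [← form_self q, ← mink_vec q q, h]
    simp only [mink_add_right, mink_smul_right, mink_add_left, mink_smul_left, mink_vec,
      form_self, hC', ← hC]
    ring
  have hC1 : Real.cosh (dist p r) = C := cosh_dist p r
  have hS := Real.sinh_sq (dist p r)
  rw [hC1] at hS
  have hS0 : 0 ≤ Real.sinh (dist p r) := Real.sinh_nonneg_iff.2 dist_nonneg
  have s1 : Real.sinh (dist p q) = β * Real.sinh (dist p r) := by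
    refine (pow_left_inj₀ (Real.sinh_nonneg_iff.2 dist_nonneg) (by positivity) two_ne_zero).1 ?_
    rw [Real.sinh_sq, cosh_dist, e1, mul_pow, hS]
    linear_combination e3
  have s2 : Real.sinh (dist q r) = α * Real.sinh (dist p r) := by
    refine (pow_left_inj₀ (Real.sinh_nonneg_iff.2 dist_nonneg) (by positivity) two_ne_zero).1 ?_
    rw [Real.sinh_sq, cosh_dist, e2, mul_pow, hS]
    linear_combination e3
  refine Real.cosh_injOn (add_nonneg dist_nonneg dist_nonneg) dist_nonneg ?_
  rw [Real.cosh_add, cosh_dist, cosh_dist, hC1, s1, s2, e1, e2]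
  linear_combination C * e3 + α * β * hS

theorem dist_add_dist_of_mem_segment {p q r : HypSpace n}
    (h : klein q ∈ segment ℝ (klein p) (klein r)) : dist p q + dist q r = dist p r := by
  obtain ⟨a, b, ha, hb, hab, h⟩ := h
  have hp := p.time_pos
  have hq := q.time_pos
  have hr := r.time_pos
  exact dist_add_dist_of_vec_eq (by positivity) (by positivity) (vec_eq_of_klein_eq hab h.symm)

/-! ### Klein directions -/

/-- Modulo the base point, a tangent vector is its Klein direction. -/
theorem kleinDir_eq {p : HypSpace n} {Q : Mink n} :
    Q = (Q.1 / p.time) • p.vec + ((0 : ℝ), kleinDir p Q) := by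
  have hp := p.time_pos.ne'
  ext1
  · simp [vec, hp]
  · simp [vec, kleinDir]

theorem kleinDir_neg (p : HypSpace n) (Q : Mink n) : kleinDir p (-Q) = -kleinDir p Q := by
  simp only [kleinDir, Prod.snd_neg, Prod.fst_neg]
  module

/-- The Klein direction determines a unit tangent vector up to sign. -/
theorem eq_or_eq_neg_of_kleinDir {p : HypSpace n} {Q Q' : Mink n} (h : IsUnitTangent p Q)
    (h' : IsUnitTangent p Q') {c : ℝ} (hc : kleinDir p Q' = c • kleinDir p Q) :
    Q' = Q ∨ Q' = -Q := by
  have h1 : ∃ e : ℝ, Q' = e • p.vec + c • Q := by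
    refine ⟨Q'.1 / p.time - c * (Q.1 / p.time), ?_⟩
    have h2 := kleinDir_eq (p := p) (Q := Q')
    have h3 := kleinDir_eq (p := p) (Q := Q)
    have h4 : ((0 : ℝ), kleinDir p Q') = c • ((0 : ℝ), kleinDir p Q) := by
      rw [hc]; ext1 <;> simp
    rw [h4, eq_sub_of_add_eq' h3.symm] at h2
    refine h2.trans ?_
    module
  obtain ⟨e, he⟩ := h1
  have h2 : e = 0 := by
    have := h'.1
    rw [he, mink_add_right, mink_smul_right, mink_smul_right, h.1, mink_vec, form_self] at this
    linarith
  rw [h2, zero_smul, zero_add] at he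
  have h3 : c ^ 2 = 1 := by
    have := h'.2
    rw [he, mink_smul_right, mink_smul_left, h.2] at this
    linarith
  rcases sq_eq_one_iff.1 h3 with h | h
  · left; rw [he, h, one_smul]
  · right; rw [he, h, neg_one_smul]

theorem kleinDir_ne_zero {p : HypSpace n} {Q : Mink n} (h : IsUnitTangent p Q) :
    kleinDir p Q ≠ 0 := by
  intro h0
  have h1 : Q = (Q.1 / p.time) • p.vec := by
    have := kleinDir_eq (p := p) (Q := Q)
    rwa [h0, ← Prod.zero_eq_mk, add_zero] at this
  have h2 := h.1
  rw [h1, mink_smul_right, mink_vec, form_self, mul_one] at h2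
  rw [h2, zero_smul] at h1
  have h3 := h.2
  rw [h1] at h3
  simp [mink] at h3

/-- There is a unit tangent vector with any given Klein direction. -/
theorem exists_kleinDir (p : HypSpace n) {v : EuclideanSpace ℝ (Fin n)} (hv : v ≠ 0) :
    ∃ Q, IsUnitTangent p Q ∧ ∃ c : ℝ, 0 < c ∧ kleinDir p Q = c • v := by
  have hp := p.time_pos
  have hps := p.time_sq
  set τ : ℝ := p.time * inner ℝ p.space v
  have h1 : mink p.vec (τ, v + (τ / p.time) • p.space) = 0 := by
    simp only [mink, vec, inner_add_right, real_inner_smul_right, real_inner_self_eq_norm_sq]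
    simp only [τ]
    field_simp
    linear_combination (inner ℝ p.space v) * hps
  have hd : kleinDir p (τ, v + (τ / p.time) • p.space) = v := by
    simp [kleinDir]
  set Z : Mink n := (τ, v + (τ / p.time) • p.space)
  have hZ : Z ≠ 0 := by
    rintro h
    apply hv
    rw [← hd, h]
    simp [kleinDir]
  have hneg := mink_self_neg p h1 hZ
  have hs : 0 < √(-mink Z Z) := Real.sqrt_pos.2 (by linarith)
  have hs2 : √(-mink Z Z) ^ 2 = -mink Z Z := Real.sq_sqrt (by linarith)
  refine ⟨(√(-mink Z Z))⁻¹ • Z, ⟨?_, ?_⟩, (√(-mink Z Z))⁻¹, by positivity, ?_⟩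
  · rw [mink_smul_right, h1, mul_zero]
  · rw [mink_smul_right, mink_smul_left]
    field_simp
    linarith
  · conv_rhs => rw [← hd]
    simp only [kleinDir, Prod.smul_snd, Prod.smul_fst, smul_eq_mul]
    rw [smul_sub, smul_smul, mul_div_assoc]

/-- Every point on the Klein line through `p` is on the geodesic line. -/
theorem exists_eq_expLine_of_klein_eq {p q : HypSpace n} {Q : Mink n} (h : IsUnitTangent p Q)
    {s : ℝ} (hq : klein q = klein p + s • kleinDir p Q) : ∃ t, q = expLine p Q t := by
  have hp := p.time_pos.ne'
  obtain ⟨α, β, hv⟩ : ∃ α β : ℝ, q.vec = α • p.vec + β • Q := by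
    refine ⟨q.time / p.time * (1 - s * (Q.1 / p.time) * p.time) , q.time * s, ?_⟩
    have h3 := kleinDir_eq (p := p) (Q := Q)
    have h4 : ((1 : ℝ), klein q) = ((1 : ℝ), klein p) + s • ((0 : ℝ), kleinDir p Q) := by
      rw [hq]; ext1 <;> simp
    have h5 : ((1 : ℝ), klein p) = p.time⁻¹ • p.vec := by
      rw [vec_eq_time_smul p, inv_smul_smul₀ hp]
    rw [vec_eq_time_smul q, h4, h5, eq_sub_of_add_eq' h3.symm]
    match_scalars <;> field_simp
    ring
  have hQ : mink Q p.vec = 0 := by rw [mink_comm, h.1]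
  have e1 : form q p = α := by
    rw [← mink_vec, hv, mink_add_left, mink_smul_left, mink_smul_left, hQ, mink_vec, form_self]
    ring
  have e2 : α ^ 2 = 1 + β ^ 2 := by
    have := form_self q
    rw [← mink_vec, hv] at this
    simp only [mink_add_right, mink_smul_right, mink_add_left, mink_smul_left, mink_vec,
      form_self, h.1, h.2, hQ] at this
    linarith
  refine ⟨Real.arsinh β, vec_injective ?_⟩
  rw [vec_expLine h, hv, Real.sinh_arsinh]
  congr 2
  refine (pow_left_inj₀ ?_ (Real.cosh_pos _).le two_ne_zero).1 ?_
  · linarith [one_le_form q p]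
  · rw [Real.cosh_sq', Real.sinh_arsinh, e2]

/-- The Klein parameter of a geodesic line is strictly increasing. -/
theorem strictMono_sinh_div_time {p : HypSpace n} {Q : Mink n} (h : IsUnitTangent p Q) :
    StrictMono fun t => Real.sinh t / (expLine p Q t).time := by
  intro s t hst
  have hs := (expLine p Q s).time_pos
  have ht := (expLine p Q t).time_pos
  have hp := p.time_pos
  have e : ∀ u, (expLine p Q u).time = Real.cosh u * p.time + Real.sinh u * Q.1 := fun u =>
    congrArg Prod.fst (vec_expLine h u)
  have h1 : 0 < Real.sinh (t - s) := Real.sinh_pos_iff.2 (by linarith)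
  rw [Real.sinh_sub] at h1
  simp only
  rw [div_lt_div_iff₀ hs ht, e, e]
  nlinarith

/-! ### The topology of hyperbolic space -/

/-- The base point of the hyperboloid. -/
noncomputable def origin : HypSpace n := ⟨1, 0, one_pos, by simp⟩

theorem continuous_time : Continuous (time : HypSpace n → ℝ) := by
  have : (time : HypSpace n → ℝ) = fun p => Real.cosh (dist p origin) := by
    funext p
    rw [cosh_dist]
    simp [form, origin]
  rw [this]
  fun_prop

/-- Here `‖q.space - p.space‖` is an explicit function of `q.time`, `p.time` and `dist q p`. -/
theorem continuous_space : Continuous (space : HypSpace n → EuclideanSpace ℝ (Fin n)) := by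
  refine continuous_iff_continuousAt.2 fun p => ?_
  rw [ContinuousAt, tendsto_iff_norm_sub_tendsto_zero]
  have h : ∀ q : HypSpace n, ‖q.space - p.space‖ =
      √((q.time - p.time) ^ 2 + 2 * (Real.cosh (dist q p) - 1)) := fun q => by
    rw [eq_comm, Real.sqrt_eq_iff_eq_sq _ (norm_nonneg _), norm_sub_sq_real, cosh_dist, form]
    · linear_combination q.time_sq + p.time_sq
    · have := Real.one_le_cosh (dist q p)
      positivity
  simp only [h]
  have hc : Continuous fun q : HypSpace n =>
      √((q.time - p.time) ^ 2 + 2 * (Real.cosh (dist q p) - 1)) := by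
    have := continuous_time (n := n)
    fun_prop
  have := hc.tendsto p
  simpa using this

theorem continuous_klein : Continuous (klein : HypSpace n → _) :=
  (continuous_time.inv₀ fun p => p.time_pos.ne').smul continuous_space

theorem continuousOn_of_coordinates {X : Type*} [TopologicalSpace X] {g : X → HypSpace n}
    {s : Set X} (h1 : ContinuousOn (fun x => (g x).time) s)
    (h2 : ContinuousOn (fun x => (g x).space) s) : ContinuousOn g s := by
  intro x hx
  rw [ContinuousWithinAt, tendsto_iff_dist_tendsto_zero]
  have h3 : ContinuousWithinAt (fun y => form (g y) (g x)) s x :=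
    ((h1 x hx).mul continuousWithinAt_const).sub
      (ContinuousWithinAt.inner (𝕜 := ℝ) (h2 x hx) continuousWithinAt_const)
  have h4 := Tendsto.comp (Real.continuousOn_arcosh (form (g x) (g x)) (one_le_form _ _))
    (tendsto_nhdsWithin_iff.2 ⟨h3, Eventually.of_forall fun y => one_le_form (g y) (g x)⟩)
  rw [form_self, Real.arcosh_zero] at h4
  exact h4

/-- The point with given Klein coordinates (a junk value outside of the unit ball). -/
noncomputable def ofKlein (v : EuclideanSpace ℝ (Fin n)) : HypSpace n where
  time := √(1 + ‖(√(1 - ‖v‖ ^ 2))⁻¹ • v‖ ^ 2)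
  space := (√(1 - ‖v‖ ^ 2))⁻¹ • v
  time_pos := by positivity
  time_sq := Real.sq_sqrt (by positivity)

theorem time_ofKlein {v : EuclideanSpace ℝ (Fin n)} (hv : ‖v‖ < 1) :
    (ofKlein v).time = (√(1 - ‖v‖ ^ 2))⁻¹ := by
  have h1 : 0 < 1 - ‖v‖ ^ 2 := by nlinarith [norm_nonneg v]
  have h2 : 0 < √(1 - ‖v‖ ^ 2) := Real.sqrt_pos.2 h1
  refine (pow_left_inj₀ (ofKlein v).time_pos.le (inv_pos.2 h2).le two_ne_zero).1 ?_
  rw [(ofKlein v).time_sq]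
  simp only [ofKlein]
  rw [norm_smul, mul_pow, norm_inv, Real.norm_of_nonneg h2.le, inv_pow, Real.sq_sqrt h1.le]
  field_simp
  ring

theorem klein_ofKlein {v : EuclideanSpace ℝ (Fin n)} (hv : ‖v‖ < 1) : klein (ofKlein v) = v := by
  have h1 : 0 < 1 - ‖v‖ ^ 2 := by nlinarith [norm_nonneg v]
  rw [klein, time_ofKlein hv, inv_inv]
  exact smul_inv_smul₀ (Real.sqrt_pos.2 h1).ne' v

/-- The Klein coordinates as a homeomorphism of hyperbolic space onto the open unit ball. -/
noncomputable def kleinChart (n : ℕ) :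
    OpenPartialHomeomorph (HypSpace n) (EuclideanSpace ℝ (Fin n)) where
  toFun := klein
  invFun := ofKlein
  source := univ
  target := Metric.ball 0 1
  map_source' p _ := by simpa using norm_klein_lt_one p
  map_target' _ _ := mem_univ _
  left_inv' p _ := klein_injective (klein_ofKlein (norm_klein_lt_one p))
  right_inv' v hv := klein_ofKlein (by simpa using hv)
  open_source := isOpen_univ
  open_target := Metric.isOpen_ball
  continuousOn_toFun := continuous_klein.continuousOn
  continuousOn_invFun := by
    have h : ContinuousOn (fun v : EuclideanSpace ℝ (Fin n) => (√(1 - ‖v‖ ^ 2))⁻¹)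
        (Metric.ball 0 1) := by
      refine ContinuousOn.inv₀ (by fun_prop) fun v hv => ?_
      have hv : ‖v‖ < 1 := by simpa using hv
      exact (Real.sqrt_pos.2 (by nlinarith [norm_nonneg v])).ne'
    refine continuousOn_of_coordinates ?_ (h.smul continuousOn_id)
    exact h.congr fun v hv => time_ofKlein (by simpa using hv)

theorem segment_klein_subset (p q : HypSpace n) :
    segment ℝ (klein p) (klein q) ⊆ range (klein : HypSpace n → _) := by
  intro v hv
  have : v ∈ Metric.ball (0 : EuclideanSpace ℝ (Fin n)) 1 :=
    (convex_ball 0 1).segment_subset (by simpa using norm_klein_lt_one p)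
      (by simpa using norm_klein_lt_one q) hv
  exact ⟨ofKlein v, klein_ofKlein (by simpa using this)⟩

/-! ### Rigidity of distance-decreasing maps -/

section Rigidity

variable {m n : ℕ} {g : HypSpace m → HypSpace n}

/-- The points which are linear combinations of the vectors `a`, `b`, `c`, and whose images under
`g` are the same linear combinations of the images of `a`, `b`, `c`. -/
def rigidSet (g : HypSpace m → HypSpace n) (a b c : HypSpace m) : Set (HypSpace m) :=
  {p | ∃ α β γ : ℝ, p.vec = α • a.vec + β • b.vec + γ • c.vec ∧
    (g p).vec = α • (g a).vec + β • (g b).vec + γ • (g c).vec}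

theorem left_mem_rigidSet (a b c : HypSpace m) : a ∈ rigidSet g a b c := ⟨1, 0, 0, by simp, by simp⟩
theorem mid_mem_rigidSet (a b c : HypSpace m) : b ∈ rigidSet g a b c := ⟨0, 1, 0, by simp, by simp⟩
theorem right_mem_rigidSet (a b c : HypSpace m) : c ∈ rigidSet g a b c :=
  ⟨0, 0, 1, by simp, by simp⟩

theorem form_eq_form_iff {p q : HypSpace m} {p' q' : HypSpace n} :
    form p' q' = form p q ↔ dist p' q' = dist p q := by
  rw [← cosh_dist, ← cosh_dist]
  exact ⟨fun h => Real.cosh_injOn dist_nonneg dist_nonneg h, fun h => by rw [h]⟩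

/-- Distances are determined by Minkowski products, which are bilinear. -/
theorem dist_eq_of_mem_rigidSet {a b c p q : HypSpace m} (hab : dist (g a) (g b) = dist a b)
    (hbc : dist (g b) (g c) = dist b c) (hac : dist (g a) (g c) = dist a c)
    (hp : p ∈ rigidSet g a b c) (hq : q ∈ rigidSet g a b c) : dist (g p) (g q) = dist p q := by
  rw [← form_eq_form_iff] at hab hbc hac ⊢
  obtain ⟨α, β, γ, h1, h2⟩ := hp
  obtain ⟨α', β', γ', h3, h4⟩ := hq
  rw [← mink_vec, ← mink_vec, h1, h2, h3, h4]
  simp only [mink_add_right, mink_smul_right, mink_add_left, mink_smul_left, mink_vec, form_self,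
    form_comm b a, form_comm c a, form_comm c b, form_comm (g b) (g a), form_comm (g c) (g a),
    form_comm (g c) (g b), hab, hbc, hac]

theorem smul_add_smul_mem_rigidSet {a b c p q r : HypSpace m} {s t : ℝ}
    (hp : p ∈ rigidSet g a b c) (hq : q ∈ rigidSet g a b c) (h : r.vec = s • p.vec + t • q.vec)
    (h' : (g r).vec = s • (g p).vec + t • (g q).vec) : r ∈ rigidSet g a b c := by
  obtain ⟨α, β, γ, h1, h2⟩ := hp
  obtain ⟨α', β', γ', h3, h4⟩ := hq
  refine ⟨s * α + t * α', s * β + t * β', s * γ + t * γ', ?_, ?_⟩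
  · rw [h, h1, h3]; module
  · rw [h', h2, h4]; module

variable {D : Set (HypSpace m)}

/-- A distance-decreasing map which preserves the distance of the end points of a geodesic segment
is an isometry on the segment. -/
theorem dist_eq_of_between (hg : ∀ p ∈ D, ∀ q ∈ D, dist (g p) (g q) ≤ dist p q)
    {p q r : HypSpace m} (hp : p ∈ D) (hq : q ∈ D) (hr : r ∈ D)
    (hpqr : dist p q + dist q r = dist p r) (hpr : dist (g p) (g r) = dist p r) :
    dist (g p) (g q) = dist p q ∧ dist (g q) (g r) = dist q r := by
  have h1 := hg p hp q hq
  have h2 := hg q hq r hr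
  have h3 := dist_triangle (g p) (g q) (g r)
  constructor <;> linarith

theorem sinh_smul_of_between {p q r : HypSpace m} (h : dist p q + dist q r = dist p r) :
    Real.sinh (dist q r) • p.vec + Real.sinh (dist p q) • r.vec =
      Real.sinh (dist p r) • q.vec := by
  have h1 := sinh_smul_vec_add p q r 0 (dist p q) (dist p r) (by simp)
    (by rw [← h, sub_add_cancel_left, abs_neg, abs_of_nonneg dist_nonneg]) (by simp)
  rw [← h, add_sub_cancel_left, zero_sub, h, Real.sinh_neg, sub_zero, neg_smul] at h1
  rw [← sub_eq_zero, ← h1]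
  module

variable {a b c : HypSpace m}

/-- The rigid set is geodesically convex: by the triangle inequality, the image of a point `q` of a
segment whose length is preserved is the corresponding point of the image segment. -/
theorem between_mem_rigidSet (hg : ∀ p ∈ D, ∀ q ∈ D, dist (g p) (g q) ≤ dist p q)
    (hab : dist (g a) (g b) = dist a b)
    (hbc : dist (g b) (g c) = dist b c) (hac : dist (g a) (g c) = dist a c)
    {p q r : HypSpace m} (hpD : p ∈ D) (hqD : q ∈ D) (hrD : r ∈ D) (hp : p ∈ rigidSet g a b c)
    (hr : r ∈ rigidSet g a b c) (h : dist p q + dist q r = dist p r) :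
    q ∈ rigidSet g a b c := by
  rcases eq_or_ne p r with rfl | hne
  · rw [dist_self, dist_comm q p] at h
    have h0 : dist p q = 0 := by linarith
    rwa [← eq_of_dist_eq_zero h0]
  have hpr := dist_eq_of_mem_rigidSet hab hbc hac hp hr
  obtain ⟨h1, h2⟩ := dist_eq_of_between hg hpD hqD hrD h hpr
  have hs : Real.sinh (dist p r) ≠ 0 := (Real.sinh_pos_iff.2 (dist_pos.2 hne)).ne'
  have e1 := sinh_smul_of_between h
  have e2 : Real.sinh (dist q r) • (g p).vec + Real.sinh (dist p q) • (g r).vec =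
      Real.sinh (dist p r) • (g q).vec := by
    have := sinh_smul_of_between (p := g p) (q := g q) (r := g r) (by rw [h1, h2, h, hpr])
    rwa [h1, h2, hpr] at this
  refine smul_add_smul_mem_rigidSet (s := Real.sinh (dist q r) / Real.sinh (dist p r))
    (t := Real.sinh (dist p q) / Real.sinh (dist p r)) hp hr ?_ ?_
  · refine smul_right_injective _ hs (Eq.trans e1.symm ?_)
    simp only [smul_add, smul_smul, mul_div_cancel₀ _ hs]
  · refine smul_right_injective _ hs (Eq.trans e2.symm ?_)
    simp only [smul_add, smul_smul, mul_div_cancel₀ _ hs]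

/-- If a segment starts with two distinct points of the rigid set, and the distance of its end
points is preserved, then its other end point is in the rigid set. -/
theorem beyond_mem_rigidSet (hg : ∀ p ∈ D, ∀ q ∈ D, dist (g p) (g q) ≤ dist p q)
    {p q r : HypSpace m} (hpD : p ∈ D) (hqD : q ∈ D) (hrD : r ∈ D) (hp : p ∈ rigidSet g a b c)
    (hq : q ∈ rigidSet g a b c) (hpq : p ≠ q) (h : dist p q + dist q r = dist p r)
    (hpr : dist (g p) (g r) = dist p r) : r ∈ rigidSet g a b c := by
  obtain ⟨h1, h2⟩ := dist_eq_of_between hg hpD hqD hrD h hpr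
  have hs : Real.sinh (dist p q) ≠ 0 := (Real.sinh_pos_iff.2 (dist_pos.2 hpq)).ne'
  have e1 := sinh_smul_of_between h
  have e2 : Real.sinh (dist q r) • (g p).vec + Real.sinh (dist p q) • (g r).vec =
      Real.sinh (dist p r) • (g q).vec := by
    have := sinh_smul_of_between (p := g p) (q := g q) (r := g r) (by rw [h1, h2, h, hpr])
    rwa [h1, h2, hpr] at this
  refine smul_add_smul_mem_rigidSet (s := -Real.sinh (dist q r) / Real.sinh (dist p q))
    (t := Real.sinh (dist p r) / Real.sinh (dist p q)) hp hq ?_ ?_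
  · refine smul_right_injective _ hs ?_
    simp only [smul_add, smul_smul, mul_div_cancel₀ _ hs]
    rw [← e1]; module
  · refine smul_right_injective _ hs ?_
    simp only [smul_add, smul_smul, mul_div_cancel₀ _ hs]
    rw [← e2]; module

/-- The comparison of angles at an interior point `q` of the segment from `a` to `b`: if the
segment and the distance from `q` to `c` are preserved, then no distance among `a`, `b`, `c`
decreases, since a positive combination of `form a c` and `form b c` is preserved. -/
theorem dist_eq_of_tripod (hg : ∀ p ∈ D, ∀ q ∈ D, dist (g p) (g q) ≤ dist p q)
    {q : HypSpace m} (ha : a ∈ D) (hb : b ∈ D) (hc : c ∈ D) (hq : q ∈ D) (haq : a ≠ q)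
    (hqb : q ≠ b) (h : dist a q + dist q b = dist a b) (hab : dist (g a) (g b) = dist a b)
    (hqc : dist (g q) (g c) = dist q c) :
    dist (g b) (g c) = dist b c ∧ dist (g a) (g c) = dist a c := by
  obtain ⟨h1, h2⟩ := dist_eq_of_between hg ha hq hb h hab
  have e1 := sinh_smul_of_between h
  have e2 : Real.sinh (dist q b) • (g a).vec + Real.sinh (dist a q) • (g b).vec =
      Real.sinh (dist a b) • (g q).vec := by
    have := sinh_smul_of_between (p := g a) (q := g q) (r := g b) (by rw [h1, h2, h, hab])
    rwa [h1, h2, hab] at this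
  have f1 := congrArg (fun v => mink v c.vec) e1
  have f2 := congrArg (fun v => mink v (g c).vec) e2
  simp only [mink_add_left, mink_smul_left, mink_vec] at f1 f2
  rw [form_eq_form_iff.2 hqc, ← f1] at f2
  have le : ∀ p ∈ D, form (g p) (g c) ≤ form p c := fun p hp => by
    rw [← cosh_dist, ← cosh_dist, Real.cosh_le_cosh, abs_of_nonneg dist_nonneg,
      abs_of_nonneg dist_nonneg]
    exact hg p hp c hc
  have s1 : 0 < Real.sinh (dist q b) := Real.sinh_pos_iff.2 (dist_pos.2 hqb)
  have s2 : 0 < Real.sinh (dist a q) := Real.sinh_pos_iff.2 (dist_pos.2 haq)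
  rw [← form_eq_form_iff, ← form_eq_form_iff]
  have la := le a ha
  have lb := le b hb
  constructor <;> refine le_antisymm (by assumption) ?_ <;> by_contra! hlt <;> nlinarith

end Rigidity

/-! ### Convex planar neighbourhoods -/

section Planar

/-- A convex set which contains a triangle with base along `e₁` and apex in the direction `e₂`. -/
theorem mem_of_triangle {V : Type*} [AddCommGroup V] [Module ℝ V] {K : Set V} (hK : Convex ℝ K)
    {x e₁ e₂ : V} {α₁ α₂ β s t : ℝ} (hα : 0 < α₁ + α₂) (hβ : 0 < β)
    (h1 : x + (-α₁) • e₁ ∈ K)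
    (h2 : x + α₂ • e₁ ∈ K) (h3 : x + β • e₂ ∈ K) (ht : 0 ≤ t) (htβ : t < β)
    (hs1 : -α₁ * (β - t) ≤ s * β) (hs2 : s * β ≤ α₂ * (β - t)) : x + s • e₁ + t • e₂ ∈ K := by
  have hb : 0 < β - t := by linarith
  have h4 : x + (s * β / (β - t)) • e₁ ∈ K := by
    refine hK.segment_subset h1 h2 ⟨(α₂ - s * β / (β - t)) / (α₁ + α₂),
      (s * β / (β - t) + α₁) / (α₁ + α₂), div_nonneg ?_ hα.le, div_nonneg ?_ hα.le, ?_, ?_⟩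
    · rw [sub_nonneg, div_le_iff₀ hb]; exact hs2
    · rw [← sub_neg_eq_add, sub_nonneg, le_div_iff₀ hb]; exact hs1
    · field_simp; ring
    · match_scalars <;> field_simp <;> ring
  refine hK.segment_subset h4 h3 ⟨(β - t) / β, t / β, by positivity, by positivity, ?_, ?_⟩
  · field_simp; ring
  · match_scalars <;> field_simp
    ring

variable {e₁ e₂ : EuclideanSpace ℝ (Fin 2)}

theorem exists_coordinates (he : LinearIndependent ℝ ![e₁, e₂]) :
    ∃ φ : EuclideanSpace ℝ (Fin 2) ≃L[ℝ] ℝ × ℝ, ∀ s t : ℝ, φ (s • e₁ + t • e₂) = (s, t) := by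
  let b := basisOfLinearIndependentOfCardEqFinrank he (by simp)
  have hb : ∀ i, b i = ![e₁, e₂] i := fun i => by simp [b]
  refine ⟨b.equivFunL.trans (ContinuousLinearEquiv.finTwoArrow ℝ ℝ), fun s t => ?_⟩
  have h1 : s • e₁ + t • e₂ = s • b 0 + t • b 1 := by rw [hb, hb]; rfl
  rw [h1]
  ext <;> simp

/-- A convex set containing the vertices of a triangle is a neighbourhood of the points of the open
segment from an interior point `x` of the base to the apex. -/
theorem mem_nhds_of_triangle (he : LinearIndependent ℝ ![e₁, e₂])
    {K : Set (EuclideanSpace ℝ (Fin 2))} (hK : Convex ℝ K) {x : EuclideanSpace ℝ (Fin 2)}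
    {α₁ α₂ β t : ℝ} (hα₁ : 0 < α₁) (hα₂ : 0 < α₂)
    (h1 : x + (-α₁) • e₁ ∈ K) (h2 : x + α₂ • e₁ ∈ K) (h3 : x + β • e₂ ∈ K) (ht : 0 < t)
    (htβ : t < β) : K ∈ 𝓝 (x + t • e₂) := by
  obtain ⟨φ, hφ⟩ := exists_coordinates he
  have hx : φ (x + t • e₂ - x) = (0, t) := by
    rw [add_sub_cancel_left, ← hφ 0 t, zero_smul, zero_add]
  have hsymm : ∀ v, v = x + (φ (v - x)).1 • e₁ + (φ (v - x)).2 • e₂ := fun v => by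
    have : φ (v - x) = φ ((φ (v - x)).1 • e₁ + (φ (v - x)).2 • e₂) := by rw [hφ]
    rw [add_assoc, ← φ.injective this]; abel
  have hc : Continuous fun v => φ (v - x) := by fun_prop
  have hβ : 0 < β := ht.trans htβ
  have ev : ∀ᶠ w in 𝓝 ((0 : ℝ), t), 0 < w.2 ∧ w.2 < β ∧ -α₁ * (β - w.2) < w.1 * β ∧
      w.1 * β < α₂ * (β - w.2) := by
    simp only [eventually_and]
    refine ⟨?_, ?_, ?_, ?_⟩ <;>
      refine ContinuousAt.eventually_lt (by fun_prop) (by fun_prop) ?_ <;> nlinarith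
  rw [← hx] at ev
  filter_upwards [hc.continuousAt.eventually ev] with v hv
  rw [hsymm v]
  exact mem_of_triangle hK (by linarith) hβ h1 h2 h3 hv.1.le hv.2.1 hv.2.2.1.le hv.2.2.2.le

/-- A convex set containing the vertices of a convex quadrilateral, whose diagonals cross at `x`, is
a neighbourhood of the interior points of a diagonal. -/
theorem mem_nhds_of_quadrilateral (he : LinearIndependent ℝ ![e₁, e₂])
    {K : Set (EuclideanSpace ℝ (Fin 2))} (hK : Convex ℝ K) {x : EuclideanSpace ℝ (Fin 2)}
    {α₁ α₂ β₁ β₂ s : ℝ} (hβ₁ : 0 < β₁) (hβ₂ : 0 < β₂)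
    (h1 : x + (-α₁) • e₁ ∈ K) (h2 : x + α₂ • e₁ ∈ K) (h3 : x + (-β₁) • e₂ ∈ K)
    (h4 : x + β₂ • e₂ ∈ K) (hs1 : -α₁ < s) (hs2 : s < α₂) : K ∈ 𝓝 (x + s • e₁) := by
  obtain ⟨φ, hφ⟩ := exists_coordinates he
  have hx : φ (x + s • e₁ - x) = (s, 0) := by
    rw [add_sub_cancel_left, ← hφ s 0, zero_smul, add_zero]
  have hsymm : ∀ v, v = x + (φ (v - x)).1 • e₁ + (φ (v - x)).2 • e₂ := fun v => by
    have : φ (v - x) = φ ((φ (v - x)).1 • e₁ + (φ (v - x)).2 • e₂) := by rw [hφ]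
    rw [add_assoc, ← φ.injective this]; abel
  have hc : Continuous fun v => φ (v - x) := by fun_prop
  have ev : ∀ᶠ w in 𝓝 (s, (0 : ℝ)), -β₁ < w.2 ∧ w.2 < β₂ ∧ -α₁ * (β₂ - w.2) < w.1 * β₂ ∧
      w.1 * β₂ < α₂ * (β₂ - w.2) ∧ -α₁ * (β₁ + w.2) < w.1 * β₁ ∧
      w.1 * β₁ < α₂ * (β₁ + w.2) := by
    simp only [eventually_and]
    refine ⟨?_, ?_, ?_, ?_, ?_, ?_⟩ <;>
      refine ContinuousAt.eventually_lt (by fun_prop) (by fun_prop) ?_ <;> nlinarith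
  rw [← hx] at ev
  filter_upwards [hc.continuousAt.eventually ev] with v ⟨v1, v2, v3, v4, v5, v6⟩
  rw [hsymm v]
  rcases le_total 0 (φ (v - x)).2 with h | h
  · exact mem_of_triangle hK (by linarith) hβ₂ h1 h2 h4 h v2 v3.le v4.le
  · rw [show (φ (v - x)).2 • e₂ = (-(φ (v - x)).2) • (-e₂) by module]
    refine mem_of_triangle hK (by linarith) hβ₁ h1 h2 ?_ (by linarith) (by linarith)
      (by rw [sub_neg_eq_add]; exact v5.le) (by rw [sub_neg_eq_add]; exact v6.le)
    rwa [smul_neg, ← neg_smul]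

end Planar

/-! ### Two crossing segments -/

section Crossing

variable {n : ℕ} {g : HypSpace 2 → HypSpace n} {Ω : Set (EuclideanSpace ℝ (Fin 2))}
  {p : HypSpace 2} {Q₁ Q₂ : Mink 2}

/-- The rigid set of a distance-decreasing map is convex in the Klein model. -/
theorem convex_klein_image_rigidSet {m : ℕ} {g : HypSpace m → HypSpace n}
    {Ω : Set (EuclideanSpace ℝ (Fin m))} (hΩ : Convex ℝ Ω)
    (hg : ∀ p, klein p ∈ Ω → ∀ q, klein q ∈ Ω → dist (g p) (g q) ≤ dist p q)
    {a b c : HypSpace m} (hab : dist (g a) (g b) = dist a b)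
    (hbc : dist (g b) (g c) = dist b c) (hac : dist (g a) (g c) = dist a c) :
    Convex ℝ (klein '' (rigidSet g a b c ∩ klein ⁻¹' Ω)) := by
  rw [convex_iff_segment_subset]
  rintro _ ⟨u, ⟨hu, huΩ⟩, rfl⟩ _ ⟨v, ⟨hv, hvΩ⟩, rfl⟩ w hw
  have hwΩ := hΩ.segment_subset huΩ hvΩ hw
  obtain ⟨q, rfl⟩ := segment_klein_subset u v hw
  exact ⟨q, ⟨between_mem_rigidSet (D := klein ⁻¹' Ω) hg hab hbc hac huΩ hwΩ hvΩ hu hv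
    (dist_add_dist_of_mem_segment hw), hwΩ⟩, rfl⟩

theorem dist_add_dist_expLine {m : ℕ} {p : HypSpace m} {Q : Mink m} (h : IsUnitTangent p Q)
    {r s t : ℝ} (hrs : r ≤ s) (hst : s ≤ t) :
    dist (expLine p Q r) (expLine p Q s) + dist (expLine p Q s) (expLine p Q t) =
      dist (expLine p Q r) (expLine p Q t) := by
  rw [dist_expLine h, dist_expLine h, dist_expLine h, abs_sub_comm r s, abs_sub_comm s t,
    abs_sub_comm r t, abs_of_nonneg (by linarith), abs_of_nonneg (by linarith),
    abs_of_nonneg (by linarith)]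
  ring

/-- If `g` preserves the lengths of a segment and of a transverse segment which starts at an
interior point of the first, then `g` is an isometry near each interior point of the latter. -/
theorem isometric_of_tripod (hΩ : Convex ℝ Ω)
    (hg : ∀ p, klein p ∈ Ω → ∀ q, klein q ∈ Ω → dist (g p) (g q) ≤ dist p q)
    (h₁ : IsUnitTangent p Q₁) (h₂ : IsUnitTangent p Q₂)
    (he : LinearIndependent ℝ ![kleinDir p Q₁, kleinDir p Q₂]) {s₁ s₂ r t : ℝ}
    (hs₁ : 0 < s₁) (hs₂ : 0 < s₂)
    (hp : klein p ∈ Ω) (ha : klein (expLine p Q₁ (-s₁)) ∈ Ω) (hb : klein (expLine p Q₁ s₂) ∈ Ω)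
    (hc : klein (expLine p Q₂ r) ∈ Ω)
    (hab : dist (g (expLine p Q₁ (-s₁))) (g (expLine p Q₁ s₂)) = s₁ + s₂)
    (hpc : dist (g p) (g (expLine p Q₂ r)) = r) (ht : 0 < t) (htr : t < r) :
    ∃ V ∈ 𝓝 (expLine p Q₂ t), ∀ q ∈ V, ∀ q' ∈ V, dist (g q) (g q') = dist q q' := by
  set a := expLine p Q₁ (-s₁)
  set b := expLine p Q₁ s₂
  set c := expLine p Q₂ r
  have hab' : dist (g a) (g b) = dist a b := by
    rw [hab, dist_expLine h₁, abs_sub_comm, abs_of_nonneg (by linarith)]; ring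
  have hpc' : dist (g p) (g c) = dist p c := by
    conv_rhs => rw [← expLine_zero h₂]
    rw [hpc, dist_expLine h₂, zero_sub, abs_neg, abs_of_nonneg (by linarith)]
  have hapb : dist a p + dist p b = dist a b := by
    have := dist_add_dist_expLine h₁ (r := -s₁) (s := 0) (t := s₂) (by linarith) hs₂.le
    rwa [expLine_zero h₁] at this
  have hne : ∀ u ≠ 0, expLine p Q₁ u ≠ p := fun u hu h => hu <| expLine_injective h₁ <| by
    rw [h, expLine_zero h₁]
  obtain ⟨hbc, hac⟩ := dist_eq_of_tripod (D := klein ⁻¹' Ω) hg ha hb hc hp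
    (hne _ (by linarith)) (hne _ hs₂.ne').symm hapb hab' hpc'
  have hK := convex_klein_image_rigidSet hΩ hg hab' hbc hac
  set K := klein '' (rigidSet g a b c ∩ klein ⁻¹' Ω)
  have hKn : K ∈ 𝓝 (klein (expLine p Q₂ t)) := by
    have ka : klein a ∈ K := mem_image_of_mem _ ⟨left_mem_rigidSet a b c, ha⟩
    have kb : klein b ∈ K := mem_image_of_mem _ ⟨mid_mem_rigidSet a b c, hb⟩
    have kc : klein c ∈ K := mem_image_of_mem _ ⟨right_mem_rigidSet a b c, hc⟩
    rw [klein_expLine h₁, Real.sinh_neg, neg_div] at ka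
    rw [klein_expLine h₁] at kb
    rw [klein_expLine h₂] at kc ⊢
    refine mem_nhds_of_triangle he hK ?_ ?_ ka kb kc ?_ ?_
    · exact div_pos (Real.sinh_pos_iff.2 hs₁) (time_pos _)
    · exact div_pos (Real.sinh_pos_iff.2 hs₂) (time_pos _)
    · exact div_pos (Real.sinh_pos_iff.2 ht) (time_pos _)
    · exact strictMono_sinh_div_time h₂ htr
  refine ⟨klein ⁻¹' K, continuous_klein.continuousAt.preimage_mem_nhds hKn, ?_⟩
  rintro q ⟨q₁, hq₁, h⟩ q' ⟨q₂, hq₂, h'⟩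
  rw [← klein_injective h, ← klein_injective h']
  exact dist_eq_of_mem_rigidSet hab' hbc hac hq₁.1 hq₂.1

/-- If `g` preserves the lengths of two crossing segments, then it is an isometry near each
interior point of the first. -/
theorem isometric_of_crossing (hΩ : Convex ℝ Ω)
    (hg : ∀ p, klein p ∈ Ω → ∀ q, klein q ∈ Ω → dist (g p) (g q) ≤ dist p q)
    (h₁ : IsUnitTangent p Q₁) (h₂ : IsUnitTangent p Q₂)
    (he : LinearIndependent ℝ ![kleinDir p Q₁, kleinDir p Q₂]) {s₁ s₂ r t : ℝ}
    (hs₁ : 0 < s₁) (hs₂ : 0 < s₂) (hr : 0 < r)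
    (hp : klein p ∈ Ω) (ha : klein (expLine p Q₁ (-s₁)) ∈ Ω) (hb : klein (expLine p Q₁ s₂) ∈ Ω)
    (hc : klein (expLine p Q₂ r) ∈ Ω) (hd : klein (expLine p Q₂ (-r)) ∈ Ω)
    (hab : dist (g (expLine p Q₁ (-s₁))) (g (expLine p Q₁ s₂)) = s₁ + s₂)
    (hcd : dist (g (expLine p Q₂ (-r))) (g (expLine p Q₂ r)) = r + r)
    (ht : -s₁ < t) (hts : t < s₂) :
    ∃ V ∈ 𝓝 (expLine p Q₁ t), ∀ q ∈ V, ∀ q' ∈ V, dist (g q) (g q') = dist q q' := by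
  set a := expLine p Q₁ (-s₁)
  set b := expLine p Q₁ s₂
  set c := expLine p Q₂ r
  set d := expLine p Q₂ (-r)
  have hab' : dist (g a) (g b) = dist a b := by
    rw [hab, dist_expLine h₁, abs_sub_comm, abs_of_nonneg (by linarith)]; ring
  have hcd' : dist (g c) (g d) = dist c d := by
    rw [dist_comm, hcd, dist_expLine h₂, abs_of_nonneg (by linarith)]; ring
  have hapb : dist a p + dist p b = dist a b := by
    have := dist_add_dist_expLine h₁ (r := -s₁) (s := 0) (t := s₂) (by linarith) hs₂.le
    rwa [expLine_zero h₁] at this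
  have hcpd : dist c p + dist p d = dist c d := by
    have := dist_add_dist_expLine h₂ (r := -r) (s := 0) (t := r) (by linarith) hr.le
    rw [expLine_zero h₂] at this
    rw [dist_comm c p, dist_comm p d, dist_comm c d, add_comm]
    exact this
  have hne : ∀ {Q}, IsUnitTangent p Q → ∀ u ≠ 0, expLine p Q u ≠ p :=
    fun hQ u hu h => hu <| expLine_injective hQ <| by rw [h, expLine_zero hQ]
  have hpc' : dist (g p) (g c) = dist p c := by
    rw [dist_comm, dist_comm p]
    exact (dist_eq_of_between (D := klein ⁻¹' Ω) hg hc hp hd hcpd hcd').1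
  obtain ⟨hbc, hac⟩ := dist_eq_of_tripod (D := klein ⁻¹' Ω) hg ha hb hc hp
    (hne h₁ _ (by linarith)) (hne h₁ _ hs₂.ne').symm hapb hab' hpc'
  have pR : p ∈ rigidSet g a b c := between_mem_rigidSet (D := klein ⁻¹' Ω) hg hab' hbc hac
    ha hp hb (left_mem_rigidSet a b c) (mid_mem_rigidSet a b c) hapb
  have dR : d ∈ rigidSet g a b c := beyond_mem_rigidSet (D := klein ⁻¹' Ω) hg hc hp hd
    (right_mem_rigidSet a b c) pR (hne h₂ _ hr.ne') hcpd hcd'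
  have hK := convex_klein_image_rigidSet hΩ hg hab' hbc hac
  set K := klein '' (rigidSet g a b c ∩ klein ⁻¹' Ω)
  have hKn : K ∈ 𝓝 (klein (expLine p Q₁ t)) := by
    have ka : klein a ∈ K := mem_image_of_mem _ ⟨left_mem_rigidSet a b c, ha⟩
    have kb : klein b ∈ K := mem_image_of_mem _ ⟨mid_mem_rigidSet a b c, hb⟩
    have kc : klein c ∈ K := mem_image_of_mem _ ⟨right_mem_rigidSet a b c, hc⟩
    have kd : klein d ∈ K := mem_image_of_mem _ ⟨dR, hd⟩
    rw [klein_expLine h₁, Real.sinh_neg, neg_div] at ka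
    rw [klein_expLine h₂, Real.sinh_neg, neg_div] at kd
    rw [klein_expLine h₁] at kb ⊢
    rw [klein_expLine h₂] at kc
    refine mem_nhds_of_quadrilateral he hK ?_ ?_ ka kb kd kc ?_ ?_
    · exact div_pos (Real.sinh_pos_iff.2 hr) (time_pos _)
    · exact div_pos (Real.sinh_pos_iff.2 hr) (time_pos _)
    · rw [← neg_div, ← Real.sinh_neg]; exact strictMono_sinh_div_time h₁ ht
    · exact strictMono_sinh_div_time h₁ hts
  refine ⟨klein ⁻¹' K, continuous_klein.continuousAt.preimage_mem_nhds hKn, ?_⟩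
  rintro q ⟨q₁, hq₁, h⟩ q' ⟨q₂, hq₂, h'⟩
  rw [← klein_injective h, ← klein_injective h']
  exact dist_eq_of_mem_rigidSet hab' hbc hac hq₁.1 hq₂.1

end Crossing

end HypSpace

/-! ### Locally hyperbolic spaces and the continuation of geodesics -/

section Charts

open HypSpace

variable {n : ℕ} {M : Type*} [EMetricSpace M]

/-- A chart with values in hyperbolic space which preserves distances. -/
def IsIsometricChart (φ : OpenPartialHomeomorph M (HypSpace n)) : Prop :=
  ∀ p ∈ φ.source, ∀ q ∈ φ.source, edist (φ p) (φ q) = edist p q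

/-- Every point is in the domain of an isometric chart with values in hyperbolic space. -/
class IsLocallyHyperbolic (n : ℕ) (M : Type*) [EMetricSpace M] : Prop where
  exists_isometricChart (n) : ∀ x : M, ∃ φ : OpenPartialHomeomorph M (HypSpace n),
    x ∈ φ.source ∧ IsIsometricChart φ

instance : IsLocallyHyperbolic n (HypSpace n) :=
  ⟨fun x => ⟨OpenPartialHomeomorph.refl _, mem_univ x, fun _ _ _ _ => rfl⟩⟩

instance [IsHyperbolicManifold n M] : IsLocallyHyperbolic n M := ⟨fun x => by
  obtain ⟨r, hr, c, ⟨e⟩⟩ := IsHyperbolicManifold.locally_isometric (n := n) x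
  let U : TopologicalSpace.Opens M := ⟨Metric.eball x r, Metric.isOpen_eball⟩
  let V : TopologicalSpace.Opens (HypSpace n) := ⟨Metric.eball c r, Metric.isOpen_eball⟩
  have hU : x ∈ U := Metric.mem_eball_self hr
  have hV : c ∈ V := Metric.mem_eball_self hr
  let φ₁ := U.openPartialHomeomorphSubtypeCoe ⟨⟨x, hU⟩⟩
  let φ₂ := V.openPartialHomeomorphSubtypeCoe ⟨⟨c, hV⟩⟩
  let ε : OpenPartialHomeomorph U V := e.toHomeomorph.toOpenPartialHomeomorph
  have key : ∀ p : U, (φ₁.symm.trans (ε.trans φ₂)) p = e p := fun p => by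
    have : φ₁.symm (φ₁ p) = p := φ₁.left_inv (by simp [φ₁])
    exact congrArg (fun q : U => ((e q : V) : HypSpace n)) this
  have hsrc : (φ₁.symm.trans (ε.trans φ₂)).source ⊆ U := fun p hp => by
    rw [OpenPartialHomeomorph.trans_source] at hp
    simpa [φ₁] using hp.1
  refine ⟨φ₁.symm.trans (ε.trans φ₂), ?_, fun p hp q hq => ?_⟩
  · simp [φ₁, φ₂, ε, hU]
  · rw [key ⟨p, hsrc hp⟩, key ⟨q, hsrc hq⟩]
    exact e.isometry _ _⟩

/-- `γ` is a unit-speed geodesic near the parameter `t`. -/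
def IsGeodesicAt (γ : ℝ → M) (t : ℝ) : Prop :=
  ∃ δ > 0, ∀ s ∈ Metric.ball t δ, ∀ s' ∈ Metric.ball t δ, edist (γ s) (γ s') = edist s s'

theorem isGeodesicOn_iff_of_isOpen {γ : ℝ → M} {I : Set ℝ} (hI : IsOpen I) :
    IsGeodesicOn γ I ↔ ∀ t ∈ I, IsGeodesicAt γ t := by
  refine forall₂_congr fun t ht => ⟨?_, ?_⟩
  · rintro ⟨δ, hδ, h⟩
    obtain ⟨δ', hδ', h'⟩ := Metric.isOpen_iff.1 hI t ht
    refine ⟨min δ δ', lt_min hδ hδ', fun s hs s' hs' => ?_⟩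
    exact h s ⟨h' (Metric.ball_subset_ball (min_le_right _ _) hs),
      Metric.ball_subset_ball (min_le_left _ _) hs⟩ s'
      ⟨h' (Metric.ball_subset_ball (min_le_right _ _) hs'),
        Metric.ball_subset_ball (min_le_left _ _) hs'⟩
  · rintro ⟨δ, hδ, h⟩
    exact ⟨δ, hδ, fun s hs s' hs' => h s hs.2 s' hs'.2⟩

namespace IsGeodesicAt

variable {γ γ' : ℝ → M} {t : ℝ}

theorem congr (h : IsGeodesicAt γ t) (hγ : γ =ᶠ[𝓝 t] γ') : IsGeodesicAt γ' t := by
  obtain ⟨δ, hδ, h⟩ := h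
  obtain ⟨δ', hδ', h'⟩ := Metric.eventually_nhds_iff_ball.1 hγ
  refine ⟨min δ δ', lt_min hδ hδ', fun s hs s' hs' => ?_⟩
  rw [← h' s (Metric.ball_subset_ball (min_le_right _ _) hs),
    ← h' s' (Metric.ball_subset_ball (min_le_right _ _) hs')]
  exact h s (Metric.ball_subset_ball (min_le_left _ _) hs) s'
    (Metric.ball_subset_ball (min_le_left _ _) hs')

theorem comp_isometry {σ : ℝ → ℝ} (hσ : Isometry σ) (h : IsGeodesicAt γ (σ t)) :
    IsGeodesicAt (fun u => γ (σ u)) t := by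
  obtain ⟨δ, hδ, h⟩ := h
  refine ⟨δ, hδ, fun s hs s' hs' => ?_⟩
  rw [h (σ s) (by rwa [Metric.mem_ball, hσ.dist_eq]) (σ s') (by rwa [Metric.mem_ball, hσ.dist_eq]),
    hσ.edist_eq]

theorem continuousAt (h : IsGeodesicAt γ t) : ContinuousAt γ t := by
  obtain ⟨δ, hδ, h⟩ := h
  rw [EMetric.continuousAt_iff]
  intro ε hε
  have hmem : Metric.ball t δ ∩ Metric.eball t ε ∈ 𝓝 t :=
    inter_mem (Metric.ball_mem_nhds t hδ) (Metric.eball_mem_nhds t hε)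
  obtain ⟨δ', hδ', h'⟩ := EMetric.mem_nhds_iff.1 hmem
  refine ⟨δ', hδ', fun s hs => ?_⟩
  rw [h s (h' hs).1 t (Metric.mem_ball_self hδ)]
  exact (h' hs).2

theorem eventually (h : IsGeodesicAt γ t) : ∀ᶠ s in 𝓝 t, IsGeodesicAt γ s := by
  obtain ⟨δ, hδ, h⟩ := h
  filter_upwards [Metric.ball_mem_nhds t hδ] with s hs
  obtain ⟨δ', hδ', h'⟩ := Metric.isOpen_iff.1 Metric.isOpen_ball s hs
  exact ⟨δ', hδ', fun u hu u' hu' => h u (h' hu) u' (h' hu')⟩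

/-- An isometric map takes geodesics to geodesics. -/
theorem comp_of_isometricOn {M' : Type*} [EMetricSpace M'] {F : M → M'} {U : Set M}
    (hU : U ∈ 𝓝 (γ t)) (hF : ∀ p ∈ U, ∀ q ∈ U, edist (F p) (F q) = edist p q)
    (h : IsGeodesicAt γ t) : IsGeodesicAt (fun s => F (γ s)) t := by
  have hc := h.continuousAt.eventually hU
  obtain ⟨δ, hδ, h⟩ := h
  obtain ⟨δ', hδ', h'⟩ := Metric.eventually_nhds_iff_ball.1 hc
  refine ⟨min δ δ', lt_min hδ hδ', fun s hs s' hs' => ?_⟩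
  rw [hF _ (h' s (Metric.ball_subset_ball (min_le_right _ _) hs)) _
    (h' s' (Metric.ball_subset_ball (min_le_right _ _) hs'))]
  exact h s (Metric.ball_subset_ball (min_le_left _ _) hs) s'
    (Metric.ball_subset_ball (min_le_left _ _) hs')

end IsGeodesicAt

theorem isGeodesicAt_expLine {p : HypSpace n} {Q : Mink n} (h : IsUnitTangent p Q) (t : ℝ) :
    IsGeodesicAt (expLine p Q) t :=
  ⟨1, one_pos, fun _ _ _ _ => edist_expLine h _ _⟩

theorem IsIsometricChart.symm_edist {φ : OpenPartialHomeomorph M (HypSpace n)}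
    (hφ : IsIsometricChart φ) {p q : HypSpace n} (hp : p ∈ φ.target) (hq : q ∈ φ.target) :
    edist (φ.symm p) (φ.symm q) = edist p q := by
  rw [← hφ _ (φ.map_target hp) _ (φ.map_target hq), φ.right_inv hp, φ.right_inv hq]

theorem IsGeodesicAt.chart {φ : OpenPartialHomeomorph M (HypSpace n)} (hφ : IsIsometricChart φ)
    {γ : ℝ → M} {t : ℝ} (ht : γ t ∈ φ.source) (h : IsGeodesicAt γ t) :
    IsGeodesicAt (fun s => φ (γ s)) t :=
  h.comp_of_isometricOn (φ.open_source.mem_nhds ht) hφ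

theorem IsGeodesicAt.chart_symm {φ : OpenPartialHomeomorph M (HypSpace n)}
    (hφ : IsIsometricChart φ) {γ : ℝ → HypSpace n} {t : ℝ} (ht : γ t ∈ φ.target)
    (h : IsGeodesicAt γ t) : IsGeodesicAt (fun s => φ.symm (γ s)) t :=
  h.comp_of_isometricOn (φ.open_target.mem_nhds ht) fun _ hp _ hq => hφ.symm_edist hp hq

theorem dist_eq_abs_of_edist_eq {p q : HypSpace n} {s t : ℝ} (h : edist p q = edist s t) :
    dist p q = |s - t| := by
  rw [dist_edist, h, ← dist_edist, Real.dist_eq]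

/-- In an isometric chart, a geodesic is a geodesic line of hyperbolic space. -/
theorem IsGeodesicAt.exists_expLine {φ : OpenPartialHomeomorph M (HypSpace n)}
    (hφ : IsIsometricChart φ) {γ : ℝ → M} {t : ℝ} (ht : γ t ∈ φ.source) (h : IsGeodesicAt γ t) :
    ∃ Q, IsUnitTangent (φ (γ t)) Q ∧
      ∀ᶠ s in 𝓝 t, γ s ∈ φ.source ∧ φ (γ s) = expLine (φ (γ t)) Q (s - t) := by
  have hev : ∀ᶠ s in 𝓝 t, γ s ∈ φ.source := h.continuousAt.eventually (φ.open_source.mem_nhds ht)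
  obtain ⟨δ, hδ, h'⟩ := h.chart hφ ht
  obtain ⟨Q, hQ, hQ'⟩ := exists_eq_expLine (γ := fun s => φ (γ s)) (I := Metric.ball t δ) (t₀ := t)
    (t₁ := t + δ / 2) (by linarith) (Metric.mem_ball_self hδ)
    (by simp [abs_of_pos hδ, hδ])
    fun s hs s' hs' => dist_eq_abs_of_edist_eq (h' s hs s' hs')
  refine ⟨Q, hQ, ?_⟩
  filter_upwards [hev, Metric.ball_mem_nhds t hδ] with s h1 h2 using ⟨h1, hQ' s h2⟩

theorem tangent_eq_of_expLine_eq {p : HypSpace n} {Q Q' : Mink n} (h : IsUnitTangent p Q)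
    (h' : IsUnitTangent p Q') {t : ℝ} (ht : t ≠ 0) (he : expLine p Q t = expLine p Q' t) :
    Q = Q' := by
  have h1 := congrArg vec he
  rw [vec_expLine h, vec_expLine h'] at h1
  exact smul_right_injective _ (Real.sinh_eq_zero.not.2 ht) (add_left_cancel h1)

theorem tangent_eq_of_eventuallyEq {p : HypSpace n} {Q Q' : Mink n} (h : IsUnitTangent p Q)
    (h' : IsUnitTangent p Q') (he : expLine p Q =ᶠ[𝓝 0] expLine p Q') : Q = Q' := by
  obtain ⟨t, ht, ht0⟩ := ((he.filter_mono nhdsWithin_le_nhds).and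
    (self_mem_nhdsWithin : ({0}ᶜ : Set ℝ) ∈ 𝓝[≠] 0)).exists
  exact tangent_eq_of_expLine_eq h h' ht0 ht

/-- Unique continuation: geodesics which agree near one parameter agree as long as both are defined,
since in a chart a geodesic line is determined by its tangent vector at one point. -/
theorem eventuallyEq_of_isGeodesicAt (n : ℕ) [IsLocallyHyperbolic n M] {γ γ' : ℝ → M} {J : Set ℝ}
    (hJ : IsPreconnected J) (h : ∀ t ∈ J, IsGeodesicAt γ t) (h' : ∀ t ∈ J, IsGeodesicAt γ' t)
    {t₀ : ℝ} (ht₀ : t₀ ∈ J) (heq : γ =ᶠ[𝓝 t₀] γ') : ∀ t ∈ J, γ =ᶠ[𝓝 t] γ' := by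
  set A : Set ℝ := {t | γ =ᶠ[𝓝 t] γ'}
  have hA : IsOpen A := isOpen_setOfPred_eventually_nhds
  refine hJ.subset_of_closure_inter_subset hA ⟨t₀, ht₀, heq⟩ ?_
  rintro t ⟨htA, htJ⟩
  have hfr : ∃ᶠ s in 𝓝 t, s ∈ A := mem_closure_iff_frequently.1 htA
  have hγt : γ t = γ' t := by
    by_contra hne
    have := ((h t htJ).continuousAt.prodMk (h' t htJ).continuousAt).eventually
      ((isClosed_diagonal.isOpen_compl).mem_nhds (x := (γ t, γ' t)) hne)
    obtain ⟨s, hs, hs'⟩ := (hfr.and_eventually this).exists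
    exact hs' hs.self_of_nhds
  obtain ⟨φ, hx, hφ⟩ := IsLocallyHyperbolic.exists_isometricChart n (γ t)
  obtain ⟨Q, hQ, hγ⟩ := (h t htJ).exists_expLine hφ hx
  obtain ⟨Q', hQ', hγ'⟩ := (h' t htJ).exists_expLine hφ (hγt ▸ hx)
  rw [← hγt] at hQ' hγ'
  have hQQ : Q = Q' := by
    obtain ⟨s, hsA, hs, hs'⟩ :=
      (hfr.and_eventually (hγ.eventually_nhds.and hγ'.eventually_nhds)).exists
    have hev : ∀ᶠ u in 𝓝 s, expLine (φ (γ t)) Q (u - t) = expLine (φ (γ t)) Q' (u - t) := by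
      filter_upwards [hsA, hs, hs'] with u h1 h2 h3
      rw [← h2.2, ← h3.2, h1]
    obtain ⟨u, hut, hu⟩ := (dense_compl_singleton t).inter_nhds_nonempty hev
    exact tangent_eq_of_expLine_eq hQ hQ' (sub_ne_zero.2 hut) hu
  filter_upwards [hγ, hγ'] with s h1 h2
  exact φ.injOn h1.1 h2.1 (by rw [h1.2, h2.2, hQQ])

/-- A path in hyperbolic space which is locally a geodesic is a geodesic line. -/
theorem eq_expLine_of_isGeodesicAt {γ : ℝ → HypSpace n} {J : Set ℝ} (hJ : IsPreconnected J)
    (h : ∀ t ∈ J, IsGeodesicAt γ t) {t₀ : ℝ} (ht₀ : t₀ ∈ J) :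
    ∃ Q, IsUnitTangent (γ t₀) Q ∧ ∀ t ∈ J, γ t = expLine (γ t₀) Q (t - t₀) := by
  obtain ⟨Q, hQ, hev⟩ := (h t₀ ht₀).exists_expLine (φ := OpenPartialHomeomorph.refl _)
    (fun _ _ _ _ => rfl) (mem_univ _)
  refine ⟨Q, hQ, fun t ht => ?_⟩
  have hiso : Isometry fun s : ℝ => s - t₀ := (IsometryEquiv.subRight t₀).isometry
  exact (eventuallyEq_of_isGeodesicAt n hJ h
    (fun t _ => (isGeodesicAt_expLine hQ (t - t₀)).comp_isometry (σ := fun s => s - t₀) hiso) ht₀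
    (hev.mono fun s hs => hs.2) t ht).self_of_nhds

/-- A locally distance-preserving path does not increase distances. -/
theorem edist_le_of_isGeodesicAt {γ : ℝ → M} {a b : ℝ} (h : ∀ t ∈ Ioo a b, IsGeodesicAt γ t)
    {s t : ℝ} (hs : s ∈ Ioo a b) (ht : t ∈ Ioo a b) : edist (γ s) (γ t) ≤ edist s t := by
  wlog hst : s ≤ t generalizing s t
  · rw [edist_comm, edist_comm s]
    exact this ht hs (le_of_not_ge hst)
  have hsub : Icc s t ⊆ Ioo a b := fun u hu => ⟨hs.1.trans_le hu.1, hu.2.trans_lt ht.2⟩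
  have hc : ContinuousOn γ (Icc s t) := fun u hu => (h u (hsub hu)).continuousAt.continuousWithinAt
  have hcl : IsClosed ({u | edist (γ s) (γ u) ≤ edist s u} ∩ Icc s t) := by
    rw [inter_comm]
    refine IsClosed.isClosed_le (f := fun u => edist (γ s) (γ u)) (g := fun u => edist s u)
      isClosed_Icc ?_ ?_
    · exact continuous_edist.comp_continuousOn (f := fun u => (γ s, γ u))
        (continuousOn_const.prodMk hc)
    · exact (continuous_edist.comp (f := fun u => (s, u)) (by fun_prop)).continuousOn
  have := hcl.Icc_subset_of_forall_mem_nhdsWithin (by simp) fun u hu => by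
    obtain ⟨δ, hδ, hu'⟩ := h u (hsub (Ico_subset_Icc_self hu.2))
    filter_upwards [nhdsWithin_le_nhds (Metric.ball_mem_nhds u hδ), self_mem_nhdsWithin]
      with v hv huv
    refine (edist_triangle _ (γ u) _).trans ((add_le_add hu.1
      (hu' u (Metric.mem_ball_self hδ) v hv).le).trans (le_of_eq ?_))
    have huv' : u < v := huv
    have hsu := hu.2.1
    simp only [edist_dist, Real.dist_eq]
    rw [← ENNReal.ofReal_add (abs_nonneg _) (abs_nonneg _), abs_sub_comm s u, abs_sub_comm u v,
      abs_sub_comm s v, abs_of_nonneg (by linarith), abs_of_nonneg (by linarith),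
      abs_of_nonneg (by linarith)]
    congr 1; ring
  exact this ⟨hst, le_rfl⟩

end Charts

/-! ### Charts adapted to a pleated surface -/

section PleatedCharts

open HypSpace

namespace HypSpace

/-- Geodesic segments with end points in a Klein convex set stay in the set. -/
theorem klein_expLine_mem {n : ℕ} {Ω : Set (EuclideanSpace ℝ (Fin n))} (hΩ : Convex ℝ Ω)
    {p : HypSpace n} {Q : Mink n} (h : IsUnitTangent p Q) {s t u : ℝ} (hst : s ≤ t) (htu : t ≤ u)
    (hs : klein (expLine p Q s) ∈ Ω) (hu : klein (expLine p Q u) ∈ Ω) :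
    klein (expLine p Q t) ∈ Ω := by
  have hmono := (strictMono_sinh_div_time h).monotone
  rw [klein_expLine h] at hs hu ⊢
  have ht : Real.sinh t / (expLine p Q t).time ∈ segment ℝ (Real.sinh s / (expLine p Q s).time)
      (Real.sinh u / (expLine p Q u).time) := by
    rw [segment_eq_Icc (hmono (hst.trans htu))]
    exact ⟨hmono hst, hmono htu⟩
  obtain ⟨a, b, ha, hb, hab, e⟩ := ht
  rw [← e]
  refine hΩ.segment_subset hs hu ⟨a, b, ha, hb, hab, ?_⟩
  have e1 : klein p = (a + b) • klein p := by rw [hab, one_smul]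
  conv_rhs => rw [e1]
  simp only [smul_eq_mul]
  module

end HypSpace

variable {S N : Type*} [EMetricSpace S] [EMetricSpace N] {f : S → N}

/-- A pair of isometric charts of the surface and of the `3`-manifold, adapted to the map `f`; the
domain of the former corresponds to a convex set in the Klein model. -/
structure PleatedChart (f : S → N) where
  /-- the chart of the surface -/
  φ : OpenPartialHomeomorph S (HypSpace 2)
  /-- the chart of the `3`-manifold -/
  ψ : OpenPartialHomeomorph N (HypSpace 3)
  /-- the image of the chart of the surface, in the Klein model -/
  Ω : Set (EuclideanSpace ℝ (Fin 2))
  isometric_φ : IsIsometricChart φ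
  isometric_ψ : IsIsometricChart ψ
  convex : Convex ℝ Ω
  target_φ : φ.target = klein ⁻¹' Ω
  mapsTo : MapsTo f φ.source ψ.source

/-- Small balls of the Klein model, pulled back to the surface, are domains of adapted charts. -/
theorem exists_pleatedChart [IsLocallyHyperbolic 2 S] [IsLocallyHyperbolic 3 N]
    (hf : Continuous f) (x : S) : ∃ C : PleatedChart f, x ∈ C.φ.source := by
  obtain ⟨φ, hx, hφ⟩ := IsLocallyHyperbolic.exists_isometricChart 2 x
  obtain ⟨ψ, hfx, hψ⟩ := IsLocallyHyperbolic.exists_isometricChart 3 (f x)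
  let θ := φ.trans (kleinChart 2)
  have hθx : x ∈ θ.source := by simp [θ, hx, kleinChart]
  have hev : ∀ᶠ w in 𝓝 (θ x), w ∈ θ.target ∧ f (θ.symm w) ∈ ψ.source := by
    refine Filter.Eventually.and (θ.open_target.mem_nhds (θ.map_source hθx)) ?_
    have h1 : ContinuousAt (fun w => f (θ.symm w)) (θ x) :=
      ContinuousAt.comp hf.continuousAt (θ.symm.continuousAt (θ.map_source hθx))
    refine h1.eventually (ψ.open_source.mem_nhds ?_)
    change f (θ.symm (θ x)) ∈ ψ.source
    rwa [θ.left_inv hθx]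
  obtain ⟨R, hR, hball⟩ := Metric.eventually_nhds_iff_ball.1 hev
  have hΩ : IsOpen (klein ⁻¹' (Metric.ball (θ x) R)) :=
    Metric.isOpen_ball.preimage continuous_klein
  have hsymm : ∀ q : HypSpace 2, θ.symm (klein q) = φ.symm q := fun q =>
    congrArg φ.symm ((kleinChart 2).left_inv (mem_univ q))
  have hsub : klein ⁻¹' (Metric.ball (θ x) R) ⊆ φ.target := fun q hq => by
    have h1 : (kleinChart 2).symm (klein q) ∈ φ.target := ((hball _ hq).1).2
    rwa [show (kleinChart 2).symm (klein q) = q from (kleinChart 2).left_inv (mem_univ q)] at h1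
  let φ' := (φ.symm.restrOpen _ hΩ).symm
  have hsrc : ∀ p, p ∈ φ'.source ↔ p ∈ φ.source ∧ klein (φ p) ∈ Metric.ball (θ x) R := by
    intro p
    simp [φ']
  refine ⟨⟨φ', ψ, Metric.ball (θ x) R, ?_, hψ, convex_ball _ _, ?_, ?_⟩, ?_⟩
  · exact fun p hp q hq => hφ p ((hsrc p).1 hp).1 q ((hsrc q).1 hq).1
  · have : φ'.target = φ.target ∩ klein ⁻¹' (Metric.ball (θ x) R) := by simp [φ']
    rw [this, inter_eq_right.2 hsub]
  · intro p hp
    have h1 := (hsrc p).1 hp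
    have h2 := (hball _ h1.2).2
    rwa [hsymm, φ.left_inv h1.1] at h2
  · exact (hsrc x).2 ⟨hx, Metric.mem_ball_self hR⟩

namespace PleatedChart

variable (C : PleatedChart f)

theorem mem_target {p : HypSpace 2} : p ∈ C.φ.target ↔ klein p ∈ C.Ω := by
  rw [C.target_φ]; rfl

/-- Pleated surfaces do not increase distances, locally, since geodesic segments keep their
lengths. -/
theorem edist_le (hf : IsPleatedSurface f) {p q : S} (hp : p ∈ C.φ.source) (hq : q ∈ C.φ.source) :
    edist (f p) (f q) ≤ edist p q := by
  rcases eq_or_ne p q with rfl | hne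
  · simp
  have hne' : C.φ p ≠ C.φ q := fun h => hne (C.φ.injOn hp hq h)
  obtain ⟨Q, hQ, hd⟩ := exists_expLine_dist hne'
  set d := dist (C.φ p) (C.φ q)
  have hd0 : 0 ≤ d := dist_nonneg
  let γ : ℝ → S := fun t => C.φ.symm (expLine (C.φ p) Q t)
  have h0 : γ 0 = p := by simp only [γ]; rw [expLine_zero hQ, C.φ.left_inv hp]
  have h1 : γ d = q := by simp only [γ]; rw [hd, C.φ.left_inv hq]
  have hmem : ∀ t ∈ Icc 0 d, expLine (C.φ p) Q t ∈ C.φ.target := fun t ht => by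
    rw [C.mem_target]
    refine klein_expLine_mem C.convex hQ ht.1 ht.2 ?_ ?_
    · rw [expLine_zero hQ, ← C.mem_target]; exact C.φ.map_source hp
    · rw [hd, ← C.mem_target]; exact C.φ.map_source hq
  have hiso : ∀ s ∈ Icc 0 d, ∀ t ∈ Icc 0 d, edist (γ s) (γ t) = edist s t := fun s hs t ht => by
    simp only [γ]
    rw [C.isometric_φ.symm_edist (hmem s hs) (hmem t ht), edist_expLine hQ]
  have hgeo : IsGeodesicOn γ (Icc 0 d) := fun t _ =>
    ⟨1, one_pos, fun s hs s' hs' => hiso s hs.1 s' hs'.1⟩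
  -- a distance-preserving path over `[0, d]` has length at most `d`, and its image does as well
  have hL : LipschitzOnWith 1 γ (Icc 0 d) := fun s hs t ht => by
    rw [hiso s hs t ht, ENNReal.coe_one, one_mul]
  have hvar : eVariationOn γ (Icc 0 d) ≤ ENNReal.ofReal d := by
    have h2 := hL.comp_eVariationOn_le (g := fun t : ℝ => t) (s := Icc 0 d) fun t ht => ht
    have h3 := (monotone_id.monotoneOn (Icc (0 : ℝ) d)).eVariationOn_eq (left_mem_Icc.2 hd0)
      (right_mem_Icc.2 hd0)
    rw [inter_self, id, id, sub_zero] at h3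
    rw [ENNReal.coe_one, one_mul] at h2
    exact h2.trans h3.le
  have h4 := eVariationOn.edist_le (f ∘ γ) (left_mem_Icc.2 hd0) (right_mem_Icc.2 hd0)
  rw [(hf.isometric γ 0 d hd0 hgeo).2, Function.comp, Function.comp, h0, h1] at h4
  refine h4.trans (hvar.trans (le_of_eq ?_))
  rw [← C.isometric_φ p hp q hq, edist_dist]

/-- The pleated surface in the charts. -/
noncomputable def map : HypSpace 2 → HypSpace 3 := fun p => C.ψ (f (C.φ.symm p))

theorem edist_map {p q : HypSpace 2} (hp : p ∈ C.φ.target) (hq : q ∈ C.φ.target) :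
    edist (C.map p) (C.map q) = edist (f (C.φ.symm p)) (f (C.φ.symm q)) :=
  C.isometric_ψ _ (C.mapsTo (C.φ.map_target hp)) _ (C.mapsTo (C.φ.map_target hq))

theorem dist_map_le (hf : IsPleatedSurface f) (p : HypSpace 2) (hp : klein p ∈ C.Ω)
    (q : HypSpace 2) (hq : klein q ∈ C.Ω) : dist (C.map p) (C.map q) ≤ dist p q := by
  rw [← C.mem_target] at hp hq
  rw [dist_edist, dist_edist]
  refine ENNReal.toReal_mono (edist_ne_top _ _) ?_
  rw [C.edist_map hp hq, ← C.isometric_φ.symm_edist hp hq]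
  exact C.edist_le hf (C.φ.map_target hp) (C.φ.map_target hq)

end PleatedChart

/-! ### Points near which the map is isometric -/

/-- `f` preserves distances in a neighbourhood of `x`. -/
def IsLocallyIsometricAt (f : S → N) (x : S) : Prop :=
  ∃ U ∈ 𝓝 x, ∀ p ∈ U, ∀ q ∈ U, edist (f p) (f q) = edist p q

theorem isOpen_isLocallyIsometricAt : IsOpen {x | IsLocallyIsometricAt f x} := by
  refine isOpen_iff_mem_nhds.2 fun x ⟨U, hU, h⟩ => ?_
  filter_upwards [eventually_mem_nhds_iff.2 hU] with y hy using ⟨U, hy, h⟩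

theorem PleatedChart.isLocallyIsometricAt (C : PleatedChart f) {p : HypSpace 2}
    (hp : p ∈ C.φ.target)
    (h : ∃ V ∈ 𝓝 p, ∀ q ∈ V, ∀ q' ∈ V, dist (C.map q) (C.map q') = dist q q') :
    IsLocallyIsometricAt f (C.φ.symm p) := by
  obtain ⟨V, hV, h⟩ := h
  have hs := C.φ.map_target hp
  refine ⟨C.φ.source ∩ C.φ ⁻¹' V, inter_mem (C.φ.open_source.mem_nhds hs)
    ((C.φ.continuousAt hs).preimage_mem_nhds (by rwa [C.φ.right_inv hp])), ?_⟩
  rintro q ⟨hq, hqV⟩ q' ⟨hq', hqV'⟩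
  have h1 := h _ hqV _ hqV'
  have h2 : edist (C.map (C.φ q)) (C.map (C.φ q')) = edist (C.φ q) (C.φ q') := by
    rw [edist_dist, h1, edist_dist]
  rwa [C.edist_map (C.φ.map_source hq) (C.φ.map_source hq'), C.φ.left_inv hq, C.φ.left_inv hq',
    C.isometric_φ q hq q' hq'] at h2

theorem isMappedGeodesicAt_iff {x : S} {γ : ℝ → S} :
    IsMappedGeodesicAt f x γ ↔ γ 0 = x ∧ IsGeodesicAt γ 0 ∧ IsGeodesicAt (f ∘ γ) 0 := by
  refine and_congr_right fun _ => ⟨?_, ?_⟩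
  · rintro ⟨ε, hε, h1, h2⟩
    have h0 : (0 : ℝ) ∈ Ioo (-ε) ε := ⟨by linarith, hε⟩
    exact ⟨(isGeodesicOn_iff_of_isOpen isOpen_Ioo).1 h1 0 h0,
      (isGeodesicOn_iff_of_isOpen isOpen_Ioo).1 h2 0 h0⟩
  · rintro ⟨h1, h2⟩
    obtain ⟨ε, hε, h⟩ := Metric.eventually_nhds_iff_ball.1 (h1.eventually.and h2.eventually)
    rw [Real.ball_eq_Ioo, zero_sub, zero_add] at h
    exact ⟨ε, hε, (isGeodesicOn_iff_of_isOpen isOpen_Ioo).2 fun t ht => (h t ht).1,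
      (isGeodesicOn_iff_of_isOpen isOpen_Ioo).2 fun t ht => (h t ht).2⟩

/-- Geodesics of a surface through a point with different germs are transverse. -/
theorem linearIndependent_of_not_sameGerm {φ : OpenPartialHomeomorph S (HypSpace 2)}
    {p : HypSpace 2} {γ₁ γ₂ : ℝ → S} {Q₁ Q₂ : Mink 2} (h₁ : IsUnitTangent p Q₁)
    (h₂ : IsUnitTangent p Q₂)
    (hγ₁ : ∀ᶠ s in 𝓝 (0 : ℝ), γ₁ s ∈ φ.source ∧ φ (γ₁ s) = expLine p Q₁ s)
    (hγ₂ : ∀ᶠ s in 𝓝 (0 : ℝ), γ₂ s ∈ φ.source ∧ φ (γ₂ s) = expLine p Q₂ s)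
    (h : ¬ SameGerm γ₁ γ₂) : LinearIndependent ℝ ![kleinDir p Q₁, kleinDir p Q₂] := by
  refine (LinearIndependent.pair_iff' (kleinDir_ne_zero h₁)).2 fun c hc => h ?_
  rcases eq_or_eq_neg_of_kleinDir h₁ h₂ hc.symm with rfl | rfl
  · left
    filter_upwards [hγ₁, hγ₂] with s h1 h2
    exact φ.injOn h1.1 h2.1 (by rw [h1.2, h2.2])
  · right
    have hneg : Tendsto (fun s : ℝ => -s) (𝓝 0) (𝓝 0) := by
      simpa using (continuous_neg (G := ℝ)).tendsto 0
    filter_upwards [hγ₁, hneg.eventually hγ₂] with s h1 h2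
    exact φ.injOn h1.1 h2.1 (by rw [h1.2, h2.2, expLine_neg, neg_neg])

/-- Where `f` is locally isometric, geodesics in all directions are mapped to geodesics. -/
theorem not_mem_pleatingLocus_of_isLocallyIsometricAt [IsLocallyHyperbolic 2 S] {x : S}
    (h : IsLocallyIsometricAt f x) : x ∉ pleatingLocus f := by
  rintro ⟨-, hun⟩
  obtain ⟨φ, hx, hφ⟩ := IsLocallyHyperbolic.exists_isometricChart 2 x
  obtain ⟨U, hU, hiso⟩ := h
  have key : ∀ Q, IsUnitTangent (φ x) Q →
      IsMappedGeodesicAt f x fun t => φ.symm (expLine (φ x) Q t) := fun Q hQ => by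
    have h0 : φ.symm (expLine (φ x) Q 0) = x := by rw [expLine_zero hQ, φ.left_inv hx]
    have h1 : IsGeodesicAt (fun t => φ.symm (expLine (φ x) Q t)) 0 :=
      (isGeodesicAt_expLine hQ 0).chart_symm hφ (by rw [expLine_zero hQ]; exact φ.map_source hx)
    exact isMappedGeodesicAt_iff.2 ⟨h0, h1,
      h1.comp_of_isometricOn (F := f) (U := U) (by simp only [h0]; exact hU) hiso⟩
  have hli : LinearIndependent ℝ ![EuclideanSpace.single (0 : Fin 2) (1 : ℝ),
      EuclideanSpace.single (1 : Fin 2) (1 : ℝ)] := by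
    refine LinearIndependent.pair_iff.2 fun s t hst => ?_
    have h0 := congrArg (fun v : EuclideanSpace ℝ (Fin 2) => v 0) hst
    have h1 := congrArg (fun v : EuclideanSpace ℝ (Fin 2) => v 1) hst
    simp at h0 h1
    exact ⟨h0, h1⟩
  obtain ⟨Q₁, h₁, c₁, hc₁, e₁⟩ := exists_kleinDir (φ x) (hli.ne_zero 0)
  obtain ⟨Q₂, h₂, c₂, hc₂, e₂⟩ := exists_kleinDir (φ x) (hli.ne_zero 1)
  have hev : ∀ Q, IsUnitTangent (φ x) Q → ∀ᶠ t in 𝓝 (0 : ℝ), expLine (φ x) Q t ∈ φ.target :=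
    fun Q hQ => (continuous_expLine hQ).continuousAt.eventually
      (φ.open_target.mem_nhds (by rw [expLine_zero hQ]; exact φ.map_source hx))
  have hne : ∀ c : ℝ, kleinDir (φ x) Q₁ ≠ c • kleinDir (φ x) Q₂ := fun c hc => by
    rw [e₁, e₂, ← sub_eq_zero, smul_smul, sub_eq_add_neg, ← neg_smul] at hc
    exact hc₁.ne' (LinearIndependent.pair_iff.1 hli _ _ hc).1
  rcases hun _ _ (key Q₁ h₁) (key Q₂ h₂) with h | h
  · have : Q₁ = Q₂ := by
      refine tangent_eq_of_eventuallyEq h₁ h₂ ?_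
      filter_upwards [h, hev Q₁ h₁, hev Q₂ h₂] with t h3 h4 h5
      exact φ.symm.injOn h4 h5 h3
    exact hne 1 (by rw [this, one_smul])
  · have : Q₁ = -Q₂ := by
      refine tangent_eq_of_eventuallyEq h₁ h₂.neg ?_
      filter_upwards [h, hev Q₁ h₁, hev (-Q₂) h₂.neg] with t h3 h4 h5
      refine φ.symm.injOn h4 h5 ?_
      rw [h3, expLine_neg]
    exact hne (-1) (by rw [this, kleinDir_neg, neg_one_smul])

/-- If a geodesic which is mapped to a geodesic crosses another such geodesic, then the map is
isometric along the whole segment of the former. -/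
theorem PleatedChart.isLocallyIsometricAt_of_crossing (C : PleatedChart f)
    (hf : IsPleatedSurface f) {γ η : ℝ → S} {a b : ℝ} (hsrc : ∀ s ∈ Ioo a b, γ s ∈ C.φ.source)
    (hγ : ∀ s ∈ Ioo a b, ∀ t ∈ Ioo a b, edist (γ s) (γ t) = edist s t)
    (hfγ : ∀ s ∈ Ioo a b, ∀ t ∈ Ioo a b, edist (f (γ s)) (f (γ t)) = edist s t)
    {t₀ : ℝ} (ht₀ : t₀ ∈ Ioo a b) (hη : IsMappedGeodesicAt f (γ t₀) η)
    (hne : ¬ SameGerm (fun s => γ (t₀ + s)) η) {t : ℝ} (ht : t ∈ Ioo a b) :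
    IsLocallyIsometricAt f (γ t) := by
  obtain ⟨hη0, hη1, hη2⟩ := isMappedGeodesicAt_iff.1 hη
  set p := C.φ (γ t₀) with hp
  have hmid : (t₀ + b) / 2 ∈ Ioo a b := ⟨by linarith [ht₀.1, ht₀.2], by linarith [ht₀.2]⟩
  obtain ⟨Q₁, h₁, e₁⟩ := exists_eq_expLine (γ := fun s => C.φ (γ s)) (I := Ioo a b) (t₀ := t₀)
    (by linarith [ht₀.2]) ht₀ hmid fun s hs s' hs' => dist_eq_abs_of_edist_eq (by
      rw [C.isometric_φ _ (hsrc s hs) _ (hsrc s' hs'), hγ s hs s' hs'])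
  obtain ⟨Q₂, h₂, e₂⟩ := hη1.exists_expLine C.isometric_φ (by rw [hη0]; exact hsrc t₀ ht₀)
  simp only [hη0, sub_zero] at h₂ e₂
  rw [← hp] at h₂ e₂
  simp only [← hp] at h₁ e₁
  have hev : ∀ᶠ s in 𝓝 (0 : ℝ), t₀ + s ∈ Ioo a b := by
    refine (continuous_const_add t₀).continuousAt.eventually (isOpen_Ioo.mem_nhds ?_)
    simpa using ht₀
  have he : LinearIndependent ℝ ![kleinDir p Q₁, kleinDir p Q₂] := by
    refine linearIndependent_of_not_sameGerm h₁ h₂ ?_ e₂ hne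
    filter_upwards [hev] with s hs
    exact ⟨hsrc _ hs, by rw [e₁ _ hs, add_sub_cancel_left]⟩
  obtain ⟨δ₁, hδ₁, e₂'⟩ := Metric.eventually_nhds_iff_ball.1 e₂
  obtain ⟨δ₂, hδ₂, hη2⟩ := hη2
  set r := min δ₁ δ₂ / 2 with hr
  have hr0 : 0 < r := by positivity
  have hrm : r < min δ₁ δ₂ := by rw [hr]; linarith
  have hr1 : r < δ₁ := hrm.trans_le (min_le_left _ _)
  have hr2 : r < δ₂ := hrm.trans_le (min_le_right _ _)
  have r1 : r ∈ Metric.ball (0 : ℝ) δ₁ := by simpa [abs_of_pos hr0] using hr1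
  have r1' : -r ∈ Metric.ball (0 : ℝ) δ₁ := by simpa [abs_of_pos hr0] using hr1
  have r2 : r ∈ Metric.ball (0 : ℝ) δ₂ := by simpa [abs_of_pos hr0] using hr2
  have r2' : -r ∈ Metric.ball (0 : ℝ) δ₂ := by simpa [abs_of_pos hr0] using hr2
  have fφ : ∀ q ∈ C.φ.source, C.map (C.φ q) = C.ψ (f q) := fun q hq => by
    rw [PleatedChart.map, C.φ.left_inv hq]
  have mt : ∀ q ∈ C.φ.source, klein (C.φ q) ∈ C.Ω := fun q hq =>
    C.mem_target.1 (C.φ.map_source hq)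
  -- the end points of the segment of `γ` are taken beyond both `t₀` and `t`
  set u := (a + min t t₀) / 2
  set v := (b + max t t₀) / 2
  have hmin : a < min t t₀ := lt_min ht.1 ht₀.1
  have hmax : max t t₀ < b := max_lt ht.2 ht₀.2
  have hum : u < min t t₀ := by simp only [u]; linarith
  have hvm : max t t₀ < v := by simp only [v]; linarith
  have hut := hum.trans_le (min_le_left _ _)
  have hut₀ := hum.trans_le (min_le_right _ _)
  have hvt := (le_max_left _ _).trans_lt hvm
  have hvt₀ := (le_max_right _ _).trans_lt hvm
  have hau : a < u := by simp only [u]; linarith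
  have hvb : v < b := by simp only [v]; linarith
  have hu : u ∈ Ioo a b := ⟨hau, by linarith [ht.2]⟩
  have hv : v ∈ Ioo a b := ⟨by linarith [ht.1], hvb⟩
  have eu : expLine p Q₁ (-(t₀ - u)) = C.φ (γ u) := by rw [e₁ u hu, neg_sub]
  have ev : expLine p Q₁ (v - t₀) = C.φ (γ v) := by rw [e₁ v hv]
  have et : expLine p Q₁ (t - t₀) = C.φ (γ t) := by rw [e₁ t ht]
  have er := e₂' r r1
  have er' := e₂' (-r) r1'
  have := isometric_of_crossing C.convex (C.dist_map_le hf) h₁ h₂ he (s₁ := t₀ - u) (s₂ := v - t₀)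
    (r := r) (t := t - t₀) (by linarith) (by linarith) hr0
    (mt _ (hsrc _ ht₀)) (by rw [eu]; exact mt _ (hsrc _ hu)) (by rw [ev]; exact mt _ (hsrc _ hv))
    (by rw [← er.2]; exact mt _ er.1) (by rw [← er'.2]; exact mt _ er'.1)
    (by
      rw [eu, ev, fφ _ (hsrc _ hu), fφ _ (hsrc _ hv), dist_eq_abs_of_edist_eq (s := u) (t := v),
        abs_sub_comm, abs_of_nonneg (by linarith)]
      · ring
      · rw [C.isometric_ψ _ (C.mapsTo (hsrc _ hu)) _ (C.mapsTo (hsrc _ hv)), hfγ u hu v hv])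
    (by
      rw [← er.2, ← er'.2, fφ _ er.1, fφ _ er'.1, dist_eq_abs_of_edist_eq (s := -r) (t := r),
        abs_sub_comm, abs_of_nonneg (by linarith)]
      · ring
      · rw [C.isometric_ψ _ (C.mapsTo er'.1) _ (C.mapsTo er.1)]
        exact hη2 _ r2' _ r2)
    (by linarith) (by linarith)
  rw [et] at this
  have := C.isLocallyIsometricAt (C.φ.map_source (hsrc t ht)) this
  rwa [C.φ.left_inv (hsrc t ht)] at this

/-- If a geodesic `η` through `x` is mapped to a geodesic, and the distance between the end points
of a transverse segment of length `r` which starts at `x` is preserved, then the map is isometric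
near the interior points of the segment. -/
theorem PleatedChart.isLocallyIsometricAt_of_tripod (C : PleatedChart f)
    (hf : IsPleatedSurface f) {x : S} (hx : x ∈ C.φ.source) {η : ℝ → S}
    (hη : IsMappedGeodesicAt f x η) {Q₁ Q₂ : Mink 2} (h₁ : IsUnitTangent (C.φ x) Q₁)
    (h₂ : IsUnitTangent (C.φ x) Q₂)
    (e₁ : ∀ᶠ s in 𝓝 (0 : ℝ), η s ∈ C.φ.source ∧ C.φ (η s) = expLine (C.φ x) Q₁ s)
    (he : LinearIndependent ℝ ![kleinDir (C.φ x) Q₁, kleinDir (C.φ x) Q₂]) {r t : ℝ} {y z : S}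
    (hy : y ∈ C.φ.source) (hz : z ∈ C.φ.source) (ey : C.φ y = expLine (C.φ x) Q₂ r)
    (ez : C.φ z = expLine (C.φ x) Q₂ t) (hxy : edist (f x) (f y) = ENNReal.ofReal r) (ht : 0 < t)
    (htr : t < r) : IsLocallyIsometricAt f z := by
  obtain ⟨hη0, hη1, hη2⟩ := isMappedGeodesicAt_iff.1 hη
  obtain ⟨δ₁, hδ₁, e₁'⟩ := Metric.eventually_nhds_iff_ball.1 e₁
  obtain ⟨δ₂, hδ₂, hη2⟩ := hη2
  set s := min δ₁ δ₂ / 2 with hs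
  have hs0 : 0 < s := by positivity
  have hsm : s < min δ₁ δ₂ := by rw [hs]; linarith
  have hs1 : s < δ₁ := hsm.trans_le (min_le_left _ _)
  have hs2 : s < δ₂ := hsm.trans_le (min_le_right _ _)
  have s1 : s ∈ Metric.ball (0 : ℝ) δ₁ := by simpa [abs_of_pos hs0] using hs1
  have s1' : -s ∈ Metric.ball (0 : ℝ) δ₁ := by simpa [abs_of_pos hs0] using hs1
  have s2 : s ∈ Metric.ball (0 : ℝ) δ₂ := by simpa [abs_of_pos hs0] using hs2
  have s2' : -s ∈ Metric.ball (0 : ℝ) δ₂ := by simpa [abs_of_pos hs0] using hs2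
  have fφ : ∀ q ∈ C.φ.source, C.map (C.φ q) = C.ψ (f q) := fun q hq => by
    rw [PleatedChart.map, C.φ.left_inv hq]
  have mt : ∀ q ∈ C.φ.source, klein (C.φ q) ∈ C.Ω := fun q hq =>
    C.mem_target.1 (C.φ.map_source hq)
  have es := e₁' s s1
  have es' := e₁' (-s) s1'
  have := isometric_of_tripod C.convex (C.dist_map_le hf) h₁ h₂ he (s₁ := s) (s₂ := s)
    (r := r) (t := t) hs0 hs0 (mt _ hx) (by rw [← es'.2]; exact mt _ es'.1)
    (by rw [← es.2]; exact mt _ es.1) (by rw [← ey]; exact mt _ hy)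
    (by
      rw [← es.2, ← es'.2, fφ _ es.1, fφ _ es'.1, dist_eq_abs_of_edist_eq (s := -s) (t := s),
        abs_sub_comm, abs_of_nonneg (by linarith)]
      · ring
      · rw [C.isometric_ψ _ (C.mapsTo es'.1) _ (C.mapsTo es.1)]
        exact hη2 _ s2' _ s2)
    (by
      rw [← ey, fφ _ hx, fφ _ hy, dist_edist, C.isometric_ψ _ (C.mapsTo hx) _ (C.mapsTo hy), hxy,
        ENNReal.toReal_ofReal (by linarith)])
    ht htr
  rw [← ez] at this
  have := C.isLocallyIsometricAt (C.φ.map_source hz) this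
  rwa [C.φ.left_inv hz] at this

end PleatedCharts

/-! ### The pleating locus and its leaves -/

section Leaves

open HypSpace

variable {S N : Type*} [EMetricSpace S] [EMetricSpace N] {f : S → N}

theorem SameGerm.symm {M : Type*} [EMetricSpace M] {γ γ' : ℝ → M} (h : SameGerm γ γ') :
    SameGerm γ' γ := by
  rcases h with h | h
  · exact Or.inl h.symm
  · right
    have hneg : Tendsto (fun s : ℝ => -s) (𝓝 0) (𝓝 0) := by
      simpa using (continuous_neg (G := ℝ)).tendsto 0
    filter_upwards [hneg.eventually h] with t ht
    rw [ht, neg_neg]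

theorem SameGerm.trans {M : Type*} [EMetricSpace M] {γ γ' γ'' : ℝ → M} (h : SameGerm γ γ')
    (h' : SameGerm γ' γ'') : SameGerm γ γ'' := by
  have hneg : Tendsto (fun s : ℝ => -s) (𝓝 0) (𝓝 0) := by
    simpa using (continuous_neg (G := ℝ)).tendsto 0
  rcases h with h | h <;> rcases h' with h' | h'
  · exact Or.inl (h.trans h')
  · exact Or.inr (h.trans h')
  · right
    filter_upwards [h, hneg.eventually h'] with t h1 h2 using h1.trans h2
  · left
    filter_upwards [h, hneg.eventually h'] with t h1 h2
    rw [h1, h2, neg_neg]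

/-- The path `γ` is, near the parameter `t`, a geodesic mapped to a geodesic by `f`. -/
def IsStraightAt (f : S → N) (γ : ℝ → S) (t : ℝ) : Prop :=
  IsGeodesicAt γ t ∧ IsGeodesicAt (fun s => f (γ s)) t

namespace IsStraightAt

variable {γ γ' : ℝ → S} {t : ℝ}

theorem congr (h : IsStraightAt f γ t) (hγ : γ =ᶠ[𝓝 t] γ') : IsStraightAt f γ' t :=
  ⟨h.1.congr hγ, h.2.congr (hγ.fun_comp f)⟩

theorem comp_isometry {σ : ℝ → ℝ} (hσ : Isometry σ) (h : IsStraightAt f γ (σ t)) :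
    IsStraightAt f (fun u => γ (σ u)) t :=
  ⟨h.1.comp_isometry hσ, h.2.comp_isometry (γ := fun s => f (γ s)) hσ⟩

theorem eventually (h : IsStraightAt f γ t) : ∀ᶠ s in 𝓝 t, IsStraightAt f γ s :=
  h.1.eventually.and h.2.eventually

theorem isMappedGeodesicAt (h : IsStraightAt f γ t) :
    IsMappedGeodesicAt f (γ t) fun s => γ (t + s) := by
  have h' : IsStraightAt f (fun s => γ (t + s)) 0 :=
    IsStraightAt.comp_isometry (isometry_add_left t) (by rwa [add_zero])
  exact isMappedGeodesicAt_iff.2 ⟨by rw [add_zero], h'⟩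

/-- On a small interval, `γ` and its image are distance-preserving, in a given chart. -/
theorem exists_Ioo (C : PleatedChart f) (ht : γ t ∈ C.φ.source) (h : IsStraightAt f γ t) :
    ∃ a b, t ∈ Ioo a b ∧ (∀ s ∈ Ioo a b, γ s ∈ C.φ.source) ∧
      (∀ s ∈ Ioo a b, ∀ t ∈ Ioo a b, edist (γ s) (γ t) = edist s t) ∧
      ∀ s ∈ Ioo a b, ∀ t ∈ Ioo a b, edist (f (γ s)) (f (γ t)) = edist s t := by
  have h0 := h.1.continuousAt.eventually (C.φ.open_source.mem_nhds ht)
  obtain ⟨δ₀, hδ₀, h0⟩ := Metric.eventually_nhds_iff_ball.1 h0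
  obtain ⟨⟨δ₁, hδ₁, h1⟩, ⟨δ₂, hδ₂, h2⟩⟩ := h
  set δ := min δ₀ (min δ₁ δ₂)
  have hδ : 0 < δ := by positivity
  have e : Ioo (t - δ) (t + δ) = Metric.ball t δ := (Real.ball_eq_Ioo t δ).symm
  refine ⟨t - δ, t + δ, ⟨by linarith, by linarith⟩, ?_⟩
  have s0 := Metric.ball_subset_ball (x := t) (min_le_left δ₀ (min δ₁ δ₂))
  have s1 := Metric.ball_subset_ball (x := t)
    ((min_le_right δ₀ (min δ₁ δ₂)).trans (min_le_left _ _))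
  have s2 := Metric.ball_subset_ball (x := t)
    ((min_le_right δ₀ (min δ₁ δ₂)).trans (min_le_right _ _))
  rw [e]
  exact ⟨fun s hs => h0 s (s0 hs), fun s hs s' hs' => h1 s (s1 hs) s' (s1 hs'),
    fun s hs s' hs' => h2 s (s2 hs) s' (s2 hs')⟩

end IsStraightAt

theorem IsPleatedSurface.exists_not_sameGerm (hf : IsPleatedSurface f) {x : S}
    (hx : x ∉ pleatingLocus f) (γ : ℝ → S) : ∃ η, IsMappedGeodesicAt f x η ∧ ¬ SameGerm γ η := by
  by_contra! h
  exact hx ⟨hf.exists_segment x, fun γ₁ γ₂ h₁ h₂ => (h γ₁ h₁).symm.trans (h γ₂ h₂)⟩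

/-- At a point of the pleating locus, any straight path has the unique germ. -/
theorem sameGerm_of_isStraightAt {γ γ' : ℝ → S} {t t' : ℝ} (h : IsStraightAt f γ t)
    (h' : IsStraightAt f γ' t') (heq : γ t = γ' t') (hP : γ t ∈ pleatingLocus f) :
    SameGerm (fun s => γ (t + s)) fun s => γ' (t' + s) :=
  hP.2 _ _ h.isMappedGeodesicAt (heq ▸ h'.isMappedGeodesicAt)

variable [IsLocallyHyperbolic 2 S] [IsLocallyHyperbolic 3 N]

/-- The pleating locus is the complement of the open set where the map is locally isometric. -/
theorem IsPleatedSurface.mem_pleatingLocus_iff (hf : IsPleatedSurface f) {x : S} :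
    x ∈ pleatingLocus f ↔ ¬ IsLocallyIsometricAt f x := by
  refine ⟨fun h h' => not_mem_pleatingLocus_of_isLocallyIsometricAt h' h, fun h => ?_⟩
  by_contra hx
  obtain ⟨γ, hγ⟩ := hf.exists_segment x
  obtain ⟨η, hη, hne⟩ := hf.exists_not_sameGerm hx γ
  obtain ⟨C, hC⟩ := exists_pleatedChart hf.continuous x
  obtain ⟨h0, h1⟩ := isMappedGeodesicAt_iff.1 hγ
  obtain ⟨a, b, hab, e1, e2, e3⟩ := IsStraightAt.exists_Ioo C (by rwa [h0]) h1
  refine h ?_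
  rw [← h0]
  exact C.isLocallyIsometricAt_of_crossing hf e1 e2 e3 hab (by rwa [h0]) (by simpa using hne) hab

theorem IsPleatedSurface.isClosed_pleatingLocus (hf : IsPleatedSurface f) :
    IsClosed (pleatingLocus f) := by
  have : pleatingLocus f = {x | IsLocallyIsometricAt f x}ᶜ := by
    ext x; exact hf.mem_pleatingLocus_iff
  rw [this]
  exact isOpen_isLocallyIsometricAt.isClosed_compl

theorem IsStraightAt.eventually_mem_pleatingLocus (hf : IsPleatedSurface f) {γ : ℝ → S} {t : ℝ}
    (h : IsStraightAt f γ t) (ht : γ t ∈ pleatingLocus f) : ∀ᶠ s in 𝓝 t, γ s ∈ pleatingLocus f := by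
  obtain ⟨C, hC⟩ := exists_pleatedChart hf.continuous (γ t)
  obtain ⟨a, b, hab, e1, e2, e3⟩ := h.exists_Ioo C hC
  filter_upwards [isOpen_Ioo.mem_nhds hab] with s hs
  by_contra hsP
  obtain ⟨η, hη, hne⟩ := hf.exists_not_sameGerm hsP fun u => γ (s + u)
  exact hf.mem_pleatingLocus_iff.1 ht
    (C.isLocallyIsometricAt_of_crossing hf e1 e2 e3 hs hη hne hab)

/-- A straight path which meets the pleating locus is contained in it. -/
theorem IsPleatedSurface.mem_pleatingLocus_of_straight (hf : IsPleatedSurface f) {γ : ℝ → S}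
    {J : Set ℝ} (hJ : IsPreconnected J) (h : ∀ t ∈ J, IsStraightAt f γ t) {t₀ : ℝ} (ht₀ : t₀ ∈ J)
    (hγ : γ t₀ ∈ pleatingLocus f) : ∀ t ∈ J, γ t ∈ pleatingLocus f := by
  set A : Set ℝ := {t | ∀ᶠ s in 𝓝 t, γ s ∈ pleatingLocus f}
  have hA : IsOpen A := isOpen_setOfPred_eventually_nhds
  have hsub : J ⊆ A := by
    refine hJ.subset_of_closure_inter_subset hA
      ⟨t₀, ht₀, (h t₀ ht₀).eventually_mem_pleatingLocus hf hγ⟩ ?_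
    rintro t ⟨htA, htJ⟩
    have hfr : ∃ᶠ s in 𝓝 t, s ∈ A := mem_closure_iff_frequently.1 htA
    refine (h t htJ).eventually_mem_pleatingLocus hf ?_
    exact hf.isClosed_pleatingLocus.mem_of_frequently_of_tendsto
      (hfr.mono fun s (hs : ∀ᶠ u in 𝓝 s, _) => hs.self_of_nhds) (h t htJ).1.continuousAt
  exact fun t ht => (hsub ht).self_of_nhds

/-- A straight path in the pleating locus can be prolonged beyond its end. The limit point is in the
pleating locus, and the geodesic through it which is mapped to a geodesic has to be tangent to the
path: otherwise the end of the path would be in the interior of a triangle on which the map is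
isometric. -/
theorem IsPleatedSurface.exists_extension [CompleteSpace S] (hf : IsPleatedSurface f) {γ : ℝ → S}
    {a b : ℝ} (hab : a < b) (h : ∀ t ∈ Ioo a b, IsStraightAt f γ t)
    (hP : ∀ t ∈ Ioo a b, γ t ∈ pleatingLocus f) :
    ∃ b' > b, ∃ γ', EqOn γ γ' (Ioo a b) ∧ ∀ t ∈ Ioo a b', IsStraightAt f γ' t := by
  have hIoo : Ioo a b ∈ 𝓝[<] b := Ioo_mem_nhdsLT hab
  obtain ⟨y, hy⟩ : ∃ y, Tendsto γ (𝓝[<] b) (𝓝 y) := by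
    have hL : LipschitzOnWith 1 γ (Ioo a b) := fun s hs t ht => by
      rw [ENNReal.coe_one, one_mul]
      exact edist_le_of_isGeodesicAt (fun t ht => (h t ht).1) hs ht
    exact CompleteSpace.complete ((cauchy_nhds.mono nhdsWithin_le_nhds).map_of_le
      hL.uniformContinuousOn (le_principal_iff.2 hIoo))
  have hyP : y ∈ pleatingLocus f := hf.isClosed_pleatingLocus.mem_of_tendsto hy
    (mem_of_superset hIoo hP)
  obtain ⟨C, hC⟩ := exists_pleatedChart hf.continuous y
  obtain ⟨c, hcb, hc⟩ : ∃ c < b, ∀ s ∈ Ioo c b, γ s ∈ C.φ.source ∧ s ∈ Ioo a b := by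
    have := (hy.eventually (C.φ.open_source.mem_nhds hC)).and hIoo
    obtain ⟨c, hc, hc'⟩ := (mem_nhdsLT_iff_exists_Ioo_subset).1 this
    exact ⟨c, hc, hc'⟩
  have hcb' : Ioo c b ∈ 𝓝[<] b := Ioo_mem_nhdsLT hcb
  -- in the chart, `γ` is a geodesic line up to the parameter `b`
  have ht₀ : (c + b) / 2 ∈ Ioo c b := ⟨by linarith, by linarith⟩
  set t₀ := (c + b) / 2
  obtain ⟨Q, hQ, hγQ⟩ := eq_expLine_of_isGeodesicAt (γ := fun s => C.φ (γ s)) isPreconnected_Ioo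
    (fun t ht => (h t (hc t ht).2).1.chart C.isometric_φ (hc t ht).1) ht₀
  set G : ℝ → HypSpace 2 := fun s => expLine (C.φ (γ t₀)) Q (s - t₀) with hG
  have hGc : Continuous G := (continuous_expLine hQ).comp (continuous_sub_right t₀)
  have hGb : G b = C.φ y := by
    refine tendsto_nhds_unique ((hGc.tendsto b).mono_left (nhdsWithin_le_nhds (s := Iio b))) ?_
    refine Tendsto.congr' ?_ ((C.φ.continuousAt hC).tendsto.comp hy)
    filter_upwards [hcb'] with s hs using hγQ s hs
  have hGgeo : ∀ t, IsGeodesicAt G t := fun t => IsGeodesicAt.comp_isometry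
    (σ := fun s => s - t₀) (IsometryEquiv.subRight t₀).isometry (isGeodesicAt_expLine hQ (t - t₀))
  set γ' : ℝ → S := fun s => if s < b then γ s else C.φ.symm (G s) with hγ'
  have hlt : ∀ s < b, γ' s = γ s := fun s hs => if_pos hs
  have hγ'b : γ' b = y := by
    rw [hγ']; simp only [lt_irrefl, if_false]
    rw [hGb, C.φ.left_inv hC]
  have hγ'G : γ' =ᶠ[𝓝 b] fun s => C.φ.symm (G s) := by
    filter_upwards [Ioi_mem_nhds hcb] with s hs
    rcases lt_or_ge s b with hsb | hsb
    · rw [hlt s hsb, hG]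
      simp only
      rw [← hγQ s ⟨hs, hsb⟩, C.φ.left_inv (hc s ⟨hs, hsb⟩).1]
    · exact if_neg hsb.not_gt
  have hγ'geo : IsGeodesicAt γ' b := ((hGgeo b).chart_symm C.isometric_φ (by
    rw [hGb]; exact C.φ.map_source hC)).congr hγ'G.symm
  -- the image of `γ` is a geodesic up to the parameter `b`
  have hfγ : ∀ s ∈ Ioo c b, edist (f y) (f (γ s)) = ENNReal.ofReal (b - s) := by
    intro s hs
    obtain ⟨Q', hQ', hfγQ⟩ := eq_expLine_of_isGeodesicAt (γ := fun s => C.ψ (f (γ s)))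
      isPreconnected_Ioo (fun t ht => (h t (hc t ht).2).2.chart C.isometric_ψ
        (C.mapsTo (hc t ht).1)) ht₀
    have h1 : ∀ t ∈ Ioo c b, edist (f (γ t)) (f (γ s)) = edist t s := fun t ht => by
      rw [← C.isometric_ψ _ (C.mapsTo (hc t ht).1) _ (C.mapsTo (hc s hs).1), hfγQ t ht, hfγQ s hs,
        edist_expLine hQ', edist_sub_right]
    have h2 : Tendsto (fun t => edist (f (γ t)) (f (γ s))) (𝓝[<] b) (𝓝 (edist (f y) (f (γ s)))) :=
      ((hf.continuous.tendsto y).comp hy).edist tendsto_const_nhds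
    have h3 : Tendsto (fun t => edist t s) (𝓝[<] b) (𝓝 (edist b s)) :=
      (tendsto_id.mono_left nhdsWithin_le_nhds).edist tendsto_const_nhds
    rw [tendsto_nhds_unique h2
        (h3.congr' (by filter_upwards [hcb'] with t ht using (h1 t ht).symm)),
      edist_dist, Real.dist_eq, abs_of_nonneg (by linarith [hs.2])]
  obtain ⟨η, hη⟩ := hyP.1
  obtain ⟨hη0, hηs⟩ := isMappedGeodesicAt_iff.1 hη
  -- if `η` were transverse to `γ`, then the map would be isometric near points of `γ`
  have hgerm : SameGerm (fun s => γ' (b + s)) η := by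
    by_contra hne
    obtain ⟨Q₁, h₁, e₁⟩ := hηs.1.exists_expLine C.isometric_φ (by rwa [hη0])
    obtain ⟨Q₂, h₂, e₂⟩ := hγ'geo.exists_expLine C.isometric_φ (by rwa [hγ'b])
    simp only [hη0, sub_zero] at h₁ e₁
    rw [hγ'b] at h₂ e₂
    have hb : Tendsto (fun s => b + s) (𝓝 0) (𝓝 b) := by
      simpa using (continuous_const_add b).tendsto 0
    have e₂' : ∀ᶠ s in 𝓝 (0 : ℝ),
        γ' (b + s) ∈ C.φ.source ∧ C.φ (γ' (b + s)) = expLine (C.φ y) Q₂ s := by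
      filter_upwards [hb.eventually e₂] with s hs
      rwa [add_sub_cancel_left] at hs
    have he := linearIndependent_of_not_sameGerm h₂ h₁ e₂' e₁ hne
    have he' : LinearIndependent ℝ ![kleinDir (C.φ y) Q₁, kleinDir (C.φ y) (-Q₂)] := by
      rw [LinearIndependent.pair_iff] at he ⊢
      intro s t hst
      rw [kleinDir_neg, smul_neg, ← neg_smul, add_comm] at hst
      obtain ⟨h3, h4⟩ := he _ _ hst
      exact ⟨h4, neg_eq_zero.1 h3⟩
    obtain ⟨δ, hδ, e₂⟩ := Metric.eventually_nhds_iff_ball.1 e₂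
    have hm : 0 < min δ (b - c) := lt_min hδ (by linarith)
    set r := min δ (b - c) / 2
    have hr : 0 < r := by positivity
    have hrδ : r < δ := by have := min_le_left δ (b - c); simp only [r]; linarith
    have hrc : r < b - c := by have := min_le_right δ (b - c); simp only [r]; linarith
    have hmem : ∀ u, 0 < u → u ≤ r → b - u ∈ Ioo c b ∧ γ (b - u) ∈ C.φ.source ∧
        C.φ (γ (b - u)) = expLine (C.φ y) (-Q₂) u := fun u hu hur => by
      have hu' : b - u ∈ Metric.ball b δ := by
        rw [Metric.mem_ball, Real.dist_eq, sub_sub_cancel_left, abs_neg, abs_of_pos hu]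
        linarith
      have h3 := e₂ (b - u) hu'
      rw [hlt _ (by linarith), sub_sub_cancel_left] at h3
      exact ⟨⟨by linarith, by linarith⟩, h3.1, by rw [h3.2, expLine_neg]⟩
    obtain ⟨m1, m2, m3⟩ := hmem r hr le_rfl
    obtain ⟨n1, n2, n3⟩ := hmem (r / 2) (by linarith) (by linarith)
    refine hf.mem_pleatingLocus_iff.1 (hP _ (hc _ n1).2)
      (C.isLocallyIsometricAt_of_tripod hf hC hη h₁ h₂.neg e₁ he' m2 n2 m3 n3 ?_ (half_pos hr)
        (half_lt_self hr))
    rw [hfγ _ m1, sub_sub_cancel]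
  have hstr : IsStraightAt f γ' b := by
    have hb : Tendsto (fun s => s - b) (𝓝 b) (𝓝 0) := by
      simpa using (continuous_sub_right b).tendsto b
    rcases hgerm with hg | hg
    · have hσ : Isometry fun s : ℝ => s - b := (IsometryEquiv.subRight b).isometry
      refine IsStraightAt.congr (γ := fun s => η (s - b))
        (IsStraightAt.comp_isometry (γ := η) (σ := fun s => s - b) hσ (by rwa [sub_self])) ?_
      filter_upwards [hb.eventually hg] with s hs
      rw [← hs, add_sub_cancel]
    · have hσ : Isometry fun s : ℝ => -(s - b) :=
        (IsometryEquiv.neg ℝ).isometry.comp (IsometryEquiv.subRight b).isometry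
      refine IsStraightAt.congr (γ := fun s => η (-(s - b)))
        (IsStraightAt.comp_isometry (γ := η) (σ := fun s => -(s - b)) hσ
          (by rwa [sub_self, neg_zero])) ?_
      filter_upwards [hb.eventually hg] with s hs
      rw [← hs, add_sub_cancel]
  obtain ⟨δ, hδ, hev⟩ := Metric.eventually_nhds_iff_ball.1 hstr.eventually
  refine ⟨b + δ, by linarith, γ', fun s hs => (hlt s hs.2).symm, fun t ht => ?_⟩
  rcases lt_or_ge t b with htb | htb
  · refine (h t ⟨ht.1, htb⟩).congr ?_
    filter_upwards [Iio_mem_nhds htb] with s hs using (hlt s hs).symm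
  · refine hev t ?_
    rw [Real.ball_eq_Ioo]
    exact ⟨by linarith, ht.2⟩

theorem IsPleatedSurface.exists_extension_both [CompleteSpace S] (hf : IsPleatedSurface f)
    {γ : ℝ → S} {T : ℝ} (hT : 0 < T) (h : ∀ t ∈ Ioo (-T) T, IsStraightAt f γ t)
    (hP : γ 0 ∈ pleatingLocus f) :
    ∃ T' > T, ∃ γ', γ =ᶠ[𝓝 0] γ' ∧ ∀ t ∈ Ioo (-T') T', IsStraightAt f γ' t := by
  obtain ⟨b, hb, γ₁, e₁, h₁⟩ := hf.exists_extension (by linarith) h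
    (hf.mem_pleatingLocus_of_straight isPreconnected_Ioo h (t₀ := 0) ⟨by linarith, hT⟩ hP)
  have h₁' : ∀ t ∈ Ioo (-b) T, IsStraightAt f (fun s => γ₁ (-s)) t := fun t ht =>
    IsStraightAt.comp_isometry (σ := fun s => -s) (IsometryEquiv.neg ℝ).isometry
      (h₁ (-t) ⟨by linarith [ht.2], by linarith [ht.1]⟩)
  have e0 : γ 0 = γ₁ 0 := e₁ ⟨by linarith, hT⟩
  obtain ⟨b', hb', γ₂, e₂, h₂⟩ := hf.exists_extension (by linarith) h₁'
    (hf.mem_pleatingLocus_of_straight isPreconnected_Ioo h₁' (t₀ := 0) ⟨by linarith, hT⟩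
      (by rwa [neg_zero, ← e0]))
  refine ⟨min b b', lt_min hb hb', fun s => γ₂ (-s), ?_, fun t ht => ?_⟩
  · filter_upwards [Ioo_mem_nhds (neg_lt_zero.2 hT) hT] with s hs
    rw [e₁ hs, ← e₂ (x := -s) ⟨by linarith [hs.2], by linarith [hs.1]⟩]
    simp only [neg_neg]
  · refine IsStraightAt.comp_isometry (σ := fun s => -s) (IsometryEquiv.neg ℝ).isometry
      (h₂ (-t) ⟨?_, ?_⟩)
    · linarith [ht.2, min_le_left b b']
    · linarith [ht.1, min_le_right b b']

/-- Through each point of the pleating locus there is a complete geodesic which is mapped to a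
geodesic. -/
theorem IsPleatedSurface.exists_complete_straight [CompleteSpace S] (hf : IsPleatedSurface f)
    {x : S} (hx : x ∈ pleatingLocus f) : ∃ γ : ℝ → S, γ 0 = x ∧ ∀ t, IsStraightAt f γ t := by
  obtain ⟨η, hη⟩ := hf.exists_segment x
  obtain ⟨hη0, hηs⟩ := isMappedGeodesicAt_iff.1 hη
  -- the half-lengths of the straight paths which continue `η` to a symmetric interval
  set 𝒯 : Set ℝ := {T | 0 < T ∧ ∃ γ : ℝ → S, η =ᶠ[𝓝 0] γ ∧ ∀ t ∈ Ioo (-T) T, IsStraightAt f γ t}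
  have hne : 𝒯.Nonempty := by
    obtain ⟨δ, hδ, hev⟩ := Metric.eventually_nhds_iff_ball.1
      (IsStraightAt.eventually (f := f) (γ := η) (t := 0) hηs)
    refine ⟨δ, hδ, η, EventuallyEq.rfl, fun t ht => hev t ?_⟩
    rwa [Real.ball_eq_Ioo, zero_sub, zero_add]
  -- all these paths are restrictions of a single path, by unique continuation
  obtain ⟨γ, hγ0, hγ⟩ : ∃ γ : ℝ → S, η =ᶠ[𝓝 0] γ ∧
      ∀ T ∈ 𝒯, ∀ t ∈ Ioo (-T) T, IsStraightAt f γ t := by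
    have hch : ∀ T : ℝ, ∃ γ : ℝ → S, T ∈ 𝒯 →
        η =ᶠ[𝓝 0] γ ∧ ∀ t ∈ Ioo (-T) T, IsStraightAt f γ t := fun T => by
      by_cases hT : T ∈ 𝒯
      · obtain ⟨γ, hγ⟩ := hT.2
        exact ⟨γ, fun _ => hγ⟩
      · exact ⟨η, fun h => absurd h hT⟩
    choose Γ hΓ using hch
    have hτ : ∀ t : ℝ, ∃ T, (∃ T' ∈ 𝒯, |t| < T') → T ∈ 𝒯 ∧ |t| < T := fun t => by
      by_cases hT : ∃ T' ∈ 𝒯, |t| < T'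
      · obtain ⟨T, hT⟩ := hT
        exact ⟨T, fun _ => hT⟩
      · exact ⟨0, fun h => absurd h hT⟩
    choose τ hτ using hτ
    have hcoh : ∀ T ∈ 𝒯, EqOn (Γ T) (fun t => Γ (τ t) t) (Ioo (-T) T) := by
      intro T hT t ht
      have htT : |t| < T := abs_lt.2 ht
      obtain ⟨hτ1, hτ2⟩ := hτ t ⟨T, hT, htT⟩
      have hm : 0 < min T (τ t) := lt_min hT.1 hτ1.1
      refine (eventuallyEq_of_isGeodesicAt 2 (J := Ioo (-min T (τ t)) (min T (τ t)))
        isPreconnected_Ioo (fun s hs => ((hΓ T hT).2 s ?_).1)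
        (fun s hs => ((hΓ (τ t) hτ1).2 s ?_).1)
        (t₀ := 0) ⟨by linarith, hm⟩ ((hΓ T hT).1.symm.trans (hΓ (τ t) hτ1).1) t
        (abs_lt.1 (lt_min htT hτ2))).self_of_nhds
      · exact abs_lt.1 ((abs_lt.2 hs).trans_le (min_le_left _ _))
      · exact abs_lt.1 ((abs_lt.2 hs).trans_le (min_le_right _ _))
    have hcoh' : ∀ T ∈ 𝒯, ∀ t ∈ Ioo (-T) T, Γ T =ᶠ[𝓝 t] fun t => Γ (τ t) t := fun T hT t ht => by
      filter_upwards [isOpen_Ioo.mem_nhds ht] with s hs using hcoh T hT hs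
    refine ⟨fun t => Γ (τ t) t, ?_, fun T hT t ht => ((hΓ T hT).2 t ht).congr (hcoh' T hT t ht)⟩
    obtain ⟨T, hT⟩ := hne
    exact (hΓ T hT).1.trans (hcoh' T hT 0 ⟨by linarith [hT.1], hT.1⟩)
  have hγx : γ 0 = x := by rw [← hγ0.self_of_nhds, hη0]
  by_cases hbd : BddAbove 𝒯
  · obtain ⟨T₀, hT₀⟩ := hne
    have hpos : 0 < sSup 𝒯 := hT₀.1.trans_le (le_csSup hbd hT₀)
    obtain ⟨T', hT', γ', hγ', h'⟩ := hf.exists_extension_both hpos (γ := γ) (fun t ht => by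
      obtain ⟨T, hT, htT⟩ := exists_lt_of_lt_csSup ⟨T₀, hT₀⟩ (abs_lt.2 ht)
      exact hγ T hT t (abs_lt.1 htT)) (by rwa [hγx])
    exact absurd (le_csSup hbd ⟨hpos.trans hT', γ', hγ0.trans hγ', h'⟩) (not_le.2 hT')
  · refine ⟨γ, hγx, fun t => ?_⟩
    obtain ⟨T, hT, htT⟩ := not_bddAbove_iff.1 hbd |t|
    exact hγ T hT t (abs_lt.1 htT)

end Leaves

/-! ### Straightening a planar lamination by segments -/

section Planar

/-- The shear of the plane which moves the vertical line through `(u, 0)` to the line of slope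
`m u` (with respect to the vertical), in the strip `|y| ≤ 1 / 2`. The second coordinate is truncated
outside of the strip, so that the shear is injective on the plane if `m` is `1`-Lipschitz. -/
noncomputable def shear (m : ℝ → ℝ) (p : ℝ × ℝ) : ℝ × ℝ :=
  (p.1 + m p.1 * max (-1 / 2) (min p.2 (1 / 2)), p.2)

theorem abs_clamp_le (y : ℝ) : |max (-1 / 2) (min y (1 / 2))| ≤ 1 / 2 := by
  rw [abs_le]
  refine ⟨?_, max_le (by norm_num) (min_le_right _ _)⟩
  have := le_max_left (-1 / 2 : ℝ) (min y (1 / 2))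
  linarith

theorem shear_of_abs_lt {m : ℝ → ℝ} {p : ℝ × ℝ} (hp : |p.2| < 1 / 2) :
    shear m p = (p.1 + m p.1 * p.2, p.2) := by
  obtain ⟨h1, h2⟩ := abs_lt.1 hp
  rw [shear, min_eq_left h2.le, max_eq_right (by linarith)]

/-- The shear along a `1`-Lipschitz family of slopes is a homeomorphism of the plane. -/
theorem exists_shear_homeomorph {m : ℝ → ℝ} (hm : LipschitzWith 1 m) :
    ∃ Φ : (ℝ × ℝ) ≃ₜ (ℝ × ℝ), ∀ p, Φ p = shear m p := by
  set c : ℝ → ℝ := fun y => max (-1 / 2) (min y (1 / 2)) with hc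
  have hcc : Continuous c := by fun_prop
  have hcb : ∀ y, |c y| ≤ 1 / 2 := abs_clamp_le
  have hmc := hm.continuous
  have hmL : ∀ u v, |m u - m v| ≤ |u - v| := fun u v => by
    have := hm.dist_le_mul u v
    simpa [Real.dist_eq] using this
  have hcont : Continuous (shear m) := by
    unfold shear
    fun_prop
  -- the shear is expanding by a factor of at least `1 / 2` along horizontal lines
  have key : ∀ u v y : ℝ, |u - v| ≤ 2 * |(u + m u * c y) - (v + m v * c y)| := fun u v y => by
    have h1 : |(m u - m v) * c y| ≤ |u - v| * (1 / 2) := by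
      rw [abs_mul]
      exact mul_le_mul (hmL u v) (hcb y) (abs_nonneg _) (abs_nonneg _)
    have h2 : u - v = ((u + m u * c y) - (v + m v * c y)) - (m u - m v) * c y := by ring
    have h3 := abs_sub ((u + m u * c y) - (v + m v * c y)) ((m u - m v) * c y)
    rw [← h2] at h3
    linarith
  have hinj : Function.Injective (shear m) := by
    rintro ⟨u, y⟩ ⟨v, z⟩ h
    simp only [shear, Prod.mk.injEq] at h
    obtain ⟨h1, rfl⟩ := h
    have := key u v y
    simp only [hc] at this
    rw [h1, sub_self, abs_zero, mul_zero] at this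
    rw [sub_eq_zero.1 (abs_nonpos_iff.1 this)]
  have hsurj : Function.Surjective (shear m) := by
    rintro ⟨w, y⟩
    have hb : ∀ u, |m u * c y| ≤ (|m 0| + |u|) * (1 / 2) := fun u => by
      rw [abs_mul]
      refine mul_le_mul ?_ (hcb y) (abs_nonneg _) (by positivity)
      have h1 := hmL u 0
      have h2 := abs_sub_abs_le_abs_sub (m u) (m 0)
      rw [sub_zero] at h1
      linarith
    have htop : Tendsto (fun u => u + m u * c y) atTop atTop := by
      refine tendsto_atTop_mono' atTop (f₁ := fun u => u * (1 / 2) + (-|m 0| * (1 / 2))) ?_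
        (tendsto_atTop_add_const_right _ _
          (tendsto_id.atTop_mul_const (show (0 : ℝ) < 1 / 2 by norm_num)))
      filter_upwards [eventually_ge_atTop 0] with u hu
      have := neg_le_of_abs_le (hb u)
      rw [abs_of_nonneg hu] at this
      linarith
    have hbot : Tendsto (fun u => u + m u * c y) atBot atBot := by
      refine tendsto_atBot_mono' atBot (f₁ := fun u => u * (1 / 2) + (|m 0| * (1 / 2))) ?_
        (tendsto_atBot_add_const_right _ _
          (tendsto_id.atBot_mul_const (show (0 : ℝ) < 1 / 2 by norm_num)))
      filter_upwards [eventually_le_atBot 0] with u hu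
      have := le_of_abs_le (hb u)
      rw [abs_of_nonpos hu] at this
      linarith
    obtain ⟨u, hu⟩ := Continuous.surjective (by fun_prop) htop hbot w
    exact ⟨(u, y), Prod.ext hu rfl⟩
  let E := Equiv.ofBijective (shear m) ⟨hinj, hsurj⟩
  have hE : ∀ p, E p = shear m p := fun p => rfl
  have hsymm : ∀ q, shear m (E.symm q) = q := fun q => E.apply_symm_apply q
  have h2 : ∀ q, (E.symm q).2 = q.2 := fun q => by
    have := congrArg Prod.snd (hsymm q)
    exact this
  have h1 : ∀ q, (E.symm q).1 + m (E.symm q).1 * c q.2 = q.1 := fun q => by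
    have := congrArg Prod.fst (hsymm q)
    simp only [shear, h2] at this
    exact this
  refine ⟨⟨E, hcont, ?_⟩, hE⟩
  refine continuous_iff_continuousAt.2 fun q => ?_
  have hfst : Tendsto (fun q' => (E.symm q').1) (𝓝 q) (𝓝 (E.symm q).1) := by
    rw [tendsto_iff_dist_tendsto_zero]
    refine squeeze_zero (fun _ => dist_nonneg)
      (g := fun q' => 2 * |q'.1 - ((E.symm q).1 + m (E.symm q).1 * c q'.2)|) (fun q' => ?_) ?_
    · rw [Real.dist_eq]
      have := key (E.symm q').1 (E.symm q).1 q'.2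
      rwa [h1] at this
    · have hcont' : Continuous fun q' : ℝ × ℝ =>
          2 * |q'.1 - ((E.symm q).1 + m (E.symm q).1 * c q'.2)| := by fun_prop
      have := hcont'.tendsto q
      rwa [h1, sub_self, abs_zero, mul_zero] at this
  have := hfst.prodMk_nhds (continuous_snd.tendsto q)
  have hpair : ∀ q', ((E.symm q').1, q'.2) = E.symm q' := fun q' => Prod.ext rfl (h2 q').symm
  simp only [hpair] at this
  exact this

variable {K : Set (ℝ × ℝ)} {dir : ℝ × ℝ → ℝ × ℝ}

theorem mem_unit_ball {p : ℝ × ℝ} : p ∈ Metric.ball (0 : ℝ × ℝ) 1 ↔ |p.1| < 1 ∧ |p.2| < 1 := by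
  rw [mem_ball_zero_iff, Prod.norm_def, max_lt_iff, Real.norm_eq_abs, Real.norm_eq_abs]

/-- A lamination of the open unit square by straight segments, one of which is vertical and passes
through the origin, is straightened by a homeomorphism near the origin. Disjointness of the
segments means that their slopes are a Lipschitz function of their base points on the axis `y = 0`;
extending this function to the real line gives the homeomorphism. -/
theorem exists_straightening (h0 : (0 : ℝ × ℝ) ∈ K) (hdir0 : (dir 0).1 = 0)
    (hne : ∀ p ∈ K, p ∈ Metric.ball (0 : ℝ × ℝ) 1 → dir p ≠ 0)
    (hline : ∀ p ∈ K, p ∈ Metric.ball (0 : ℝ × ℝ) 1 → ∀ t : ℝ,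
      p + t • dir p ∈ Metric.ball (0 : ℝ × ℝ) 1 →
        p + t • dir p ∈ K ∧ ∃ k : ℝ, dir (p + t • dir p) = k • dir p) :
    ∃ (Φ : (ℝ × ℝ) ≃ₜ (ℝ × ℝ)) (B : Set ℝ), Φ 0 = 0 ∧
      ∀ p : ℝ × ℝ, |p.1| < 1 / 8 → |p.2| < 1 / 2 → Φ p ∈ Metric.ball (0 : ℝ × ℝ) 1 ∧
        (Φ p ∈ K ↔ p.1 ∈ B) ∧ (p.1 ∈ B → ∀ q : ℝ × ℝ, |q.2| < 1 / 2 →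
          (q.1 = p.1 ↔ ∃ t : ℝ, Φ q = Φ p + t • dir (Φ p))) := by
  have h0Q : (0 : ℝ × ℝ) ∈ Metric.ball (0 : ℝ × ℝ) 1 := Metric.mem_ball_self one_pos
  have hdir0' : (dir 0).2 ≠ 0 := fun h => hne 0 h0 h0Q (Prod.ext hdir0 h)
  -- a segment which meets the vertical axis is contained in it
  have haxis : ∀ p ∈ K, p ∈ Metric.ball (0 : ℝ × ℝ) 1 → ∀ t : ℝ, (p + t • dir p).1 = 0 →
      |(p + t • dir p).2| < 1 → (dir p).1 = 0 := by
    intro p hp hpQ t ht1 ht2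
    have hQ : p + t • dir p ∈ Metric.ball (0 : ℝ × ℝ) 1 :=
      mem_unit_ball.2 ⟨by rw [ht1, abs_zero]; exact one_pos, ht2⟩
    obtain ⟨hK, k, hk⟩ := hline p hp hpQ t hQ
    have he : p + t • dir p = 0 + ((p + t • dir p).2 / (dir 0).2) • dir 0 := by
      ext
      · simp only [ht1, Prod.fst_add, Prod.smul_fst, hdir0, Prod.fst_zero]; simp
      · simp only [Prod.snd_add, Prod.smul_snd, Prod.snd_zero, smul_eq_mul]
        rw [div_mul_cancel₀ _ hdir0', zero_add]
    obtain ⟨-, k', hk'⟩ := hline 0 h0 h0Q _ (he ▸ hQ)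
    rw [← he] at hk'
    have h1 := hne _ hK hQ
    have hk0 : k ≠ 0 := by
      rintro rfl
      rw [zero_smul] at hk
      exact h1 hk
    have h2 : k * (dir p).1 = k' * (dir 0).1 := congrArg Prod.fst (hk.symm.trans hk')
    rw [hdir0, mul_zero] at h2
    exact (mul_eq_zero.1 h2).resolve_left hk0
  -- the base points of the segments on the axis `y = 0`, and the slopes of the segments
  set B : Set ℝ := {b | |b| < 1 / 2 ∧ (b, (0 : ℝ)) ∈ K}
  set m : ℝ → ℝ := fun b => (dir (b, 0)).1 / (dir (b, 0)).2
  have hBQ : ∀ b ∈ B, (b, (0 : ℝ)) ∈ Metric.ball (0 : ℝ × ℝ) 1 := fun b hb =>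
    mem_unit_ball.2 ⟨by have := hb.1; simp only; linarith, by simp⟩
  have hd2 : ∀ b ∈ B, (dir (b, 0)).2 ≠ 0 := by
    intro b hb h
    have hd := hne _ hb.2 (hBQ b hb)
    have hd1 : (dir (b, 0)).1 ≠ 0 := fun h' => hd (Prod.ext h' h)
    refine hd1 (haxis _ hb.2 (hBQ b hb) (-b / (dir (b, 0)).1) ?_ ?_)
    · simp only [Prod.fst_add, Prod.smul_fst, smul_eq_mul]
      rw [div_mul_cancel₀ _ hd1]; ring
    · simp [h]
  have hpt : ∀ b ∈ B, ∀ y : ℝ, (b, (0 : ℝ)) + (y / (dir (b, 0)).2) • dir (b, 0) =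
      (b + m b * y, y) := fun b hb y => by
    have := hd2 b hb
    ext
    · simp only [Prod.fst_add, Prod.smul_fst, smul_eq_mul, m]; field_simp
    · simp only [Prod.snd_add, Prod.smul_snd, smul_eq_mul]; field_simp; ring
  have hseg : ∀ b ∈ B, ∀ y : ℝ, (b + m b * y, y) ∈ Metric.ball (0 : ℝ × ℝ) 1 →
      (b + m b * y, y) ∈ K ∧ ∃ k : ℝ, k ≠ 0 ∧ dir (b + m b * y, y) = (k * m b, k) := by
    intro b hb y hy
    have h1 := hline _ hb.2 (hBQ b hb) (y / (dir (b, 0)).2) (by rwa [hpt b hb])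
    rw [hpt b hb] at h1
    obtain ⟨h2, k, hk⟩ := h1
    have h3 : dir (b + m b * y, y) = (k * (dir (b, 0)).2 * m b, k * (dir (b, 0)).2) := by
      rw [hk]
      have := hd2 b hb
      ext
      · simp only [Prod.smul_fst, smul_eq_mul, m]; field_simp
      · rfl
    refine ⟨h2, _, ?_, h3⟩
    intro h4
    rw [h4, zero_mul] at h3
    exact hne _ h2 hy h3
  -- otherwise the segment would cross the vertical axis
  have hmb : ∀ b ∈ B, |m b| ≤ |b| := by
    intro b hb
    by_contra! hlt
    have hm0 : m b ≠ 0 := abs_pos.1 ((abs_nonneg b).trans_lt hlt)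
    have h1 : (dir (b, 0)).1 = 0 := by
      refine haxis _ hb.2 (hBQ b hb) ((-b / m b) / (dir (b, 0)).2) ?_ ?_
      · rw [hpt b hb]; simp only; field_simp; ring
      · rw [hpt b hb]; simp only
        rw [abs_div, abs_neg, div_lt_one (abs_pos.2 hm0)]
        exact hlt
    exact hm0 (by simp only [m]; rw [h1, zero_div])
  -- otherwise two of the segments would cross in the square
  have hmL : LipschitzOnWith 1 m B := by
    refine LipschitzOnWith.of_dist_le_mul fun b hb b' hb' => ?_
    rw [NNReal.coe_one, one_mul, Real.dist_eq, Real.dist_eq]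
    by_contra! hlt
    have hmm : m b - m b' ≠ 0 := abs_pos.1 ((abs_nonneg _).trans_lt hlt)
    set y := -(b - b') / (m b - m b') with hy
    have hy1 : |y| < 1 := by
      rw [hy, abs_div, abs_neg, div_lt_one (abs_pos.2 hmm)]
      exact hlt
    have he : b + m b * y = b' + m b' * y := by
      have : (m b - m b') * y = -(b - b') := by rw [hy, mul_div_cancel₀ _ hmm]
      linarith
    have hQ : (b + m b * y, y) ∈ Metric.ball (0 : ℝ × ℝ) 1 := by
      refine mem_unit_ball.2 ⟨?_, hy1⟩
      have h1 : |m b * y| ≤ |b| * 1 := by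
        rw [abs_mul]
        exact mul_le_mul (hmb b hb) hy1.le (abs_nonneg _) (abs_nonneg _)
      have h2 := abs_add_le b (m b * y)
      have h3 := hb.1
      simp only
      linarith
    obtain ⟨-, k, hk0, hk⟩ := hseg b hb y hQ
    obtain ⟨-, k', -, hk'⟩ := hseg b' hb' y (he ▸ hQ)
    rw [← he, hk, Prod.mk.injEq] at hk'
    obtain ⟨h1, rfl⟩ := hk'
    exact hmm (sub_eq_zero.2 (mul_left_cancel₀ hk0 h1))
  obtain ⟨M, hM, hMeq⟩ := hmL.extend_real
  have h0B : (0 : ℝ) ∈ B := ⟨by norm_num, h0⟩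
  have hM0 : M 0 = 0 := by
    rw [← hMeq h0B]
    have := hmb 0 h0B
    rwa [abs_zero, abs_nonpos_iff] at this
  have hMb : ∀ u, |M u| ≤ |u| := fun u => by
    have := hM.dist_le_mul u 0
    simpa [Real.dist_eq, hM0] using this
  obtain ⟨Φ, hΦ⟩ := exists_shear_homeomorph hM
  have hΦ' : ∀ p : ℝ × ℝ, |p.2| < 1 / 2 → Φ p = (p.1 + M p.1 * p.2, p.2) := fun p hp => by
    rw [hΦ, shear_of_abs_lt hp]
  refine ⟨Φ, B, ?_, ?_⟩
  · rw [hΦ' 0 (by simp)]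
    simp
  rintro ⟨u, y⟩ hu hy
  simp only at hu hy
  -- since `|u| < 1 / 8`, this bounds the slope of the segment through `Φ (u, y)` by `3 / 8`, and
  -- the segment meets the axis `y = 0` at distance less than `3 / 16 + 3 / 16 < 1 / 2` from `0`
  have hx : |u + M u * y| < 3 / 16 := by
    have h1 : |M u * y| ≤ |u| * (1 / 2) := by
      rw [abs_mul]
      exact mul_le_mul (hMb u) hy.le (abs_nonneg _) (abs_nonneg _)
    have h2 := abs_add_le u (M u * y)
    linarith
  have hQ : Φ (u, y) ∈ Metric.ball (0 : ℝ × ℝ) 1 := by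
    rw [hΦ' _ hy]
    exact mem_unit_ball.2 ⟨by simp only; linarith, by simp only; linarith⟩
  have hback : u ∈ B → Φ (u, y) ∈ K := fun huB => by
    rw [hΦ' _ hy] at hQ ⊢
    simp only [← hMeq huB] at hQ ⊢
    exact (hseg u huB y hQ).1
  refine ⟨hQ, ⟨fun hK => ?_, hback⟩, fun huB q hq => ?_⟩
  · -- the segment through `Φ (u, y)` meets the axis `y = 0` in the square
    rw [hΦ' _ hy] at hQ hK
    simp only at hQ hK
    set x := u + M u * y with hxdef
    have hinj : ∀ b ∈ B, b + m b * y = x → u ∈ B := fun b hb he => by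
      have : Φ (b, y) = Φ (u, y) := by
        rw [hΦ' _ hy, hΦ' _ hy]
        simp only [← hMeq hb, he, hxdef]
      have hbu : b = u := congrArg Prod.fst (Φ.injective this)
      rwa [← hbu]
    rcases eq_or_ne x 0 with hx0 | hx0
    · refine hinj 0 h0B ?_
      rw [hMeq h0B, hM0, hx0]; ring
    have hd := hne _ hK hQ
    set d := dir (x, y) with hddef
    have hd2 : d.2 ≠ 0 := by
      intro h
      have hd1 : d.1 ≠ 0 := fun h' => hd (Prod.ext h' h)
      refine hd1 (haxis _ hK hQ (-x / d.1) ?_ ?_)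
      · simp only [Prod.fst_add, Prod.smul_fst, smul_eq_mul, ← hddef]
        rw [div_mul_cancel₀ _ hd1]; ring
      · simp only [Prod.snd_add, Prod.smul_snd, smul_eq_mul, ← hddef, h]
        rw [mul_zero, add_zero]; linarith
    set μ := d.1 / d.2 with hμ
    have hd1 : d.1 = μ * d.2 := by rw [hμ, div_mul_cancel₀ _ hd2]
    have hμb : |μ| ≤ 2 * |x| := by
      by_contra! hlt
      have hμ0 : μ ≠ 0 := abs_pos.1 (lt_of_le_of_lt (by positivity) hlt)
      have h1 : d.1 = 0 := by
        refine haxis _ hK hQ (-(x / μ) / d.2) ?_ ?_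
        · simp only [Prod.fst_add, Prod.smul_fst, smul_eq_mul, ← hddef, hd1]
          field_simp
          ring
        · simp only [Prod.snd_add, Prod.smul_snd, smul_eq_mul, ← hddef]
          rw [div_mul_cancel₀ _ hd2]
          have h2 : |x / μ| < 1 / 2 := by
            rw [abs_div, div_lt_iff₀ (abs_pos.2 hμ0)]; linarith
          have h3 := abs_add_le y (-(x / μ))
          rw [abs_neg] at h3
          linarith
      exact hμ0 (by rw [hμ, h1, zero_div])
    have hb : |x - μ * y| < 1 / 2 := by
      have h1 : |μ * y| ≤ 2 * |x| * (1 / 2) := by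
        rw [abs_mul]
        exact mul_le_mul hμb hy.le (abs_nonneg _) (by positivity)
      have h2 := abs_sub x (μ * y)
      linarith
    have he : (x, y) + (-y / d.2) • d = (x - μ * y, 0) := by
      ext
      · simp only [Prod.fst_add, Prod.smul_fst, smul_eq_mul, hd1]; field_simp; ring
      · simp only [Prod.snd_add, Prod.smul_snd, smul_eq_mul]; field_simp; ring
    obtain ⟨h1, k, hk⟩ := hline _ hK hQ (-y / d.2)
      (by rw [← hddef, he]; exact mem_unit_ball.2 ⟨by simp only; linarith, by simp⟩)
    rw [← hddef, he] at h1 hk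
    have hbB : x - μ * y ∈ B := ⟨hb, h1⟩
    refine hinj _ hbB ?_
    have hk0 : k ≠ 0 := by
      rintro rfl
      rw [zero_smul] at hk
      exact hne _ h1 (hBQ _ hbB) hk
    have hmμ : m (x - μ * y) = μ := by
      simp only [m, hk, Prod.smul_fst, Prod.smul_snd, smul_eq_mul, hd1]
      field_simp
    rw [hmμ]; ring
  · have hQ' := hQ
    rw [hΦ' _ hy] at hQ'
    simp only [← hMeq huB] at hQ'
    obtain ⟨-, k, hk0, hk⟩ := hseg u huB y hQ'
    have hΦu : ∀ z, |z| < 1 / 2 → Φ (u, z) = (u + m u * z, z) := fun z hz => by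
      rw [hΦ' _ hz]
      simp only [← hMeq huB]
    have hpl : ∀ z, |z| < 1 / 2 → ∀ t : ℝ, t = (z - y) / k →
        Φ (u, z) = Φ (u, y) + t • dir (Φ (u, y)) := fun z hz t ht => by
      rw [hΦu z hz, hΦu y hy, hk, ht]
      ext
      · simp only [Prod.fst_add, Prod.smul_fst, smul_eq_mul]; field_simp; ring
      · simp only [Prod.snd_add, Prod.smul_snd, smul_eq_mul]; field_simp; ring
    obtain ⟨v, z⟩ := q
    constructor
    · rintro rfl
      exact ⟨_, hpl z hq _ rfl⟩
    · rintro ⟨t, ht⟩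
      have h2 : z = y + t * k := by
        have := congrArg Prod.snd ht
        rw [hΦ' _ hq, hΦu y hy, hk] at this
        simpa using this
      have h3 := hpl z hq t (by rw [h2]; field_simp; ring)
      rw [← ht] at h3
      exact (congrArg Prod.fst (Φ.injective h3)).symm

end Planar

/-! ### Foliation charts of the pleating locus -/

section FoliationCharts

open HypSpace

variable {S N : Type*} [EMetricSpace S] [EMetricSpace N] {f : S → N}

/-- The tangent vector, unique up to sign, of the straight paths through a point of the pleating
locus. -/
theorem exists_leafTangent (C : PleatedChart f) {y : S} (hy : y ∈ pleatingLocus f)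
    (hyC : y ∈ C.φ.source) : ∃ Q, IsUnitTangent (C.φ y) Q ∧ ∀ (γ : ℝ → S) (t₀ : ℝ),
      IsStraightAt f γ t₀ → γ t₀ = y → ∃ Q', (Q' = Q ∨ Q' = -Q) ∧
        ∀ᶠ s in 𝓝 t₀, γ s ∈ C.φ.source ∧ C.φ (γ s) = expLine (C.φ y) Q' (s - t₀) := by
  obtain ⟨η, hη⟩ := hy.1
  obtain ⟨hη0, hηs⟩ := isMappedGeodesicAt_iff.1 hη
  obtain ⟨Q, hQ, e⟩ := hηs.1.exists_expLine C.isometric_φ (by rwa [hη0])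
  simp only [hη0, sub_zero] at hQ e
  refine ⟨Q, hQ, fun γ t₀ hγ hγy => ?_⟩
  have ht : Tendsto (fun s => s - t₀) (𝓝 t₀) (𝓝 0) := by
    simpa using (continuous_sub_right t₀).tendsto t₀
  have ht' : Tendsto (fun s => -(s - t₀)) (𝓝 t₀) (𝓝 0) := by simpa using ht.neg
  rcases hy.2 _ _ (hγy ▸ hγ.isMappedGeodesicAt) hη with h | h
  · refine ⟨Q, Or.inl rfl, ?_⟩
    filter_upwards [ht.eventually h, ht.eventually e] with s h1 h2
    rw [add_sub_cancel] at h1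
    rwa [h1]
  · refine ⟨-Q, Or.inr rfl, ?_⟩
    filter_upwards [ht.eventually h, ht'.eventually e] with s h1 h2
    rw [add_sub_cancel] at h1
    rwa [h1, expLine_neg]

variable [IsLocallyHyperbolic 2 S]

/-- In a chart with a Klein convex image, a geodesic coincides with the geodesic line given by its
tangent vector, for all parameters at which the latter is in the image of the chart. -/
theorem eventuallyEq_symm_expLine (C : PleatedChart f) {γ : ℝ → S} (hγ : ∀ t, IsGeodesicAt γ t)
    {t₀ : ℝ} (hC : γ t₀ ∈ C.φ.source) {Q : Mink 2} (hQ : IsUnitTangent (C.φ (γ t₀)) Q)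
    (he : ∀ᶠ s in 𝓝 t₀, γ s ∈ C.φ.source ∧ C.φ (γ s) = expLine (C.φ (γ t₀)) Q (s - t₀)) {t : ℝ}
    (ht : expLine (C.φ (γ t₀)) Q (t - t₀) ∈ C.φ.target) :
    γ =ᶠ[𝓝 t] fun s => C.φ.symm (expLine (C.φ (γ t₀)) Q (s - t₀)) := by
  have hiso : Isometry fun s : ℝ => s - t₀ := (IsometryEquiv.subRight t₀).isometry
  have h0 : klein (expLine (C.φ (γ t₀)) Q 0) ∈ C.Ω := by
    rw [expLine_zero hQ, ← C.mem_target]; exact C.φ.map_source hC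
  have h1 : klein (expLine (C.φ (γ t₀)) Q (t - t₀)) ∈ C.Ω := C.mem_target.1 ht
  refine eventuallyEq_of_isGeodesicAt 2 (J := uIcc t₀ t) isPreconnected_uIcc (fun s _ => hγ s)
    (fun s hs => ?_) left_mem_uIcc ?_ t right_mem_uIcc
  · refine ((isGeodesicAt_expLine hQ (s - t₀)).comp_isometry
      (σ := fun s => s - t₀) hiso).chart_symm C.isometric_φ ?_
    rw [C.mem_target]
    rcases mem_uIcc.1 hs with hs | hs
    · exact klein_expLine_mem C.convex hQ (by linarith) (by linarith) h0 h1
    · exact klein_expLine_mem C.convex hQ (by linarith) (by linarith) h1 h0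
  · filter_upwards [he] with s hs
    rw [← hs.2, C.φ.left_inv hs.1]

variable [IsLocallyHyperbolic 3 N]

/-- In the Klein model, the leaves of the pleating locus are straight segments: there is a direction
field `D` such that a leaf through `y` stays, near `y`, on the line through `y` in the direction
`D y`, and conversely contains all points of the chart on this line, where it has the same
direction up to a factor. -/
theorem exists_leafDir (hf : IsPleatedSurface f) (C : PleatedChart f) :
    ∃ D : S → EuclideanSpace ℝ (Fin 2), ∀ y ∈ pleatingLocus f, y ∈ C.φ.source → D y ≠ 0 ∧
      (∀ (γ : ℝ → S) (t₀ : ℝ), IsStraightAt f γ t₀ → γ t₀ = y →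
        ∀ᶠ t in 𝓝 t₀, γ t ∈ C.φ.source ∧
          ∃ s : ℝ, klein (C.φ (γ t)) = klein (C.φ y) + s • D y) ∧
      ∀ γ : ℝ → S, (∀ t, IsStraightAt f γ t) → ∀ t₀, γ t₀ = y → ∀ z ∈ C.φ.source, ∀ s : ℝ,
        klein (C.φ z) = klein (C.φ y) + s • D y → z ∈ range γ ∧ ∃ k : ℝ, D z = k • D y := by
  have hch : ∀ y, ∃ Q, y ∈ pleatingLocus f → y ∈ C.φ.source → IsUnitTangent (C.φ y) Q ∧
      ∀ (γ : ℝ → S) (t₀ : ℝ), IsStraightAt f γ t₀ → γ t₀ = y → ∃ Q', (Q' = Q ∨ Q' = -Q) ∧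
        ∀ᶠ s in 𝓝 t₀, γ s ∈ C.φ.source ∧ C.φ (γ s) = expLine (C.φ y) Q' (s - t₀) := fun y => by
    by_cases h : y ∈ pleatingLocus f ∧ y ∈ C.φ.source
    · obtain ⟨Q, hQ⟩ := exists_leafTangent C h.1 h.2
      exact ⟨Q, fun _ _ => hQ⟩
    · exact ⟨0, fun h1 h2 => absurd ⟨h1, h2⟩ h⟩
  choose Q hQ using hch
  have hsign : ∀ y Q', (Q' = Q y ∨ Q' = -Q y) →
      ∃ c : ℝ, c ≠ 0 ∧ kleinDir (C.φ y) Q' = c • kleinDir (C.φ y) (Q y) := by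
    rintro y Q' (rfl | rfl)
    · exact ⟨1, one_ne_zero, (one_smul _ _).symm⟩
    · exact ⟨-1, by norm_num, by rw [kleinDir_neg, neg_one_smul]⟩
  have htan : ∀ y ∈ pleatingLocus f, y ∈ C.φ.source → ∀ Q', (Q' = Q y ∨ Q' = -Q y) →
      IsUnitTangent (C.φ y) Q' := by
    rintro y hy hyC Q' (rfl | rfl)
    · exact (hQ y hy hyC).1
    · exact (hQ y hy hyC).1.neg
  have hlocal : ∀ y ∈ pleatingLocus f, y ∈ C.φ.source → ∀ (γ : ℝ → S) (t₀ : ℝ),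
      IsStraightAt f γ t₀ → γ t₀ = y → ∀ᶠ t in 𝓝 t₀, γ t ∈ C.φ.source ∧
        ∃ s : ℝ, klein (C.φ (γ t)) = klein (C.φ y) + s • kleinDir (C.φ y) (Q y) := by
    intro y hy hyC γ t₀ hγ hγy
    obtain ⟨Q', hQ', he⟩ := (hQ y hy hyC).2 γ t₀ hγ hγy
    obtain ⟨c, -, hc⟩ := hsign y Q' hQ'
    filter_upwards [he] with t ht
    refine ⟨ht.1, Real.sinh (t - t₀) / (expLine (C.φ y) Q' (t - t₀)).time * c, ?_⟩
    rw [ht.2, klein_expLine (htan y hy hyC Q' hQ'), hc, smul_smul]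
  refine ⟨fun y => kleinDir (C.φ y) (Q y), fun y hy hyC =>
    ⟨kleinDir_ne_zero (hQ y hy hyC).1, hlocal y hy hyC, ?_⟩⟩
  intro γ hγ t₀ hγy z hz s hs
  obtain ⟨Q', hQ', he⟩ := (hQ y hy hyC).2 γ t₀ (hγ t₀) hγy
  obtain ⟨c, hc0, hc⟩ := hsign y Q' hQ'
  have hQ't := htan y hy hyC Q' hQ'
  obtain ⟨u, hu⟩ : ∃ u, C.φ z = expLine (C.φ y) Q' u := by
    refine exists_eq_expLine_of_klein_eq hQ't (s := s / c) ?_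
    rw [hs, hc, smul_smul, div_mul_cancel₀ _ hc0]
  have hcont := eventuallyEq_symm_expLine C (fun t => (hγ t).1) (t₀ := t₀) (Q := Q') (t := t₀ + u)
    (by rwa [hγy]) (by rwa [hγy]) (by rwa [hγy])
    (by rw [hγy, add_sub_cancel_left, ← hu]; exact C.φ.map_source hz)
  rw [hγy] at hcont
  have hzγ : γ (t₀ + u) = z := by
    refine hcont.self_of_nhds.trans ?_
    change C.φ.symm (expLine (C.φ y) Q' (t₀ + u - t₀)) = z
    rw [add_sub_cancel_left, ← hu, C.φ.left_inv hz]
  have hzP : z ∈ pleatingLocus f := by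
    rw [← hzγ]
    exact hf.mem_pleatingLocus_of_straight isPreconnected_univ (fun t _ => hγ t) (mem_univ t₀)
      (by rwa [hγy]) _ (mem_univ _)
  refine ⟨⟨_, hzγ⟩, ?_⟩
  -- compare the two descriptions of the leaf at a parameter close to that of `z`
  have hev := (hlocal z hzP hz γ (t₀ + u) (hγ _) hzγ).and hcont
  have htar : ∀ᶠ v in 𝓝 (t₀ + u), expLine (C.φ y) Q' (v - t₀) ∈ C.φ.target := by
    have hc : Continuous fun v => expLine (C.φ y) Q' (v - t₀) :=
      (continuous_expLine hQ't).comp (continuous_sub_right t₀)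
    refine hc.continuousAt.eventually (C.φ.open_target.mem_nhds ?_)
    change expLine (C.φ y) Q' (t₀ + u - t₀) ∈ C.φ.target
    rw [add_sub_cancel_left, ← hu]
    exact C.φ.map_source hz
  obtain ⟨v, hvne, ⟨⟨-, s', h1⟩, h2⟩, h3⟩ :=
    (dense_compl_singleton (t₀ + u)).inter_nhds_nonempty (hev.and htar)
  rw [h2, C.φ.right_inv h3, hu, klein_expLine hQ't, klein_expLine hQ't, add_assoc] at h1
  set τ := fun t => Real.sinh t / (expLine (C.φ y) Q' t).time
  have h4 : (τ (v - t₀) - τ u) • kleinDir (C.φ y) Q' = s' • kleinDir (C.φ z) (Q z) := by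
    rw [sub_smul, sub_eq_iff_eq_add', add_left_cancel h1]
    rw [hu]
  have h5 : τ (v - t₀) - τ u ≠ 0 := by
    rw [sub_ne_zero]
    intro h
    have h6 : v - t₀ = u := (strictMono_sinh_div_time hQ't).injective h
    exact hvne (by rw [mem_singleton_iff]; linarith)
  have h7 : s' ≠ 0 := by
    rintro rfl
    rw [zero_smul] at h4
    exact (smul_ne_zero h5 (kleinDir_ne_zero hQ't)) h4
  refine ⟨s'⁻¹ * ((τ (v - t₀) - τ u) * c), ?_⟩
  rw [← smul_smul, ← smul_smul, ← hc, h4, inv_smul_smul₀ h7]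

/-- Affine coordinates of the Klein model in which the leaf through `x` is vertical, and in which
all other leaves are straight segments. -/
theorem exists_boxChart (hf : IsPleatedSurface f) {x : S} (hx : x ∈ pleatingLocus f) :
    ∃ (θ : OpenPartialHomeomorph S (ℝ × ℝ)) (dir : ℝ × ℝ → ℝ × ℝ), x ∈ θ.source ∧ θ x = 0 ∧
      Metric.ball 0 1 ⊆ θ.target ∧ (dir 0).1 = 0 ∧
      ∀ y ∈ θ.source, y ∈ pleatingLocus f → dir (θ y) ≠ 0 ∧
      (∀ (γ : ℝ → S) (t₀ : ℝ), IsStraightAt f γ t₀ → γ t₀ = y →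
        ∀ᶠ t in 𝓝 t₀, ∃ s : ℝ, θ (γ t) = θ y + s • dir (θ y)) ∧
      ∀ γ : ℝ → S, (∀ t, IsStraightAt f γ t) → ∀ t₀, γ t₀ = y → ∀ z ∈ θ.source, ∀ s : ℝ,
        θ z = θ y + s • dir (θ y) → z ∈ range γ ∧ ∃ k : ℝ, dir (θ z) = k • dir (θ y) := by
  obtain ⟨C, hC⟩ := exists_pleatedChart hf.continuous x
  obtain ⟨D, hD⟩ := exists_leafDir hf C
  obtain ⟨e₁, he⟩ := exists_linearIndependent_pair_of_one_lt_finrank (R := ℝ)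
    (M := EuclideanSpace ℝ (Fin 2)) (by simp) (hD x hx hC).1
  obtain ⟨L, hL⟩ := exists_coordinates (LinearIndependent.pair_symm_iff.1 he)
  set v₀ := klein (C.φ x)
  let θ₀ : OpenPartialHomeomorph S (ℝ × ℝ) := (C.φ.trans (kleinChart 2)).transHomeomorph
    ((Homeomorph.subRight v₀).trans L.toHomeomorph)
  have hsrc₀ : θ₀.source = C.φ.source := by simp [θ₀, kleinChart]
  have hθ₀ : ∀ y, θ₀ y = L (klein (C.φ y) - v₀) := fun y => rfl
  have hx₀ : θ₀ x = 0 := by rw [hθ₀, sub_self, map_zero]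
  obtain ⟨ε, hε, hball⟩ := Metric.isOpen_iff.1 θ₀.open_target 0
    (by rw [← hx₀]; exact θ₀.map_source (by rwa [hsrc₀]))
  let θ := θ₀.transHomeomorph (Homeomorph.smulOfNeZero ε⁻¹ (inv_ne_zero hε.ne'))
  have hsrc : θ.source = C.φ.source := hsrc₀
  have hθ : ∀ y, θ y = ε⁻¹ • L (klein (C.φ y) - v₀) := fun y => rfl
  have hinj : ∀ v w : EuclideanSpace ℝ (Fin 2), ε⁻¹ • L v = ε⁻¹ • L w ↔ v = w := fun v w =>
    ((smul_right_injective _ (inv_ne_zero hε.ne')).eq_iff).trans L.injective.eq_iff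
  set dir : ℝ × ℝ → ℝ × ℝ := fun w => ε⁻¹ • L (D (θ.symm w))
  have hdir : ∀ y ∈ C.φ.source, dir (θ y) = ε⁻¹ • L (D y) := fun y hy => by
    simp only [dir]
    rw [θ.left_inv (by rwa [hsrc])]
  have hline : ∀ y ∈ C.φ.source, ∀ z, ∀ s : ℝ, θ z = θ y + s • dir (θ y) ↔
      klein (C.φ z) = klein (C.φ y) + s • D y := fun y hy z s => by
    have : θ y + s • dir (θ y) = ε⁻¹ • L (klein (C.φ y) - v₀ + s • D y) := by
      rw [hdir y hy, hθ, map_add, map_smul, smul_add, smul_comm s]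
    rw [this, hθ, hinj, sub_eq_iff_eq_add]
    refine Eq.congr_right ?_
    abel
  have hx0 : θ x = 0 := by rw [hθ, sub_self, map_zero, smul_zero]
  refine ⟨θ, dir, by rwa [hsrc], hx0, ?_, ?_, fun y hy hyP => ?_⟩
  · intro w hw
    refine hball ?_
    rw [mem_ball_zero_iff] at hw
    change (ε⁻¹)⁻¹ • w ∈ Metric.ball (0 : ℝ × ℝ) ε
    rw [mem_ball_zero_iff, norm_smul, inv_inv, Real.norm_of_nonneg hε.le]
    nlinarith
  · have h1 := hL 0 1
    rw [zero_smul, one_smul, zero_add] at h1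
    rw [← hx0, hdir x hC, h1]
    simp
  · rw [hsrc] at hy
    obtain ⟨h1, h2, h3⟩ := hD y hyP hy
    refine ⟨?_, fun γ t₀ hγ hγy => ?_, fun γ hγ t₀ hγy z hz s hs => ?_⟩
    · rw [hdir y hy]
      exact smul_ne_zero (inv_ne_zero hε.ne') ((map_ne_zero_iff L L.injective).2 h1)
    · filter_upwards [h2 γ t₀ hγ hγy] with t ht
      obtain ⟨-, s, hs⟩ := ht
      exact ⟨s, (hline y hy _ s).2 hs⟩
    · rw [hsrc] at hz
      obtain ⟨h4, k, hk⟩ := h3 γ hγ t₀ hγy z hz s ((hline y hy z s).1 hs)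
      refine ⟨h4, k, ?_⟩
      rw [hdir z hz, hdir y hy, hk, map_smul, smul_comm]

/-- The leaves of the pleating locus: the complete geodesics in the pleating locus which are mapped
to geodesics. -/
def pleatingLeaves (f : S → N) : Set (Set S) :=
  {l | ∃ γ : ℝ → S, (∀ t, IsStraightAt f γ t) ∧ γ 0 ∈ pleatingLocus f ∧ range γ = l}

theorem IsPleatedSurface.range_subset_pleatingLocus (hf : IsPleatedSurface f) {γ : ℝ → S}
    (hγ : ∀ t, IsStraightAt f γ t) {t₀ : ℝ} (h0 : γ t₀ ∈ pleatingLocus f) :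
    range γ ⊆ pleatingLocus f := by
  rintro _ ⟨t, rfl⟩
  exact hf.mem_pleatingLocus_of_straight isPreconnected_univ (fun t _ => hγ t) (mem_univ t₀) h0 _
    (mem_univ _)

theorem IsPleatedSurface.pairwiseDisjoint_pleatingLeaves (hf : IsPleatedSurface f) :
    (pleatingLeaves f).PairwiseDisjoint id := by
  rintro _ ⟨γ, hγ, hγ0, rfl⟩ _ ⟨γ', hγ', -, rfl⟩ hne
  rw [Function.onFun, id, id, Set.disjoint_left]
  rintro _ ⟨t, rfl⟩ ⟨t', heq⟩
  apply hne
  have hS : ∀ {η : ℝ → S}, (∀ t, IsStraightAt f η t) → ∀ (σ : ℝ → ℝ), Isometry σ →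
      ∀ t ∈ (univ : Set ℝ), IsGeodesicAt (fun s => η (σ s)) t :=
    fun hη σ hσ t _ => (hη (σ t)).1.comp_isometry hσ
  have i1 : ∀ t : ℝ, Isometry fun s : ℝ => t + s := isometry_add_left
  have i2 : ∀ t : ℝ, Isometry fun s : ℝ => t + -s := fun t =>
    (isometry_add_left t).comp (IsometryEquiv.neg ℝ).isometry
  rcases sameGerm_of_isStraightAt (hγ t) (hγ' t') heq.symm
    (hf.range_subset_pleatingLocus hγ hγ0 ⟨t, rfl⟩) with h | h
  · have key : ∀ s, γ (t + s) = γ' (t' + s) := fun s =>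
      (eventuallyEq_of_isGeodesicAt 2 isPreconnected_univ (hS hγ _ (i1 t)) (hS hγ' _ (i1 t'))
        (mem_univ 0) h s (mem_univ s)).self_of_nhds
    apply Subset.antisymm
    · rintro _ ⟨s, rfl⟩
      exact ⟨t' + (s - t), by rw [← key (s - t), add_sub_cancel]⟩
    · rintro _ ⟨s, rfl⟩
      exact ⟨t + (s - t'), by rw [key (s - t'), add_sub_cancel]⟩
  · have key : ∀ s, γ (t + s) = γ' (t' + -s) := fun s =>
      (eventuallyEq_of_isGeodesicAt 2 isPreconnected_univ (hS hγ _ (i1 t)) (hS hγ' _ (i2 t'))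
        (mem_univ 0) h s (mem_univ s)).self_of_nhds
    apply Subset.antisymm
    · rintro _ ⟨s, rfl⟩
      exact ⟨t' + -(s - t), by rw [← key (s - t), add_sub_cancel]⟩
    · rintro _ ⟨s, rfl⟩
      exact ⟨t + (t' - s), by rw [key (t' - s)]; congr 1; ring⟩

/-- The straightening of the pleating locus in the Klein model, restricted to a rectangle which is
then identified with the plane, is a foliation chart. -/
theorem IsPleatedSurface.exists_laminationChart [CompleteSpace S] (hf : IsPleatedSurface f) {x : S}
    (hx : x ∈ pleatingLocus f) : ∃ e : OpenPartialHomeomorph S (ℝ × ℝ),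
      x ∈ e.source ∧ IsLaminationChart (pleatingLocus f) (pleatingLeaves f) e := by
  obtain ⟨θ, dir, hxθ, hx0, hball, hdir0, hθ⟩ := exists_boxChart hf hx
  set K : Set (ℝ × ℝ) := {w | w ∈ θ.target ∧ θ.symm w ∈ pleatingLocus f}
  obtain ⟨Φ, B, hΦ0, hΦ⟩ := exists_straightening (K := K) (dir := dir)
    ⟨hball (Metric.mem_ball_self one_pos), by rwa [← hx0, θ.left_inv hxθ]⟩ hdir0
    (fun w hw _ => by
      have := (hθ _ (θ.map_target hw.1) hw.2).1
      rwa [θ.right_inv hw.1] at this)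
    (fun w hw _ t ht => by
      obtain ⟨γ, hγ0, hγ⟩ := hf.exists_complete_straight hw.2
      have h1 := (hθ _ (θ.map_target hw.1) hw.2).2.2 γ hγ 0 hγ0 _ (θ.map_target (hball ht)) t
        (by rw [θ.right_inv (hball ht), θ.right_inv hw.1])
      rw [θ.right_inv (hball ht), θ.right_inv hw.1] at h1
      exact ⟨⟨hball ht, hf.range_subset_pleatingLocus hγ (by rw [hγ0]; exact hw.2) h1.1⟩, h1.2⟩)
  let ρ₁ := OpenPartialHomeomorph.univBall (0 : ℝ) (1 / 8)
  let ρ₂ := OpenPartialHomeomorph.univBall (0 : ℝ) (1 / 2)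
  have hρ₁ : ρ₁.target = Metric.ball 0 (1 / 8) :=
    OpenPartialHomeomorph.univBall_target _ (by norm_num)
  have hρ₂ : ρ₂.target = Metric.ball 0 (1 / 2) :=
    OpenPartialHomeomorph.univBall_target _ (by norm_num)
  have hs₁ : ρ₁.source = univ := OpenPartialHomeomorph.univBall_source _ _
  have hs₂ : ρ₂.source = univ := OpenPartialHomeomorph.univBall_source _ _
  let e : OpenPartialHomeomorph S (ℝ × ℝ) :=
    (θ.transHomeomorph Φ.symm).trans (ρ₁.prod ρ₂).symm
  set c : S → ℝ × ℝ := fun p => Φ.symm (θ p)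
  have hΦc : ∀ p, Φ (c p) = θ p := fun p => Φ.apply_symm_apply _
  have hsrc : ∀ p, p ∈ e.source ↔ p ∈ θ.source ∧ |(c p).1| < 1 / 8 ∧ |(c p).2| < 1 / 2 := by
    intro p
    have : p ∈ e.source ↔ p ∈ θ.source ∧ (c p).1 ∈ ρ₁.target ∧ (c p).2 ∈ ρ₂.target := Iff.rfl
    rw [this, hρ₁, hρ₂, mem_ball_zero_iff, mem_ball_zero_iff, Real.norm_eq_abs, Real.norm_eq_abs]
  have hfst : ∀ p, (e p).1 = ρ₁.symm (c p).1 := fun p => rfl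
  have hfst' : ∀ p ∈ e.source, ρ₁ (e p).1 = (c p).1 := fun p hp => by
    rw [hfst]
    refine ρ₁.right_inv ?_
    rw [hρ₁, mem_ball_zero_iff, Real.norm_eq_abs]
    exact ((hsrc p).1 hp).2.1
  have hmem : ∀ p ∈ e.source, p ∈ pleatingLocus f ↔ (c p).1 ∈ B := fun p hp => by
    obtain ⟨h1, h2, h3⟩ := (hsrc p).1 hp
    have := (hΦ (c p) h2 h3).2.1
    rw [hΦc] at this
    rw [← this]
    simp only [K, Set.mem_ofPred_eq, θ.left_inv h1, θ.map_source h1, true_and]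
  have hplaque : ∀ p ∈ e.source, p ∈ pleatingLocus f → ∀ q ∈ e.source,
      ((e q).1 = (e p).1 ↔ ∃ t : ℝ, θ q = θ p + t • dir (θ p)) := fun p hp hpP q hq => by
    obtain ⟨h1, h2, h3⟩ := (hsrc p).1 hp
    have := (hΦ (c p) h2 h3).2.2 ((hmem p hp).1 hpP) (c q) ((hsrc q).1 hq).2.2
    rw [hΦc, hΦc] at this
    rw [← this]
    exact ⟨fun h => by rw [← hfst' p hp, ← hfst' q hq, h], fun h => by rw [hfst, hfst, h]⟩
  have htarget : e.target = univ := by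
    refine eq_univ_of_forall fun w => ?_
    have h0 : w ∈ (ρ₁.prod ρ₂).source := by
      rw [OpenPartialHomeomorph.prod_source, hs₁, hs₂, univ_prod_univ]; trivial
    have h1 := (ρ₁.prod ρ₂).map_source h0
    rw [OpenPartialHomeomorph.prod_target, hρ₁, hρ₂] at h1
    have h2 := hball (hΦ (ρ₁ w.1, ρ₂ w.2) (mem_ball_zero_iff.1 h1.1) (mem_ball_zero_iff.1 h1.2)).1
    exact ⟨h0, h2⟩
  have hxe : x ∈ e.source := by
    have : c x = 0 := Φ.injective (by rw [hΦc, hx0, hΦ0])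
    rw [hsrc, this]
    simp [hxθ]
  refine ⟨e, hxe, htarget, ⟨ρ₁ ⁻¹' B, fun p hp => ?_⟩, ?_⟩
  · rw [mem_preimage, hfst' p hp, hmem p hp]
  rintro _ ⟨γ, hγ, hγ0, rfl⟩ p ⟨hpγ, hp⟩
  have hsub := hf.range_subset_pleatingLocus hγ hγ0
  have hpP := hsub hpγ
  apply Subset.antisymm
  · -- a leaf meets only countably many plaques, hence a connected subset meets only one
    set A := connectedComponentIn (range γ ∩ e.source) p
    have hA : A ⊆ range γ ∩ e.source := connectedComponentIn_subset _ _
    have hpA : p ∈ A := mem_connectedComponentIn ⟨hpγ, hp⟩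
    have hcount : ((fun q => (e q).1) '' A).Countable := by
      refine (countable_range fun r : ℚ => (e (γ r)).1).mono ?_
      rintro _ ⟨q, hq, rfl⟩
      obtain ⟨⟨t, rfl⟩, hte⟩ := hA hq
      have hev : ∀ᶠ s in 𝓝 t, γ s ∈ e.source ∧ ∃ u : ℝ, θ (γ s) = θ (γ t) + u • dir (θ (γ t)) :=
        ((hγ t).1.continuousAt.eventually (e.open_source.mem_nhds hte)).and
          ((hθ _ ((hsrc _).1 hte).1 (hsub ⟨t, rfl⟩)).2.1 γ t (hγ t) rfl)
      obtain ⟨_, ⟨r, rfl⟩, hr1, hr2⟩ := Rat.denseRange_cast.inter_nhds_nonempty hev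
      exact ⟨r, (hplaque _ hte (hsub ⟨t, rfl⟩) _ hr1).2 hr2⟩
    have hconn : IsPreconnected ((fun q => (e q).1) '' A) :=
      isPreconnected_connectedComponentIn.image _
        (continuous_fst.comp_continuousOn (e.continuousOn.mono fun q hq => (hA hq).2))
    have hss := hcount.isTotallyDisconnected _ Subset.rfl hconn
    exact fun q hq => ⟨(hA hq).2, hss (mem_image_of_mem _ hq) (mem_image_of_mem _ hpA)⟩
  · have himage : {q | q ∈ e.source ∧ (e q).1 = (e p).1} =
        e.symm '' ({(e p).1} ×ˢ univ) := by
      ext q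
      constructor
      · rintro ⟨h1, h2⟩
        exact ⟨e q, ⟨h2, mem_univ _⟩, e.left_inv h1⟩
      · rintro ⟨w, ⟨hw, -⟩, rfl⟩
        have hwt : w ∈ e.target := by rw [htarget]; trivial
        exact ⟨e.map_target hwt, by rw [e.right_inv hwt]; exact hw⟩
    have hconn : IsPreconnected {q | q ∈ e.source ∧ (e q).1 = (e p).1} := by
      rw [himage]
      refine (isPreconnected_singleton.prod isPreconnected_univ).image _
        (e.continuousOn_symm.mono ?_)
      rw [htarget]
      exact subset_univ _
    refine hconn.subset_connectedComponentIn ⟨hp, rfl⟩ fun q hq => ⟨?_, hq.1⟩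
    obtain ⟨t, ht⟩ := (hplaque p hp hpP q hq.1).1 hq.2
    obtain ⟨t₀, ht₀⟩ := hpγ
    exact ((hθ p ((hsrc p).1 hp).1 hpP).2.2 γ hγ t₀ ht₀ q ((hsrc q).1 hq.1).1 t ht).1

/-- The pleating locus as a geodesic lamination. -/
def pleatingLamination [CompleteSpace S] (hf : IsPleatedSurface f) : GeodesicLamination S where
  support := pleatingLocus f
  leaves := pleatingLeaves f
  isClosed_support := hf.isClosed_pleatingLocus
  sUnion_leaves := by
    apply Subset.antisymm
    · rintro x ⟨_, ⟨γ, hγ, hγ0, rfl⟩, hx⟩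
      exact hf.range_subset_pleatingLocus hγ hγ0 hx
    · intro x hx
      obtain ⟨γ, hγ0, hγ⟩ := hf.exists_complete_straight hx
      exact ⟨range γ, ⟨γ, hγ, by rwa [hγ0], rfl⟩, 0, hγ0⟩
  pairwiseDisjoint_leaves := hf.pairwiseDisjoint_pleatingLeaves
  exists_geodesic := by
    rintro _ ⟨γ, hγ, -, rfl⟩
    exact ⟨γ, (isGeodesicOn_iff_of_isOpen isOpen_univ).2 fun t _ => (hγ t).1, rfl⟩
  exists_chart _ hx := hf.exists_laminationChart hx

end FoliationCharts

end PleatedSurfaces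

theorem mainTheorem12 {S N : Type*} [EMetricSpace S] [EMetricSpace N]
    [PleatedSurfaces.IsHyperbolicManifold 2 S] [CompleteSpace S]
    [PleatedSurfaces.IsHyperbolicManifold 3 N]
    (f : S → N) (hf : PleatedSurfaces.IsPleatedSurface f) :
    ∃ Λ : PleatedSurfaces.GeodesicLamination S,
      Λ.support = PleatedSurfaces.pleatingLocus f ∧
      ∀ l ∈ Λ.leaves, ∃ γ : ℝ → S, PleatedSurfaces.IsGeodesicOn γ univ ∧
        PleatedSurfaces.IsGeodesicOn (f ∘ γ) univ ∧ range γ = l := by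
  refine ⟨PleatedSurfaces.pleatingLamination hf, rfl, ?_⟩
  rintro _ ⟨γ, hγ, -, rfl⟩
  exact ⟨γ, (PleatedSurfaces.isGeodesicOn_iff_of_isOpen isOpen_univ).2 fun t _ => (hγ t).1,
    (PleatedSurfaces.isGeodesicOn_iff_of_isOpen isOpen_univ).2 fun t _ => (hγ t).2, rfl⟩
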